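/- Let $g:(0,\infty)\to\mathbb R$ be bounded and completely monotone ($g\in C^\infty(0,\infty)$ and $(-1)^n g^{(n)}\ge 0$ for all $n\ge 0$), and write $g^{(j)}(0):=\lim_{z\to 0+}g^{(j)}(z)$. Assume $g\in\mathcal B_4$, that is, $g(0)=1$, $g'(0)=-1$, $g''(0)<\infty$ and $g^{(4)}(0)<\infty$, and assume that $g\in L^k(0,\infty)$ for some integer $k\ge 1$. Then $g(z)=\int_{[0,\infty)}e^{-zs}\,\nu(ds)$, $z>0$, for a finite positive Borel measure $\nu$ on $[0,\infty)$. Put $$G(s)=\int_{[0,s]}(s-\tau)\,\nu(d\tau)\quad(0\le s\le 1),\qquad G(s)=\int_{[s,\infty)}(\tau-s)\,\nu(d\tau)\quad(s>1),$$ $$a[g]=\frac{g''(0)-1}{2},\qquad b[g]=\int_0^\infty(1-s)G(s)\,ds,\qquad d_1[g]=\int_0^\infty\frac{(1-s)^2(1+s)}{s^2}\,G(s)\,ds,$$ where the integrals $b[g]$ and $d_1[g]$ converge absolutely. There is a constant $C(g)>0$, depending only on $g$, such that the following holds for every complex Banach space $X$, every sectorially bounded holomorphic $C_0$-semigroup $(e^{-tA})_{t\ge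 0}$ on $X$ with generator $-A$, and every $\alpha\in[0,1]$. (Sectorially bounded holomorphic means that for some $\theta\in(0,\pi/2]$ the semigroup extends holomorphically to $\{\lambda\ne 0:|\arg\lambda|<\theta\}$, and the extension is bounded and strongly continuous on $\overline{\{\lambda\neq 0:|\arg\lambda|<\xi\}}$ for every $\xi\in(0,\theta)$.) Here $g(rA)x=\int e^{-rsA}x\,\nu(ds)$ for $r\ge 0$, and fractional powers $A^\beta$, $\beta\ge0$, are taken in the extended Hille--Phillips calculus: $x\in\mathrm{dom}(A^\beta)$ and $A^\beta x=y$ if and only if $e(A)y=(z^\beta e)(A)x$ for some $e$ such that $e$ and $z^\beta e$ are Laplace transforms of bounded complex Borel measures on $[0,\infty)$ and $e(A)$ is injective. For $\beta\in\{3-\alpha,4-\alpha\}$ the operators $A^\beta e^{-tA}$, $t>0$, are defined on all of $X$ and $M_\beta:=\sup_{t>0}\|t^\beta A^\beta e^{-tA}\|<\infty$. For every $x\in\mathrm{dom}(A^\alpha)$, $$\bigl\|g(A)x-e^{-A}x-a[g]\,A^2e^{-A}x\bigr\|\le\Bigl(|b[g]|\,M_{3-\alpha}+\tfrac12 d_1[g]\,M_{4-\alpha}\Bigr)\|A^\alpha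 x\|,$$ and for all integers $n\ge 1$ and all $t>0$, $$\bigl\|g^n(tA/n)x-e^{-tA}x-a[g]\,n^{-1}t^2A^2e^{-tA}x\bigr\|\le C(g)\,\bigl(M_{3-\alpha}+M_{4-\alpha}\bigr)\frac{t^\alpha}{n^2}\,\|A^\alpha x\|,$$ where $g^n(tA/n)=(g(tA/n))^n$; in particular $e^{-tA}x\in\mathrm{dom}(A^2)$ for $t>0$. -/

import Mathlib

open scoped ContDiff Topology

universe u

noncomputable section

namespace SemigroupApprox

open Set Filter MeasureTheory

/-! ### Completely monotone functions on `(0, ∞)` -/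

/-- `g` is completely monotone: smooth on `(0, ∞)` with `(-1)ⁿ g⁽ⁿ⁾ ≥ 0` there for all `n ≥ 0`.
Only the values of `g` on `(0, ∞)` matter. -/
def CompletelyMonotone (g : ℝ → ℝ) : Prop :=
  ContDiffOn ℝ ∞ g (Ioi 0) ∧ ∀ n : ℕ, ∀ z : ℝ, 0 < z → 0 ≤ (-1 : ℝ) ^ n * iteratedDeriv n g z

/-- Bounded completely monotone functions. -/
def BM : Set (ℝ → ℝ) :=
  {g | CompletelyMonotone g ∧ ∃ c : ℝ, ∀ z : ℝ, 0 < z → g z ≤ c}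

/-- `g⁽ᵏ⁾(0) = l`, where `g⁽ᵏ⁾(0)` is the limit of `g⁽ᵏ⁾(z)` as `z → 0+`. -/
def HasDerivZero (g : ℝ → ℝ) (k : ℕ) (l : ℝ) : Prop :=
  Tendsto (iteratedDeriv k g) (𝓝[>] 0) (𝓝 l)

/-- The number `g⁽ᵏ⁾(0)`, used only where the limit exists and is finite. -/
def derivZero (g : ℝ → ℝ) (k : ℕ) : ℝ :=
  limUnder (𝓝[>] (0 : ℝ)) (iteratedDeriv k g)

/-- The class `B₁`: bounded completely monotone with `g(0) = 1`, `g'(0) = -1`. -/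
def B₁ : Set (ℝ → ℝ) := {g | g ∈ BM ∧ HasDerivZero g 0 1 ∧ HasDerivZero g 1 (-1)}

/-- The class `B₂`: elements of `B₁` with `g''(0)` finite. -/
def B₂ : Set (ℝ → ℝ) := {g | g ∈ B₁ ∧ ∃ l : ℝ, HasDerivZero g 2 l}

/-- The class `B₄`: elements of `B₂` with `g''''(0)` finite. -/
def B₄ : Set (ℝ → ℝ) := {g | g ∈ B₂ ∧ ∃ l : ℝ, HasDerivZero g 4 l}

/-- `g ∼ ν`: the function `g` on `(0, ∞)` is the Laplace transform of the finite positive Borel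
measure `ν` on `[0, ∞)` (viewed as a measure on `ℝ` that does not charge `(-∞, 0)`). -/
def Represents (g : ℝ → ℝ) (ν : Measure ℝ) : Prop :=
  IsFiniteMeasure ν ∧ ν (Iio 0) = 0 ∧ ∀ z : ℝ, 0 < z → g z = ∫ s, Real.exp (-(z * s)) ∂ν

/-- The density `G` attached to `g ∼ ν`. -/
def densG (ν : Measure ℝ) (s : ℝ) : ℝ :=
  if s ≤ 1 then ∫ τ in Icc 0 s, (s - τ) ∂ν else ∫ τ in Ici s, (τ - s) ∂ν

/-- `a[g] = (g''(0) - 1) / 2`. -/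
def aCoeff (g : ℝ → ℝ) : ℝ := (derivZero g 2 - 1) / 2

/-- The integrand of `b[g]`. -/
def bIntegrand (ν : Measure ℝ) (s : ℝ) : ℝ := (1 - s) * densG ν s

/-- `b[g] = ∫₀^∞ (1 - s) G(s) ds`. -/
def bCoeff (ν : Measure ℝ) : ℝ := ∫ s in Ioi (0 : ℝ), bIntegrand ν s

/-- The integrand of `d₁[g]`. -/
def dIntegrand (ν : Measure ℝ) (s : ℝ) : ℝ := (1 - s) ^ 2 * (1 + s) / s ^ 2 * densG ν s

/-- `d₁[g] = ∫₀^∞ (1 - s)² (1 + s) s⁻² G(s) ds`. -/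
def dCoeff (ν : Measure ℝ) : ℝ := ∫ s in Ioi (0 : ℝ), dIntegrand ν s

/-! ### Semigroups -/

/-- The open sector `{z ≠ 0 : |arg z| < θ}`. -/
def sector (θ : ℝ) : Set ℂ := {z | z ≠ 0 ∧ |z.arg| < θ}

section Semigroups

variable {X : Type*} [NormedAddCommGroup X] [NormedSpace ℂ X]

/-- A `C₀`-semigroup `(T t)_{t ≥ 0}`; the values of `T` at negative times play no role. -/
def IsC0Semigroup (T : ℝ → X →L[ℂ] X) : Prop :=
  T 0 = ContinuousLinearMap.id ℂ X ∧
  (∀ s t : ℝ, 0 ≤ s → 0 ≤ t → T (s + t) = (T s).comp (T t)) ∧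
  ∀ x : X, ContinuousOn (fun t => T t x) (Ici 0)

/-- `-A` is the generator of `T`: `x ∈ dom A` with `A x = y` iff
`(x - T t x) / t → y` as `t → 0+`. -/
def IsNegGenerator (T : ℝ → X →L[ℂ] X) (A : X →ₗ.[ℂ] X) : Prop :=
  ∀ x y : X, (x, y) ∈ A.graph ↔ Tendsto (fun t : ℝ => t⁻¹ • (x - T t x)) (𝓝[>] 0) (𝓝 y)

/-- A sectorially bounded holomorphic `C₀`-semigroup: it extends holomorphically to a sector of
some angle `θ ∈ (0, π/2]`, and the extension is bounded and strongly continuous on every closed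
sector of angle `ξ` with `0 < ξ < θ`. -/
def IsSectBddHolomorphic (T : ℝ → X →L[ℂ] X) : Prop :=
  IsC0Semigroup T ∧
  ∃ θ : ℝ, 0 < θ ∧ θ ≤ Real.pi / 2 ∧
    ∃ S : ℂ → X →L[ℂ] X,
      (∀ t : ℝ, 0 ≤ t → S (t : ℂ) = T t) ∧
      DifferentiableOn ℂ S (sector θ) ∧
      ∀ ξ : ℝ, 0 < ξ → ξ < θ →
        (∃ c : ℝ, ∀ z ∈ closure (sector ξ), ‖S z‖ ≤ c) ∧
        ∀ x : X, ContinuousOn (fun z => S z x) (closure (sector ξ))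

/-! ### Hille-Phillips calculus

A bounded complex Borel measure on `[0, ∞)` is written as `h ν` with `ν` a finite positive measure
and `h` a `ν`-integrable complex density (polar decomposition). -/

/-- On the open right half-plane, `f` is the Laplace transform of the complex measure `h ν` on
`[0, ∞)`. -/
def IsLaplace (f : ℂ → ℂ) (ν : Measure ℝ) (h : ℝ → ℂ) : Prop :=
  IsFiniteMeasure ν ∧ ν (Iio 0) = 0 ∧ Integrable h ν ∧
  ∀ z : ℂ, 0 < z.re → f z = ∫ s, Complex.exp (-(z * (s : ℂ))) * h s ∂ν

/-- `f(A) x = ∫ T(s) x h(s) ν(ds)` for `f` the Laplace transform of the complex measure `h ν`. -/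
def hpComplex (T : ℝ → X →L[ℂ] X) (ν : Measure ℝ) (h : ℝ → ℂ) (x : X) : X :=
  ∫ s, h s • T s x ∂ν

/-- `g(rA) x = ∫ T(r s) x ν(ds)` for `g ∼ ν` and `r ≥ 0`. -/
def hp (T : ℝ → X →L[ℂ] X) (ν : Measure ℝ) (r : ℝ) (x : X) : X :=
  ∫ s, T (r * s) x ∂ν

/-- The graph of `f(A)` in the extended Hille-Phillips calculus: for `f` holomorphic on the right
half-plane and a regularizer `e` (`e` and `e f` Laplace transforms of complex measures, `e(A)`
injective), `f(A) x = y` means `e(A) y = (e f)(A) x`. -/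
def extHPGraph (T : ℝ → X →L[ℂ] X) (f : ℂ → ℂ) : Set (X × X) :=
  {p | DifferentiableOn ℂ f {z | 0 < z.re} ∧
    ∃ (e : ℂ → ℂ) (ν : Measure ℝ) (h : ℝ → ℂ) (μ : Measure ℝ) (k : ℝ → ℂ),
      IsLaplace e ν h ∧ IsLaplace (fun z => e z * f z) μ k ∧
      Function.Injective (hpComplex T ν h) ∧ hpComplex T ν h p.2 = hpComplex T μ k p.1}

/-- The graph of the fractional power `A ^ β`. -/
def fracPowGraph (T : ℝ → X →L[ℂ] X) (β : ℝ) : Set (X × X) :=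
  extHPGraph T (fun z => z ^ (β : ℂ))

/-- The numbers `‖t ^ β A ^ β e^{-tA} x‖` with `t > 0` and `‖x‖ ≤ 1`. -/
def powBoundSet (T : ℝ → X →L[ℂ] X) (β : ℝ) : Set ℝ :=
  {r | ∃ (t : ℝ) (x y : X), 0 < t ∧ ‖x‖ ≤ 1 ∧ (T t x, y) ∈ fracPowGraph T β ∧ r = t ^ β * ‖y‖}

/-- `M_β = sup_{t > 0} ‖t ^ β A ^ β e^{-tA}‖`. -/
def powBound (T : ℝ → X →L[ℂ] X) (β : ℝ) : ℝ := sSup (powBoundSet T β)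

end Semigroups

end SemigroupApprox

end

/-! The measure `ν` has mass and mean one and a finite fourth moment, because these are read off
from `g` and its derivatives at zero (`Represents.moment`). Integrability of a power of `g` forces a
power decay of `g` at infinity, so `ν` has no atom at 0 (`Represents.isNormalized`).

Put `F(s) = e^{-tsA} x`. Taylor's formula at `s = 1` with the Peano kernel, integrated against `ν`,
loses its linear term because the mean is one, and `G` is the average of the kernel. Hence `g(tA)x -
e^{-tA}x = ∫ G F''`. A second expansion, of `F''` at 1, gives three terms: `F''(1) ∫ G`, which is
the term with `a[g]`; `-b[g] F'''(1)`; and a remainder with `F''''`. Since `A^4 e^{-rtA} x = A^{4-α}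
e^{-rtA} A^α x`, the norm of `F''''(r)` is at most a constant times `r^{α-4}`, hence `r^{-4}` for `r
≤ 1` and `r^{-3}` for `r ≥ 1`. Integrated against the kernel, these majorants stay below half the
weight in `d₁[g]` (`IsNormalized.norm_integral_sub_le`).

The operator `g^n(tA/n)` averages `e^{-tsA}` over the law of the mean of `n` independent variables
of law `ν` (`IsBddSemigroup.iterate_hp_div`), so the same estimate applies to that law. Its variance
is of order `1/n`, which gives the correction term. Its third and fourth centred moments are of
order `1/n²`. The coefficient `d₁` also sees the mass near zero, where its weight blows up like
`s^{-2}`. Chernoff's bound gives both exponential decay in `n` and power decay in `s`, and the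
geometric mean of the two suffices (`IsNormalized.exists_dCoeff_meanLaw_le`).

Existence of `ν` is Bernstein's theorem, proved here through a Hausdorff moment problem
(`IsCMChain.exists_represents`). Operator identities reduce to identities of functions, because the
Laplace transform is injective (`IsBddSemigroup.isHP_unique`). Finiteness of `M_β` follows from
Cauchy's estimates for integer powers and from a splitting of the Lévy integral for `z^{1-α}`
(`IsSmoothing.exists_regularized`). -/

namespace SemigroupApprox

open Set Filter MeasureTheory

noncomputable section

/-! ### Bernstein's theorem -/

/-- `φ` is the head of a sequence of nonnegative functions, each the negative derivative of its
predecessor on `(0, ∞)`. -/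
def IsCMChain (φ : ℝ → ℝ) : Prop :=
  ∃ f : ℕ → ℝ → ℝ, f 0 = φ ∧ ∀ n : ℕ, ∀ z : ℝ, 0 < z →
    HasDerivAt (f n) (-f (n + 1) z) z ∧ 0 ≤ f n z

/-- Chains replace complete monotonicity below because finite differences act on them termwise, with
no iterated derivatives to compute. -/
lemma CompletelyMonotone.isCMChain {g : ℝ → ℝ} (hg : CompletelyMonotone g) : IsCMChain g := by
  refine ⟨fun n z => (-1) ^ n * iteratedDeriv n g z, by ext; simp, fun n z hz => ⟨?_, hg.2 n z hz⟩⟩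
  have hd : DifferentiableAt ℝ (iteratedDeriv n g) z :=
    ((hg.1.differentiableOn_iteratedDerivWithin
      (by exact_mod_cast ENat.natCast_lt_top n) isOpen_Ioi.uniqueDiffOn).differentiableAt
      (Ioi_mem_nhds hz)).congr_of_eventuallyEq (by
        filter_upwards [Ioi_mem_nhds hz] with w hw
        exact (iteratedDerivWithin_of_isOpen isOpen_Ioi hw).symm)
  have h := (hd.hasDerivAt).const_mul ((-1 : ℝ) ^ n)
  convert! h using 1
  simp only [iteratedDeriv_succ]; ring

lemma IsCMChain.nonneg {φ : ℝ → ℝ} (h : IsCMChain φ) {z : ℝ} (hz : 0 < z) : 0 ≤ φ z := by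
  obtain ⟨f, rfl, hf⟩ := h
  exact (hf 0 z hz).2

lemma IsCMChain.continuousAt {φ : ℝ → ℝ} (h : IsCMChain φ) {z : ℝ} (hz : 0 < z) :
    ContinuousAt φ z := by
  obtain ⟨f, rfl, hf⟩ := h
  exact (hf 0 z hz).1.continuousAt

lemma antitoneOn_of_chain {f : ℕ → ℝ → ℝ} (hf : ∀ n : ℕ, ∀ z : ℝ, 0 < z →
    HasDerivAt (f n) (-f (n + 1) z) z ∧ 0 ≤ f n z) (n : ℕ) : AntitoneOn (f n) (Ioi 0) := by
  refine antitoneOn_of_deriv_nonpos (convex_Ioi 0)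
    (fun z hz => (hf n z hz).1.continuousAt.continuousWithinAt) ?_ ?_
  · rw [interior_Ioi]
    exact fun z hz => (hf n z hz).1.differentiableAt.differentiableWithinAt
  · rw [interior_Ioi]
    intro z hz
    rw [(hf n z hz).1.deriv]
    linarith [(hf (n + 1) z hz).2]

lemma IsCMChain.antitoneOn {φ : ℝ → ℝ} (h : IsCMChain φ) : AntitoneOn φ (Ioi 0) := by
  obtain ⟨f, rfl, hf⟩ := h
  exact antitoneOn_of_chain hf 0

/-- The backward difference `φ(z) - φ(z + h)`. -/
def decrement (h : ℝ) (φ : ℝ → ℝ) (z : ℝ) : ℝ := φ z - φ (z + h)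

/-- Every member of a chain is antitone, its derivative being minus the next nonnegative member, so
its differences are nonnegative. -/
lemma IsCMChain.decrement {φ : ℝ → ℝ} (hφ : IsCMChain φ) {h : ℝ} (hh : 0 < h) :
    IsCMChain (decrement h φ) := by
  obtain ⟨f, rfl, hf⟩ := hφ
  refine ⟨fun n => SemigroupApprox.decrement h (f n), rfl, fun n z hz => ⟨?_, ?_⟩⟩
  · have h1 := (hf n z hz).1
    have h2 := (hf n (z + h) (by positivity)).1.comp_add_const z h
    have := h1.sub h2
    convert! this using 1
    simp only [SemigroupApprox.decrement]; ring
  · have := antitoneOn_of_chain hf n (mem_Ioi.2 hz) (mem_Ioi.2 (add_pos hz hh))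
      (by linarith : z ≤ z + h)
    simp only [SemigroupApprox.decrement]; linarith

lemma IsCMChain.decrement_iterate {φ : ℝ → ℝ} (hφ : IsCMChain φ) {h : ℝ} (hh : 0 < h) (k : ℕ) :
    IsCMChain ((SemigroupApprox.decrement h)^[k] φ) := by
  induction k with
  | zero => simpa
  | succ k ih => rw [Function.iterate_succ_apply']; exact ih.decrement hh

/-! ### Moment functionals and Bernstein polynomials -/

open Polynomial in
/-- The linear functional on polynomials with moments `c`. -/
def momentFunctional (c : ℕ → ℝ) : ℝ[X] →ₗ[ℝ] ℝ :=
  Polynomial.lsum fun n => c n • LinearMap.id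

open Polynomial in
lemma momentFunctional_X_pow (c : ℕ → ℝ) (n : ℕ) : momentFunctional c (X ^ n) = c n := by
  rw [X_pow_eq_monomial, momentFunctional, lsum_apply, sum_monomial_index] <;> simp

open Polynomial in
-- A factor `1 - X` becomes a difference of consecutive moments. The moments start at `φ h` and not
-- at `φ 0`, since `φ` is controlled on the open half-line only.
lemma momentFunctional_mul_one_sub_pow (φ : ℝ → ℝ) (h : ℝ) (k j : ℕ) :
    momentFunctional (fun n => φ ((n + 1) * h)) (X ^ j * (1 - X) ^ k) =
      (decrement h)^[k] φ ((j + 1) * h) := by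
  induction k generalizing j with
  | zero => simp [momentFunctional_X_pow]
  | succ k ih =>
    have : (X : ℝ[X]) ^ j * (1 - X) ^ (k + 1) =
        X ^ j * (1 - X) ^ k - X ^ (j + 1) * (1 - X) ^ k := by ring
    rw [this, map_sub, ih, ih, Function.iterate_succ_apply', decrement]
    congr 2
    push_cast; ring_nf

open Polynomial in
lemma momentFunctional_bernstein_nonneg {φ : ℝ → ℝ} (hφ : IsCMChain φ) {h : ℝ} (hh : 0 < h)
    (N j : ℕ) :
    0 ≤ momentFunctional (fun n => φ ((n + 1) * h)) (bernsteinPolynomial ℝ N j) := by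
  have : bernsteinPolynomial ℝ N j = (N.choose j : ℝ) • (X ^ j * (1 - X) ^ (N - j)) := by
    rw [bernsteinPolynomial, smul_eq_C_mul]; simp [mul_assoc]
  rw [this, map_smul, momentFunctional_mul_one_sub_pow, smul_eq_mul]
  exact mul_nonneg (Nat.cast_nonneg _) ((hφ.decrement_iterate hh _).nonneg (by positivity))

open Polynomial in
-- From `C(N,j) C(j,m) = C(N,m) C(N-m,j-m)` and the partition of unity of degree `N - m`. It gives
-- the exact binomial moments of a discrete measure with Bernstein weights.
lemma sum_choose_smul_bernstein {N m : ℕ} (hm : m ≤ N) :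
    ∑ j ∈ Finset.range (N + 1), (j.choose m : ℝ) • bernsteinPolynomial ℝ N j =
      (N.choose m : ℝ) • X ^ m := by
  have h1 : ∑ j ∈ Finset.range (N + 1), (j.choose m : ℝ) • bernsteinPolynomial ℝ N j =
      ∑ j ∈ Finset.Ico m (N + 1), (j.choose m : ℝ) • bernsteinPolynomial ℝ N j := by
    symm
    apply Finset.sum_subset
    · intro j; simp
    · intro j hj hj'
      simp only [Finset.mem_range, Finset.mem_Ico, not_and_or, not_le, not_lt] at hj hj'
      rw [Nat.choose_eq_zero_of_lt (by omega)]; simp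
  rw [h1, Finset.sum_Ico_eq_sum_range]
  have h2 : ∀ i ∈ Finset.range (N + 1 - m),
      ((m + i).choose m : ℝ) • bernsteinPolynomial ℝ N (m + i) =
      (N.choose m : ℝ) • (X ^ m * bernsteinPolynomial ℝ (N - m) i) := by
    intro i hi
    have h := Nat.choose_mul (n := N) (k := m + i) (s := m) (by omega)
    rw [Nat.add_sub_cancel_left] at h
    have h' : (C (N.choose (m + i) : ℝ)) * C ((m + i).choose m : ℝ) =
        C (N.choose m : ℝ) * C ((N - m).choose i : ℝ) := by
      rw [← C_mul, ← C_mul]; congr 1; exact_mod_cast h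
    simp only [bernsteinPolynomial, smul_eq_C_mul, ← C_eq_natCast] at h' ⊢
    rw [show N - (m + i) = N - m - i by omega, pow_add]
    linear_combination (X ^ m * X ^ i * (1 - X) ^ (N - m - i)) * h'
  rw [Finset.sum_congr rfl h2, ← Finset.smul_sum, ← Finset.mul_sum,
    show N + 1 - m = (N - m) + 1 by omega, bernsteinPolynomial.sum, mul_one]

/-- Both quantities are products of `m` factors in `[0, 1]`, namely `j/N` and `(j-i)/(N-i)`
(truncated at zero). Corresponding factors differ by at most `m₀/(N-m₀)`, and the errors add up. -/
lemma abs_pow_sub_choose_div_le {N m m₀ j : ℕ} (hm : m ≤ m₀) (hN : m₀ < N) (hj : j ≤ N) :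
    |((j : ℝ) / N) ^ m - (j.choose m : ℝ) / N.choose m| ≤ m * ((m₀ : ℝ) / (N - m₀)) := by
  -- Falling factorials obey a one-step recursion; the factor `m!` cancels in the quotient of
  -- binomial coefficients.
  have hkey : ∀ m ≤ m₀, |((j : ℝ) / N) ^ m - (j.descFactorial m : ℝ) / N.descFactorial m| ≤
      m * ((m₀ : ℝ) / (N - m₀)) := by
    intro m hm
    have hN0 : (0 : ℝ) < N := by exact_mod_cast (by omega : 0 < N)
    have hNm : (0 : ℝ) < N - m₀ := by
      have : (m₀ : ℝ) < N := by exact_mod_cast hN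
      linarith
    induction m with
    | zero => simp
    | succ m ih =>
      have ih' := ih (by omega)
      have hNk : (0 : ℝ) < ((N - m : ℕ) : ℝ) := by exact_mod_cast (by omega : 0 < N - m)
      have hNk' : ((N - m : ℕ) : ℝ) = N - m := by push_cast [show m ≤ N by omega]; ring
      rw [Nat.descFactorial_succ, Nat.descFactorial_succ, pow_succ]
      push_cast
      set a := ((j : ℝ) / N) with ha
      set P := a ^ m with hP
      set q := (j.descFactorial m : ℝ) / N.descFactorial m with hq
      set b := ((j - m : ℕ) : ℝ) / ((N - m : ℕ) : ℝ) with hb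
      have e : ((j - m : ℕ) : ℝ) * (j.descFactorial m : ℝ) /
          (((N - m : ℕ) : ℝ) * N.descFactorial m) = b * q := by
        rw [hb, hq]; ring
      have ha1 : a ≤ 1 := by rw [ha, div_le_one hN0]; exact_mod_cast hj
      have ha0 : 0 ≤ a := by positivity
      have hq0 : 0 ≤ q := by positivity
      have hq1 : q ≤ 1 := by
        rw [hq]
        apply div_le_one_of_le₀
        · exact_mod_cast Nat.descFactorial_le m hj
        · positivity
      have hab : |a - b| ≤ (m₀ : ℝ) / (N - m₀) := by
        have hmm : (m : ℝ) + 1 ≤ m₀ := by exact_mod_cast hm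
        rcases le_total m j with hmj | hmj
        · have hb' : b = (j - m) / (N - m) := by rw [hb, hNk']; push_cast [hmj]; ring
          rw [hNk'] at hNk
          have : a - b = m * (N - j) / (N * (N - m)) := by
            rw [ha, hb']; field_simp; ring
          have hjN : (j : ℝ) ≤ N := by exact_mod_cast hj
          rw [this, abs_of_nonneg (div_nonneg (mul_nonneg (by positivity) (by linarith)) (by positivity))]
          rw [div_le_div_iff₀ (by positivity) hNm]
          have h1 : (m : ℝ) * (N - j) ≤ m₀ * N := by
            apply mul_le_mul <;> linarith
          have h2 : (N : ℝ) - m₀ ≤ N - m := by linarith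
          calc (m : ℝ) * (N - j) * (N - m₀) ≤ (m₀ * N) * (N - m) := by
                apply mul_le_mul h1 h2 hNm.le (by positivity)
            _ = _ := by ring
        · have hb' : b = 0 := by rw [hb, Nat.sub_eq_zero_of_le hmj]; simp
          rw [hb', sub_zero, abs_of_nonneg ha0, ha, div_le_div_iff₀ hN0 hNm]
          have hjm : (j : ℝ) ≤ m := by exact_mod_cast hmj
          apply mul_le_mul <;> first | positivity | linarith
      rw [e, show P * a - b * q = a * (P - q) + q * (a - b) by ring]
      calc |a * (P - q) + q * (a - b)| ≤ |a * (P - q)| + |q * (a - b)| := abs_add_le _ _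
        _ ≤ 1 * |P - q| + 1 * |a - b| := by
          rw [abs_mul, abs_mul, abs_of_nonneg ha0, abs_of_nonneg hq0]
          gcongr
        _ ≤ _ := by linarith
  have h := hkey m hm
  rw [Nat.descFactorial_eq_factorial_mul_choose, Nat.descFactorial_eq_factorial_mul_choose] at h
  push_cast at h
  rwa [mul_div_mul_left _ _ (by exact_mod_cast m.factorial_ne_zero)] at h

/-- Approximate solution of a Hausdorff moment problem. -/
lemma exists_probability_moments {φ : ℝ → ℝ} (hφ : IsCMChain φ) {h : ℝ} (hh : 0 < h)
    (hpos : 0 < φ h) (m₀ : ℕ) {ε : ℝ} (hε : 0 < ε) :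
    ∃ μ : ProbabilityMeasure (Icc (0 : ℝ) 1), ∀ m ≤ m₀,
      |∫ x, (x : ℝ) ^ m ∂(μ : Measure (Icc (0 : ℝ) 1)) - φ ((m + 1) * h) / φ h| < ε := by
  set c : ℕ → ℝ := fun n => φ ((n + 1) * h) with hc
  have hc0 : c 0 = φ h := by simp [hc]
  obtain ⟨N, hN1, hN2⟩ : ∃ N : ℕ, m₀ < N ∧ (m₀ : ℝ) * (m₀ / (N - m₀)) < ε := by
    obtain ⟨K, hK⟩ := exists_nat_gt ((m₀ : ℝ) * m₀ / ε)
    refine ⟨m₀ + K + 1, by omega, ?_⟩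
    have hK1 : (0 : ℝ) < K + 1 := by positivity
    push_cast
    rw [show (m₀ : ℝ) + K + 1 - m₀ = K + 1 by ring, ← mul_div_assoc, div_lt_iff₀ hK1]
    rw [div_lt_iff₀ hε] at hK
    nlinarith
  have hN0 : (0 : ℝ) < N := by exact_mod_cast (by omega : 0 < N)
  -- Bernstein weights, placed below at the points `j/N`. They are nonnegative by complete
  -- monotonicity, and division by `φ h = c 0` makes their sum one.
  set w : ℕ → ℝ := fun j => momentFunctional c (bernsteinPolynomial ℝ N j) / φ h with hw
  have hw0 : ∀ j, 0 ≤ w j := fun j =>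
    div_nonneg (momentFunctional_bernstein_nonneg hφ hh N j) hpos.le
  have hmom : ∀ m ≤ N, ∑ j ∈ Finset.range (N + 1), (j.choose m : ℝ) * w j =
      N.choose m * (c m / φ h) := by
    intro m hm
    have := congrArg (momentFunctional c) (sum_choose_smul_bernstein hm)
    rw [map_sum, map_smul, momentFunctional_X_pow] at this
    simp only [map_smul, smul_eq_mul] at this
    rw [← mul_div_assoc, ← this, Finset.sum_div]
    simp only [hw, mul_div_assoc]
  have hw1 : ∑ j ∈ Finset.range (N + 1), w j = 1 := by
    have := hmom 0 (by omega)
    simpa [hc0, hpos.ne'] using this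
  let pt : ℕ → Icc (0 : ℝ) 1 := fun j =>
    if hj : j ≤ N then ⟨(j : ℝ) / N, by positivity,
      div_le_one_of_le₀ (by exact_mod_cast hj) hN0.le⟩ else ⟨0, by simp⟩
  let μ : Measure (Icc (0 : ℝ) 1) :=
    ∑ j ∈ Finset.range (N + 1), ENNReal.ofReal (w j) • Measure.dirac (pt j)
  have hμ : IsProbabilityMeasure μ := by
    constructor
    simp only [μ, Measure.coe_finsetSum, Finset.sum_apply, Measure.smul_apply, measure_univ,
      smul_eq_mul, mul_one]
    rw [← ENNReal.ofReal_sum_of_nonneg (fun j _ => hw0 j), hw1, ENNReal.ofReal_one]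
  refine ⟨⟨μ, hμ⟩, fun m hm => ?_⟩
  have hint : ∫ x, (x : ℝ) ^ m ∂μ = ∑ j ∈ Finset.range (N + 1), ((j : ℝ) / N) ^ m * w j := by
    rw [integral_finsetSum_measure]
    · refine Finset.sum_congr rfl fun j hj => ?_
      rw [integral_smul_measure, integral_dirac, ENNReal.toReal_ofReal (hw0 j)]
      have : j ≤ N := by simpa [Nat.lt_succ_iff] using hj
      simp [pt, this, mul_comm]
    · intro j _
      exact (integrable_dirac (by simp)).smul_measure ENNReal.ofReal_ne_top
  have hch : (0 : ℝ) < N.choose m := by exact_mod_cast Nat.choose_pos (by omega)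
  have hcm : φ ((m + 1) * h) / φ h =
      ∑ j ∈ Finset.range (N + 1), (j.choose m : ℝ) / N.choose m * w j := by
    have := hmom m (by omega)
    rw [mul_comm, ← div_eq_iff hch.ne', Finset.sum_div] at this
    rw [← this]
    exact Finset.sum_congr rfl fun j _ => by ring
  change |∫ x, (x : ℝ) ^ m ∂μ - _| < ε
  rw [hint, hcm, ← Finset.sum_sub_distrib]
  refine lt_of_le_of_lt ?_ hN2
  have hNm : (0 : ℝ) < N - m₀ := by
    have : (m₀ : ℝ) < N := by exact_mod_cast hN1
    linarith
  calc |∑ j ∈ Finset.range (N + 1), (((j : ℝ) / N) ^ m * w j - (j.choose m : ℝ) / N.choose m * w j)|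
      ≤ ∑ j ∈ Finset.range (N + 1), (m₀ : ℝ) * (m₀ / (N - m₀)) * w j := by
        refine (Finset.abs_sum_le_sum_abs _ _).trans (Finset.sum_le_sum fun j hj => ?_)
        rw [← sub_mul, abs_mul, abs_of_nonneg (hw0 j)]
        refine mul_le_mul_of_nonneg_right ?_ (hw0 j)
        refine (abs_pow_sub_choose_div_le hm hN1
          (by simpa [Nat.lt_succ_iff] using hj)).trans ?_
        gcongr
    _ = _ := by rw [← Finset.mul_sum, hw1, mul_one]

/-- Bernstein's theorem as a moment problem on `[0, 1]` with real exponents. -/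
lemma IsCMChain.exists_measure_rpow {φ : ℝ → ℝ} (hφ : IsCMChain φ)
    (h0 : Tendsto φ (𝓝[>] 0) (𝓝 1)) :
    ∃ μ : ProbabilityMeasure (Icc (0 : ℝ) 1), ∀ z : ℝ, 0 < z →
      φ z = ∫ x, (x : ℝ) ^ z ∂(μ : Measure (Icc (0 : ℝ) 1)) := by
  -- The mesh is `h = 1/n!`, so that a given positive rational `q` is an integer multiple of `h` for
  -- all large `n`.
  have hfac : Tendsto (fun n : ℕ => ((n.factorial : ℝ))⁻¹) atTop (𝓝[>] 0) := by
    refine tendsto_nhdsWithin_iff.2 ⟨?_, Eventually.of_forall fun n => ?_⟩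
    · exact tendsto_inv_atTop_zero.comp (tendsto_natCast_atTop_atTop.comp
        (tendsto_atTop_mono Nat.self_le_factorial tendsto_id))
    · exact mem_Ioi.2 (inv_pos.2 (Nat.cast_pos.2 n.factorial_pos))
  have hφn : Tendsto (fun n : ℕ => φ ((n.factorial : ℝ))⁻¹) atTop (𝓝 1) := h0.comp hfac
  have hex : ∀ n : ℕ, ∃ μ : ProbabilityMeasure (Icc (0 : ℝ) 1), 0 < φ ((n.factorial : ℝ))⁻¹ →
      ∀ m ≤ n * n.factorial, |∫ x, (x : ℝ) ^ m ∂(μ : Measure (Icc (0 : ℝ) 1)) -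
        φ ((m + 1) * ((n.factorial : ℝ))⁻¹) / φ ((n.factorial : ℝ))⁻¹| < 1 / ((n : ℝ) + 1) := by
    intro n
    by_cases hp : 0 < φ ((n.factorial : ℝ))⁻¹
    · obtain ⟨μ, hμ⟩ := exists_probability_moments hφ
        (inv_pos.2 (by exact_mod_cast n.factorial_pos)) hp (n * n.factorial)
        (ε := 1 / ((n : ℝ) + 1)) (by positivity)
      exact ⟨μ, fun _ => hμ⟩
    -- An arbitrary choice; it plays no role in the limit, since `φ(1/n!)` tends to 1.
    · exact ⟨⟨Measure.dirac ⟨0, by simp⟩, inferInstance⟩, fun h => absurd h hp⟩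
  choose μ hμ using hex
  -- Pushing forward by `x ↦ x^{n!}` turns the moment of order `q n!` into the moment of order `q`,
  -- so the measures for different `n` become comparable.
  let pw : ℕ → Icc (0 : ℝ) 1 → Icc (0 : ℝ) 1 := fun n x => x ^ n.factorial
  have hpw : ∀ n, Continuous (pw n) := fun n => continuous_pow _
  let ρ : ℕ → ProbabilityMeasure (Icc (0 : ℝ) 1) := fun n => (μ n).map (hpw n).aemeasurable
  -- Probability measures on `[0, 1]` form a compact space; a limit along an ultrafilter avoids
  -- extracting subsequences.
  obtain ⟨κ, -, hκ⟩ := isCompact_univ.ultrafilter_le_nhds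
    ((hyperfilter ℕ).map ρ) (by simp)
  have hκ' : Tendsto ρ (hyperfilter ℕ : Filter ℕ) (𝓝 κ) := hκ
  have hU : (hyperfilter ℕ : Filter ℕ) ≤ atTop := Nat.hyperfilter_le_atTop
  refine ⟨κ, ?_⟩
  have hrat : ∀ q : ℚ, 0 < q → φ q = ∫ x, (x : ℝ) ^ (q : ℝ) ∂(κ : Measure (Icc (0 : ℝ) 1)) := by
    intro q hq
    have hq' : (0 : ℝ) < q := by exact_mod_cast hq
    let f : BoundedContinuousFunction (Icc (0 : ℝ) 1) ℝ :=
      BoundedContinuousFunction.mkOfCompact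
        ⟨fun x => (x : ℝ) ^ (q : ℝ), by
          exact continuous_subtype_val.rpow_const fun x => Or.inr hq'.le⟩
    have h1 := (ProbabilityMeasure.tendsto_iff_forall_integral_tendsto.1 hκ') f
    refine tendsto_nhds_unique (Tendsto.mono_left ?_ hU) h1
    have hlim : Tendsto (fun n : ℕ => φ (q + ((n.factorial : ℝ))⁻¹) / φ ((n.factorial : ℝ))⁻¹)
        atTop (𝓝 (φ q)) := by
      have h2 : Tendsto (fun n : ℕ => (q : ℝ) + ((n.factorial : ℝ))⁻¹) atTop (𝓝 q) := by
        simpa using (tendsto_nhds_of_tendsto_nhdsWithin hfac).const_add (q : ℝ)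
      have h3 := ((hφ.continuousAt hq').tendsto.comp h2).div hφn one_ne_zero
      rwa [div_one] at h3
    refine tendsto_of_tendsto_of_dist hlim ?_
    refine squeeze_zero' (Eventually.of_forall fun _ => dist_nonneg) ?_
      tendsto_one_div_add_atTop_nhds_zero_nat
    filter_upwards [hφn.eventually_const_lt (zero_lt_one), eventually_ge_atTop q.den,
      eventually_ge_atTop q.num.toNat] with n hn hn1 hn2
    have hdvd : q.den ∣ n.factorial := Nat.dvd_factorial q.den_pos hn1
    obtain ⟨e, he⟩ := hdvd
    set m := q.num.toNat * e with hm
    have hnum : (q.num.toNat : ℝ) = q * q.den := by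
      have h3 : (q.num.toNat : ℤ) = q.num := Int.toNat_of_nonneg (Rat.num_pos.2 hq).le
      have h4 : (q.num : ℚ) = q * q.den := (Rat.mul_den_eq_num q).symm
      have h5 : (q.num.toNat : ℚ) = q * q.den := by rw [← h4]; exact_mod_cast h3
      exact_mod_cast h5
    have hqm : (m : ℝ) = q * n.factorial := by
      rw [hm, he]; push_cast; rw [hnum]; ring
    have hmle : m ≤ n * n.factorial := by
      rw [hm]
      refine Nat.mul_le_mul hn2 ?_
      rw [he]; exact Nat.le_mul_of_pos_left _ q.den_pos
    have h6 := hμ n hn m hmle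
    have hnf : (0 : ℝ) < n.factorial := by exact_mod_cast n.factorial_pos
    have h7 : ((m : ℝ) + 1) * ((n.factorial : ℝ))⁻¹ = q + ((n.factorial : ℝ))⁻¹ := by
      rw [hqm]; field_simp
    have h8 : ∫ x, f x ∂(ρ n : Measure (Icc (0 : ℝ) 1)) =
        ∫ x, (x : ℝ) ^ m ∂(μ n : Measure (Icc (0 : ℝ) 1)) := by
      change ∫ x, f x ∂(Measure.map (pw n) (μ n : Measure (Icc (0 : ℝ) 1))) = _
      rw [integral_map (hpw n).aemeasurable f.continuous.aestronglyMeasurable]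
      refine integral_congr_ae (Eventually.of_forall fun x => ?_)
      change (((x ^ n.factorial : Icc (0 : ℝ) 1)) : ℝ) ^ (q : ℝ) = _
      rw [Icc.coe_pow, ← Real.rpow_natCast, ← Real.rpow_mul x.2.1, mul_comm, ← hqm,
        Real.rpow_natCast]
    rw [dist_comm, Real.dist_eq, h8, ← h7]
    exact h6.le
  intro z hz
  -- Both sides are continuous in `z > 0`, so the rational case extends by density.
  have hden : (comap ((↑) : ℚ → ℝ) (𝓝 z)).NeBot := Rat.isDenseEmbedding_coe_real.isDenseInducing.comap_nhds_neBot z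
  have hc : Tendsto ((↑) : ℚ → ℝ) (comap ((↑) : ℚ → ℝ) (𝓝 z)) (𝓝 z) := tendsto_comap
  have h1 := (hφ.continuousAt hz).tendsto.comp hc
  have h2 : Tendsto (fun w : ℝ => ∫ x, (x : ℝ) ^ w ∂(κ : Measure (Icc (0 : ℝ) 1))) (𝓝 z)
      (𝓝 (∫ x, (x : ℝ) ^ z ∂(κ : Measure (Icc (0 : ℝ) 1)))) := by
    refine tendsto_integral_filter_of_dominated_convergence (fun _ => 1) ?_ ?_
      (integrable_const _) ?_
    · filter_upwards [Ioi_mem_nhds hz] with w hw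
      exact (continuous_subtype_val.rpow_const fun x => Or.inr (le_of_lt hw)).aestronglyMeasurable
    · filter_upwards [Ioi_mem_nhds hz] with w hw
      refine Eventually.of_forall fun x => ?_
      rw [Real.norm_of_nonneg (Real.rpow_nonneg x.2.1 _)]
      exact Real.rpow_le_one x.2.1 x.2.2 (le_of_lt hw)
    · refine Eventually.of_forall fun x => ?_
      exact (Real.continuousAt_const_rpow' hz.ne').tendsto
  refine tendsto_nhds_unique (h1.congr' ?_) (h2.comp hc)
  filter_upwards [hc.eventually (Ioi_mem_nhds hz)] with q hq
  exact hrat q (by exact_mod_cast hq)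

/-- Bernstein's theorem. -/
theorem IsCMChain.exists_represents {φ : ℝ → ℝ} (hφ : IsCMChain φ)
    (h0 : Tendsto φ (𝓝[>] 0) (𝓝 1)) : ∃ ν : Measure ℝ, Represents φ ν := by
  obtain ⟨μ, hμ⟩ := hφ.exists_measure_rpow h0
  set κ : Measure (Icc (0 : ℝ) 1) := (μ : Measure (Icc (0 : ℝ) 1)) with hκ
  have hlog : Measurable fun x : Icc (0 : ℝ) 1 => -Real.log (x : ℝ) :=
    (Real.measurable_log.comp measurable_subtype_coe).neg
  -- The substitution `s = -log x` is faithful only off `x = 0`. As `z → 0+`, `x^z` tends to the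
  -- indicator of `x > 0`, so `φ(0+) = 1` says that there is no mass at 0.
  have hae : ∀ᵐ x : Icc (0 : ℝ) 1 ∂κ, (0 : ℝ) < (x : ℝ) := by
    have hms : MeasurableSet {x : Icc (0 : ℝ) 1 | (0 : ℝ) < (x : ℝ)} :=
      measurableSet_lt measurable_const measurable_subtype_coe
    have hlim : Tendsto (fun z : ℝ => ∫ x, (x : ℝ) ^ z ∂κ) (𝓝[>] 0)
        (𝓝 (∫ x, {x : Icc (0 : ℝ) 1 | (0 : ℝ) < (x : ℝ)}.indicator (fun _ => (1 : ℝ)) x ∂κ)) := by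
      refine tendsto_integral_filter_of_dominated_convergence (fun _ => 1) ?_ ?_
        (integrable_const _) ?_
      · filter_upwards [self_mem_nhdsWithin] with w hw
        exact (continuous_subtype_val.rpow_const fun x => Or.inr (le_of_lt hw)).aestronglyMeasurable
      · filter_upwards [self_mem_nhdsWithin] with w hw
        refine Eventually.of_forall fun x => ?_
        rw [Real.norm_of_nonneg (Real.rpow_nonneg x.2.1 _)]
        exact Real.rpow_le_one x.2.1 x.2.2 (le_of_lt hw)
      · refine Eventually.of_forall fun x => ?_
        rcases x.2.1.eq_or_lt with hx | hx
        · refine tendsto_const_nhds.congr' ?_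
          filter_upwards [self_mem_nhdsWithin] with w hw
          rw [← hx, Real.zero_rpow (ne_of_gt hw)]
          rw [indicator_of_notMem]
          exact fun h => (ne_of_gt h) hx.symm
        · have : Tendsto (fun w : ℝ => (x : ℝ) ^ w) (𝓝[>] 0) (𝓝 ((x : ℝ) ^ (0 : ℝ))) :=
            ((Real.continuousAt_const_rpow hx.ne').tendsto).mono_left nhdsWithin_le_nhds
          rw [Real.rpow_zero] at this
          rwa [indicator_of_mem (by exact hx)]
    have heq : Tendsto (fun z : ℝ => ∫ x, (x : ℝ) ^ z ∂κ) (𝓝[>] 0) (𝓝 1) := by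
      refine h0.congr' ?_
      filter_upwards [self_mem_nhdsWithin] with z hz
      exact hμ z hz
    have h1 := tendsto_nhds_unique hlim heq
    rw [integral_indicator_const _ hms, smul_eq_mul, mul_one] at h1
    rw [ae_iff]
    have h2 : κ {x : Icc (0 : ℝ) 1 | (0 : ℝ) < (x : ℝ)} = 1 := by
      rw [measureReal_def] at h1
      rw [← ENNReal.ofReal_toReal (measure_ne_top κ _), h1, ENNReal.ofReal_one]
    exact (prob_compl_eq_zero_iff hms).2 h2
  refine ⟨κ.map fun x : Icc (0 : ℝ) 1 => -Real.log (x : ℝ), ⟨inferInstance, ?_, fun z hz => ?_⟩⟩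
  · rw [Measure.map_apply hlog measurableSet_Iio]
    convert! measure_empty (μ := κ)
    ext x
    simp only [mem_preimage, mem_Iio, mem_empty_iff_false, iff_false, not_lt]
    linarith [Real.log_nonpos x.2.1 x.2.2]
  · rw [hμ z hz, integral_map hlog.aemeasurable (by fun_prop)]
    refine integral_congr_ae ?_
    filter_upwards [hae] with x hx
    rw [Real.rpow_def_of_pos hx]
    congr 1; ring

/-! ### The Taylor kernel -/

/-- The Peano kernel of the first order Taylor expansion at `1`. -/
def kern (s τ : ℝ) : ℝ := if τ ≤ 1 then max (τ - s) 0 else max (s - τ) 0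

lemma kern_nonneg (s τ : ℝ) : 0 ≤ kern s τ := by
  unfold kern; split_ifs <;> exact le_max_right _ _

lemma measurable_kern : Measurable fun p : ℝ × ℝ => kern p.1 p.2 := by
  unfold kern
  refine Measurable.ite (measurableSet_le measurable_snd measurable_const) ?_ ?_ <;> fun_prop

lemma kern_le (s τ : ℝ) : kern s τ ≤ |s| + |τ| := by
  unfold kern
  have h1 := le_abs_self s; have h2 := le_abs_self τ
  have h3 := neg_abs_le s; have h4 := neg_abs_le τ
  split_ifs <;> apply max_le <;> linarith [abs_nonneg s, abs_nonneg τ]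

section Taylor

variable {E : Type*} [NormedAddCommGroup E] [NormedSpace ℝ E]

lemma kern_smul_eq_indicator {s : ℝ} (hs : s ≤ 1) (φ : ℝ → E) :
    (fun τ => kern s τ • φ τ) = (Ioc s 1).indicator fun τ => (τ - s) • φ τ := by
  ext τ
  unfold kern
  by_cases h : τ ∈ Ioc s 1
  · rw [indicator_of_mem h, if_pos h.2, max_eq_left (by linarith [h.1])]
  · rw [indicator_of_notMem h]
    simp only [mem_Ioc, not_and_or, not_lt, not_le] at h
    split_ifs with h1
    · rw [max_eq_right, zero_smul]
      rcases h with h | h <;> linarith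
    · rw [max_eq_right, zero_smul]; linarith

lemma kern_smul_eq_indicator' {s : ℝ} (hs : 1 ≤ s) (φ : ℝ → E) :
    (fun τ => kern s τ • φ τ) = (Ioc 1 s).indicator fun τ => (s - τ) • φ τ := by
  ext τ
  unfold kern
  by_cases h : τ ∈ Ioc 1 s
  · rw [indicator_of_mem h, if_neg (not_le.2 h.1), max_eq_left (by linarith [h.2])]
  · rw [indicator_of_notMem h]
    simp only [mem_Ioc, not_and_or, not_lt, not_le] at h
    split_ifs with h1
    · rw [max_eq_right, zero_smul]
      linarith
    · rw [max_eq_right, zero_smul]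
      rcases h with h | h <;> linarith

/-- Taylor's formula of first order at `1` with integral remainder. -/
lemma integral_kern_smul [CompleteSpace E] {f f₁ f₂ : ℝ → E}
    (h₁ : ∀ s, 0 < s → HasDerivAt f (f₁ s) s) (h₂ : ∀ s, 0 < s → HasDerivAt f₁ (f₂ s) s)
    (hc : ContinuousOn f₂ (Ioi 0)) {s : ℝ} (hs : 0 < s) :
    IntegrableOn (fun τ => kern s τ • f₂ τ) (Ioi 0) ∧
      ∫ τ in Ioi 0, kern s τ • f₂ τ = f s - f 1 - (s - 1) • f₁ 1 := by
  rcases le_total s 1 with h | h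
  · have hsub : Icc s 1 ⊆ Ioi 0 := fun τ hτ => hs.trans_le hτ.1
    have hcont : ContinuousOn (fun τ => (τ - s) • f₂ τ) (Icc s 1) :=
      (continuousOn_id.sub continuousOn_const).smul (hc.mono hsub)
    have hI : IntervalIntegrable (fun τ => (τ - s) • f₂ τ) volume s 1 := by
      apply ContinuousOn.intervalIntegrable; rwa [uIcc_of_le h]
    have hinter : Ioi (0 : ℝ) ∩ Ioc s 1 = Ioc s 1 :=
      inter_eq_right.2 (Ioc_subset_Icc_self.trans hsub)
    rw [kern_smul_eq_indicator h]
    refine ⟨?_, ?_⟩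
    · rw [IntegrableOn, integrable_indicator_iff measurableSet_Ioc, IntegrableOn,
        Measure.restrict_restrict measurableSet_Ioc, inter_comm, hinter]
      exact (intervalIntegrable_iff_integrableOn_Ioc_of_le h).1 hI
    · rw [setIntegral_indicator measurableSet_Ioc, hinter, ← intervalIntegral.integral_of_le h,
        intervalIntegral.integral_eq_sub_of_hasDerivAt
          (f := fun τ => (τ - s) • f₁ τ - f τ) ?_ hI]
      · simp only [sub_self, zero_smul]; module
      · intro τ hτ
        rw [uIcc_of_le h] at hτ
        have h3 := ((hasDerivAt_id τ).sub_const s).smul (h₂ τ (hsub hτ))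
        convert! h3.sub (h₁ τ (hsub hτ)) using 1
        simp
  · have hsub : Icc 1 s ⊆ Ioi 0 := fun τ hτ => zero_lt_one.trans_le hτ.1
    have hcont : ContinuousOn (fun τ => (s - τ) • f₂ τ) (Icc 1 s) :=
      (continuousOn_const.sub continuousOn_id).smul (hc.mono hsub)
    have hI : IntervalIntegrable (fun τ => (s - τ) • f₂ τ) volume 1 s := by
      apply ContinuousOn.intervalIntegrable; rwa [uIcc_of_le h]
    have hinter : Ioi (0 : ℝ) ∩ Ioc 1 s = Ioc 1 s :=
      inter_eq_right.2 (Ioc_subset_Icc_self.trans hsub)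
    rw [kern_smul_eq_indicator' h]
    refine ⟨?_, ?_⟩
    · rw [IntegrableOn, integrable_indicator_iff measurableSet_Ioc, IntegrableOn,
        Measure.restrict_restrict measurableSet_Ioc, inter_comm, hinter]
      exact (intervalIntegrable_iff_integrableOn_Ioc_of_le h).1 hI
    · rw [setIntegral_indicator measurableSet_Ioc, hinter, ← intervalIntegral.integral_of_le h,
        intervalIntegral.integral_eq_sub_of_hasDerivAt
          (f := fun τ => (s - τ) • f₁ τ + f τ) ?_ hI]
      · simp only [sub_self, zero_smul]; module
      · intro τ hτ
        rw [uIcc_of_le h] at hτ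
        have h3 := ((hasDerivAt_id τ).const_sub s).smul (h₂ τ (hsub hτ))
        convert! h3.add (h₁ τ (hsub hτ)) using 1
        simp

end Taylor

/-- Probability measures on `(0, ∞)` of mean one with finite fourth moment. -/
structure IsNormalized (ν : Measure ℝ) : Prop where
  prob : IsProbabilityMeasure ν
  pos : ∀ᵐ s ∂ν, 0 < s
  integrable_pow_four : Integrable (fun s => s ^ 4) ν
  mean : ∫ s, s ∂ν = 1

lemma integrable_pow_of_pow_four {ν : Measure ℝ} [IsFiniteMeasure ν]
    (h : Integrable (fun s => s ^ 4) ν) {k : ℕ} (hk : k ≤ 4) :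
    Integrable (fun s => s ^ k) ν := by
  refine ((integrable_const (1 : ℝ)).add h).mono' (by fun_prop) (Eventually.of_forall fun s => ?_)
  rw [norm_pow, Real.norm_eq_abs, Pi.add_apply, ← (by decide : Even 4).pow_abs]
  rcases le_total |s| 1 with h1 | h1
  · have := pow_le_one₀ (n := k) (abs_nonneg s) h1
    have : (0 : ℝ) ≤ |s| ^ 4 := by positivity
    linarith
  · have := pow_le_pow_right₀ h1 hk
    linarith

/-- The two branches of `densG` are the two branches of the Peano kernel, averaged over its first
variable. -/
lemma densG_eq {ν : Measure ℝ} (hν : ν (Iio 0) = 0) (τ : ℝ) :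
    densG ν τ = ∫ s, kern s τ ∂ν := by
  have hae : ∀ᵐ s ∂ν, 0 ≤ s := by
    rw [ae_iff]; simpa [Iio] using hν
  unfold densG
  split_ifs with h
  · rw [← integral_indicator measurableSet_Icc]
    refine integral_congr_ae ?_
    filter_upwards [hae] with s hs
    rw [kern, if_pos h]
    by_cases hst : s ≤ τ
    · rw [indicator_of_mem (show s ∈ Icc 0 τ from ⟨hs, hst⟩), max_eq_left (by linarith)]
    · rw [indicator_of_notMem (fun h => hst h.2), max_eq_right (by linarith)]
  · rw [← integral_indicator measurableSet_Ici]
    refine integral_congr_ae ?_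
    filter_upwards with s
    rw [kern, if_neg h]
    by_cases hst : τ ≤ s
    · rw [indicator_of_mem (show s ∈ Ici τ from hst), max_eq_left (by linarith)]
    · rw [indicator_of_notMem (show s ∉ Ici τ from hst), max_eq_right (by linarith)]

lemma densG_nonneg {ν : Measure ℝ} (hν : ν (Iio 0) = 0) (τ : ℝ) :
    0 ≤ densG ν τ := by
  rw [densG_eq hν]; exact integral_nonneg fun s => kern_nonneg s τ

/-! ### Fubini's theorem for the Peano kernel -/

section Fubini

variable {E : Type*} [NormedAddCommGroup E] [NormedSpace ℝ E]

/-- For `φ = f''` the inner integral on the right is the first order Taylor remainder of `f` at 1.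
Polynomial `f` yields the moments of `G`; the orbit of the semigroup yields the formula for `g(A)x`.
-/
lemma integral_densG_smul [CompleteSpace E] {ν : Measure ℝ} [IsFiniteMeasure ν]
    (hν : ν (Iio 0) = 0) {φ : ℝ → E}
    (h : Integrable (fun p : ℝ × ℝ => kern p.1 p.2 • φ p.2) (ν.prod (volume.restrict (Ioi 0)))) :
    IntegrableOn (fun τ => densG ν τ • φ τ) (Ioi 0) ∧
      ∫ τ in Ioi 0, densG ν τ • φ τ = ∫ s, (∫ τ in Ioi 0, kern s τ • φ τ) ∂ν := by
  have heq : ∀ᵐ τ ∂(volume.restrict (Ioi (0 : ℝ))),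
      ∫ s, kern s τ • φ τ ∂ν = densG ν τ • φ τ := by
    filter_upwards [ae_restrict_mem measurableSet_Ioi] with τ hτ
    rw [integral_smul_const, densG_eq hν]
  refine ⟨(h.integral_prod_right).congr heq, ?_⟩
  rw [← integral_congr_ae heq]
  exact (integral_integral_swap (f := fun s τ => kern s τ • φ τ) h).symm

/-- By Tonelli: integrating the norm in `s` first gives `G ‖φ‖`, as the kernel is nonnegative. -/
lemma integrable_kern_smul_of_densG {ν : Measure ℝ} [IsFiniteMeasure ν] (hν : ν (Iio 0) = 0)
    (h1 : Integrable (fun s => s) ν) {φ : ℝ → E}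
    (hφ : AEStronglyMeasurable φ (volume.restrict (Ioi 0)))
    (h : IntegrableOn (fun τ => densG ν τ * ‖φ τ‖) (Ioi 0)) :
    Integrable (fun p : ℝ × ℝ => kern p.1 p.2 • φ p.2) (ν.prod (volume.restrict (Ioi 0))) := by
  have hmeas : AEStronglyMeasurable (fun p : ℝ × ℝ => kern p.1 p.2 • φ p.2)
      (ν.prod (volume.restrict (Ioi 0))) :=
    measurable_kern.aestronglyMeasurable.smul hφ.comp_snd
  rw [integrable_prod_iff' hmeas]
  refine ⟨Eventually.of_forall fun τ => ?_, ?_⟩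
  · have hk : Integrable (fun s => kern s τ) ν := (h1.norm.add (integrable_const |τ|)).mono'
      (measurable_kern.comp (measurable_id.prodMk measurable_const)).aestronglyMeasurable
      (Eventually.of_forall fun s => by
        rw [Real.norm_of_nonneg (kern_nonneg _ _)]
        exact kern_le s τ)
    exact hk.smul_const (φ τ)
  · refine h.congr ?_
    filter_upwards [ae_restrict_mem measurableSet_Ioi] with τ hτ
    simp only [norm_smul, Real.norm_of_nonneg (kern_nonneg _ _)]
    rw [integral_mul_const, densG_eq hν]

/-- By Tonelli in the other order: for `f₂ ≥ 0` the integrand is its own norm, and Taylor's formula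
evaluates the integral in `τ` as the remainder assumed integrable. -/
lemma integrable_kern_mul_of_taylor {ν : Measure ℝ} [IsFiniteMeasure ν] (hpos : ∀ᵐ s ∂ν, 0 < s)
    {f f₁ f₂ : ℝ → ℝ} (h₁ : ∀ s, 0 < s → HasDerivAt f (f₁ s) s)
    (h₂ : ∀ s, 0 < s → HasDerivAt f₁ (f₂ s) s)
    (hc : ContinuousOn f₂ (Ioi 0)) (hnn : ∀ τ, 0 < τ → 0 ≤ f₂ τ)
    (hint : Integrable (fun s => f s - f 1 - (s - 1) • f₁ 1) ν) :
    Integrable (fun p : ℝ × ℝ => kern p.1 p.2 • f₂ p.2) (ν.prod (volume.restrict (Ioi 0))) := by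
  have hmeas : AEStronglyMeasurable (fun p : ℝ × ℝ => kern p.1 p.2 • f₂ p.2)
      (ν.prod (volume.restrict (Ioi 0))) :=
    measurable_kern.aestronglyMeasurable.smul
      (hc.aestronglyMeasurable measurableSet_Ioi).comp_snd
  rw [integrable_prod_iff hmeas]
  refine ⟨?_, ?_⟩
  · filter_upwards [hpos] with s hs
    exact (integral_kern_smul h₁ h₂ hc hs).1
  · refine hint.congr ?_
    filter_upwards [hpos] with s hs
    rw [← (integral_kern_smul h₁ h₂ hc hs).2]
    refine setIntegral_congr_fun measurableSet_Ioi fun τ hτ => ?_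
    exact (Real.norm_of_nonneg (mul_nonneg (kern_nonneg _ _) (hnn τ hτ))).symm

end Fubini

/-! ### Moments of the density `G` and the coefficients `b` and `d₁` -/

namespace IsNormalized

variable {ν : Measure ℝ}

lemma measure_Iio (h : IsNormalized ν) : ν (Iio 0) = 0 := by
  have := h.pos
  rw [ae_iff] at this
  exact measure_mono_null (fun s hs => not_lt.2 (le_of_lt hs)) this

lemma integrable_pow (h : IsNormalized ν) {k : ℕ} (hk : k ≤ 4) : Integrable (fun s => s ^ k) ν :=
  have := h.prob
  integrable_pow_of_pow_four h.integrable_pow_four hk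

lemma integrable_id (h : IsNormalized ν) : Integrable (fun s => s) ν := by
  simpa using h.integrable_pow (k := 1) (by norm_num)

lemma integrable_sub_pow (h : IsNormalized ν) {k : ℕ} (hk : k ≤ 4) :
    Integrable (fun s => (s - 1) ^ k) ν := by
  have := h.prob
  simp only [sub_eq_add_neg, add_pow]
  refine integrable_finsetSum _ fun i hi => ?_
  exact ((h.integrable_pow (k := i)
    (by simp only [Finset.mem_range] at hi; omega)).mul_const _).mul_const _

lemma integral_sub_one (h : IsNormalized ν) : ∫ s, (s - 1) ∂ν = 0 := by
  have := h.prob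
  rw [integral_sub h.integrable_id (integrable_const _), h.mean]; simp

lemma prod_integrable_one (h : IsNormalized ν) :
    Integrable (fun p : ℝ × ℝ => kern p.1 p.2 • (1 : ℝ)) (ν.prod (volume.restrict (Ioi 0))) := by
  have := h.prob
  refine integrable_kern_mul_of_taylor h.pos (f := fun s => (s - 1) ^ 2 / 2)
    (f₁ := fun s => s - 1) (f₂ := fun _ => 1) (fun s _ => ?_) (fun s _ => ?_)
    continuousOn_const (fun _ _ => zero_le_one) ?_
  · have := (((hasDerivAt_id s).sub_const 1).pow 2).div_const 2
    convert! this using 1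
    simp
  · exact (hasDerivAt_id s).sub_const 1
  · simpa using (h.integrable_sub_pow (k := 2) (by norm_num)).div_const 2

lemma integral_densG (h : IsNormalized ν) : IntegrableOn (densG ν) (Ioi 0) ∧
    ∫ τ in Ioi 0, densG ν τ = (∫ s, (s - 1) ^ 2 ∂ν) / 2 := by
  have := h.prob
  have h1 := integral_densG_smul h.measure_Iio (φ := fun _ => (1 : ℝ)) h.prod_integrable_one
  simp only [smul_eq_mul, mul_one] at h1
  refine ⟨h1.1, ?_⟩
  rw [h1.2, ← integral_div]
  refine integral_congr_ae ?_
  filter_upwards [h.pos] with s hs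
  have h2 := (integral_kern_smul (E := ℝ) (f := fun s => (s - 1) ^ 2 / 2)
    (f₁ := fun s => s - 1) (f₂ := fun _ => (1 : ℝ)) (s := s) (fun s _ => ?_) (fun s _ => ?_)
    continuousOn_const hs).2
  · simpa using h2
  · have := (((hasDerivAt_id s).sub_const 1).pow 2).div_const 2
    convert! this using 1
    simp
  · exact (hasDerivAt_id s).sub_const 1

lemma prod_integrable_sq (h : IsNormalized ν) :
    Integrable (fun p : ℝ × ℝ => kern p.1 p.2 • (1 - p.2) ^ 2)
      (ν.prod (volume.restrict (Ioi 0))) := by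
  have := h.prob
  refine integrable_kern_mul_of_taylor h.pos (f := fun s => (s - 1) ^ 4 / 12)
    (f₁ := fun s => (s - 1) ^ 3 / 3) (f₂ := fun τ => (1 - τ) ^ 2) (fun s _ => ?_) (fun s _ => ?_)
    (by fun_prop) (fun τ _ => by positivity) ?_
  · have := (((hasDerivAt_id s).sub_const 1).pow 4).div_const 12
    convert! this using 1
    simp; ring
  · have := (((hasDerivAt_id s).sub_const 1).pow 3).div_const 3
    convert! this using 1
    simp; ring
  · simpa using (h.integrable_sub_pow (k := 4) (by norm_num)).div_const 12

lemma integral_densG_sq (h : IsNormalized ν) :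
    IntegrableOn (fun τ => densG ν τ * (1 - τ) ^ 2) (Ioi 0) ∧
    ∫ τ in Ioi 0, densG ν τ * (1 - τ) ^ 2 = (∫ s, (s - 1) ^ 4 ∂ν) / 12 := by
  have := h.prob
  have h1 := integral_densG_smul h.measure_Iio (φ := fun τ => (1 - τ) ^ 2) h.prod_integrable_sq
  simp only [smul_eq_mul] at h1
  refine ⟨h1.1, ?_⟩
  rw [h1.2, ← integral_div]
  refine integral_congr_ae ?_
  filter_upwards [h.pos] with s hs
  have h2 := (integral_kern_smul (E := ℝ) (f := fun s => (s - 1) ^ 4 / 12)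
    (f₁ := fun s => (s - 1) ^ 3 / 3) (f₂ := fun τ => (1 - τ) ^ 2) (fun s _ => ?_) (fun s _ => ?_)
    (by fun_prop) hs).2
  · simpa using h2
  · have := (((hasDerivAt_id s).sub_const 1).pow 4).div_const 12
    convert! this using 1
    simp; ring
  · have := (((hasDerivAt_id s).sub_const 1).pow 3).div_const 3
    convert! this using 1
    simp; ring

lemma integrable_bIntegrand (h : IsNormalized ν) : IntegrableOn (bIntegrand ν) (Ioi 0) := by
  refine (h.integral_densG.1.add h.integral_densG_sq.1).mono'
    ((measurable_const.sub measurable_id).aestronglyMeasurable.mul h.integral_densG.1.1) ?_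
  filter_upwards [ae_restrict_mem measurableSet_Ioi] with τ hτ
  have hG := densG_nonneg h.measure_Iio τ
  rw [bIntegrand, norm_mul, Real.norm_of_nonneg hG, Real.norm_eq_abs, Pi.add_apply]
  have : |1 - τ| ≤ 1 + (1 - τ) ^ 2 := by
    rw [abs_le]; constructor <;> nlinarith [sq_nonneg (1 - τ - 1), sq_nonneg (1 - τ + 1)]
  nlinarith

lemma bCoeff_eq (h : IsNormalized ν) : bCoeff ν = -(∫ s, (s - 1) ^ 3 ∂ν) / 6 := by
  have := h.prob
  have hI : IntegrableOn (fun τ => densG ν τ * ‖1 - τ‖) (Ioi 0) := by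
    refine h.integrable_bIntegrand.norm.congr ?_
    filter_upwards [ae_restrict_mem measurableSet_Ioi] with τ hτ
    rw [bIntegrand, norm_mul, Real.norm_of_nonneg (densG_nonneg h.measure_Iio τ), mul_comm]
  have h1 := integral_densG_smul h.measure_Iio (integrable_kern_smul_of_densG h.measure_Iio
    h.integrable_id (φ := fun τ => 1 - τ) (by fun_prop) hI)
  have h3 : bCoeff ν = ∫ τ in Ioi 0, densG ν τ • (1 - τ) := by
    unfold bCoeff bIntegrand; simp only [smul_eq_mul, mul_comm]
  rw [h3, h1.2, neg_div, ← integral_div, ← integral_neg]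
  refine integral_congr_ae ?_
  filter_upwards [h.pos] with s hs
  have h2 := (integral_kern_smul (E := ℝ) (f := fun s => -((s - 1) ^ 3 / 6))
    (f₁ := fun s => -((s - 1) ^ 2 / 2)) (f₂ := fun τ => 1 - τ) (fun s _ => ?_) (fun s _ => ?_)
    (by fun_prop) hs).2
  · simpa using h2
  · have := (((hasDerivAt_id s).sub_const 1).pow 3).div_const 6 |>.neg
    convert! this using 1
    simp; ring
  · have := (((hasDerivAt_id s).sub_const 1).pow 2).div_const 2 |>.neg
    convert! this using 1
    simp

/-- The weight of `d₁` is singular only at zero, and there this bound trades `G` for the mass of `ν`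
near zero. -/
lemma densG_le (h : IsNormalized ν) {τ : ℝ} (hτ : 0 < τ) (hτ1 : τ ≤ 1) :
    densG ν τ ≤ τ * ν.real (Iic τ) := by
  have := h.prob
  rw [densG_eq h.measure_Iio, mul_comm, ← smul_eq_mul, ← integral_indicator_const _ measurableSet_Iic]
  refine integral_mono_ae ?_ ((integrable_const τ).indicator measurableSet_Iic) ?_
  · refine (h.integrable_id.norm.add (integrable_const |τ|)).mono'
      (measurable_kern.comp (measurable_id.prodMk measurable_const)).aestronglyMeasurable
      (Eventually.of_forall fun s => ?_)
    rw [Real.norm_of_nonneg (kern_nonneg _ _)]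
    exact kern_le s τ
  · filter_upwards [h.pos] with s hs
    rw [kern, if_pos hτ1]
    by_cases hs' : s ≤ τ
    · rw [indicator_of_mem (show s ∈ Iic τ from hs')]
      exact max_le (by linarith) hτ.le
    · rw [indicator_of_notMem (show s ∉ Iic τ from hs')]
      exact max_le (by linarith) le_rfl

/-- Integrability and size of `d₁` in terms of the fourth centred moment and of the mass near
zero. -/
lemma dCoeff_le (h : IsNormalized ν) {C δ : ℝ} (hδ : 0 < δ)
    (hC : ∀ s, 0 < s → s ≤ 1 / 2 → ν.real (Iic s) ≤ C * s ^ δ) :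
    IntegrableOn (dIntegrand ν) (Ioi 0) ∧
      dCoeff ν ≤ (∫ s, (s - 1) ^ 4 ∂ν) + C / δ := by
  have hC0 : 0 ≤ C := by
    have := (measureReal_nonneg).trans (hC (1 / 2) (by norm_num) le_rfl)
    exact nonneg_of_mul_nonneg_left this (by positivity)
  -- The majorant near zero: the weight is at most `τ^{-2}`, and `G` is at most `τ · C τ^δ`.
  set ψ : ℝ → ℝ := (Ioc 0 (1 / 2)).indicator fun s => C * s ^ (δ - 1) with hψ
  have hint0 : IntervalIntegrable (fun s : ℝ => s ^ (δ - 1)) volume 0 (1 / 2) :=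
    intervalIntegral.intervalIntegrable_rpow' (by linarith)
  have hinter : Ioi (0 : ℝ) ∩ Ioc 0 (1 / 2) = Ioc 0 (1 / 2) :=
    inter_eq_right.2 fun s hs => hs.1
  have hψi : IntegrableOn ψ (Ioi 0) := by
    rw [IntegrableOn, integrable_indicator_iff measurableSet_Ioc, IntegrableOn,
      Measure.restrict_restrict measurableSet_Ioc, inter_comm, hinter]
    exact ((intervalIntegrable_iff_integrableOn_Ioc_of_le (by norm_num)).1 hint0).const_mul C
  have hψe : ∫ s in Ioi 0, ψ s ≤ C / δ := by
    rw [setIntegral_indicator measurableSet_Ioc, hinter, integral_const_mul,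
      ← intervalIntegral.integral_of_le (by norm_num), integral_rpow (Or.inl (by linarith))]
    rw [sub_add_cancel, Real.zero_rpow hδ.ne', sub_zero, div_eq_mul_inv C]
    refine mul_le_mul_of_nonneg_left ?_ hC0
    rw [div_eq_mul_inv]
    refine mul_le_of_le_one_left (by positivity) ?_
    exact Real.rpow_le_one (by norm_num) (by norm_num) hδ.le
  -- Above `1/2` the weight is at most `12 (1-τ)²`. The constant 12 is not sharp, but it cancels the
  -- `1/12` of `integral_densG_sq`.
  have hbd : ∀ τ ∈ Ioi (0 : ℝ), dIntegrand ν τ ≤ 12 * (densG ν τ * (1 - τ) ^ 2) + ψ τ := by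
    intro τ hτ
    have hτ' : 0 < τ := hτ
    have hG := densG_nonneg h.measure_Iio τ
    rw [dIntegrand]
    rcases le_or_gt τ (1 / 2) with h2 | h2
    · rw [hψ, indicator_of_mem (show τ ∈ Ioc 0 (1 / 2) from ⟨hτ, h2⟩)]
      have h3 : densG ν τ ≤ τ * (C * τ ^ δ) :=
        (h.densG_le hτ (by linarith)).trans (by gcongr; exact hC τ hτ h2)
      have h4 : (1 - τ) ^ 2 * (1 + τ) / τ ^ 2 ≤ 1 / τ ^ 2 := by
        gcongr; nlinarith [mul_pos hτ' hτ']
      have h5 : τ ^ (δ - 1) = τ ^ δ / τ := by rw [Real.rpow_sub hτ', Real.rpow_one]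
      calc (1 - τ) ^ 2 * (1 + τ) / τ ^ 2 * densG ν τ ≤ 1 / τ ^ 2 * (τ * (C * τ ^ δ)) := by
            gcongr
        _ = C * τ ^ (δ - 1) := by rw [h5]; field_simp
        _ ≤ _ := by linarith [mul_nonneg hG (sq_nonneg (1 - τ))]
    · rw [hψ, indicator_of_notMem (fun h => absurd h.2 (not_le.2 h2)), add_zero]
      have h4 : (1 - τ) ^ 2 * (1 + τ) / τ ^ 2 ≤ 12 * (1 - τ) ^ 2 := by
        rw [div_le_iff₀ (by positivity), mul_assoc, mul_left_comm 12]
        refine mul_le_mul_of_nonneg_left ?_ (sq_nonneg _)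
        nlinarith
      calc _ ≤ 12 * (1 - τ) ^ 2 * densG ν τ := by gcongr
        _ = _ := by ring
  have hsum : IntegrableOn (fun τ => 12 * (densG ν τ * (1 - τ) ^ 2) + ψ τ) (Ioi 0) :=
    (h.integral_densG_sq.1.const_mul 12).add hψi
  have hd : IntegrableOn (dIntegrand ν) (Ioi 0) := by
    refine hsum.mono' ?_ ?_
    · refine AEStronglyMeasurable.mul ?_ h.integral_densG.1.1
      exact Measurable.aestronglyMeasurable (by fun_prop)
    · filter_upwards [ae_restrict_mem measurableSet_Ioi] with τ hτ
      have hτ' : 0 < τ := hτ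
      have hG := densG_nonneg h.measure_Iio τ
      rw [Real.norm_of_nonneg (by unfold dIntegrand; positivity)]
      exact hbd τ hτ
  refine ⟨hd, ?_⟩
  calc dCoeff ν ≤ ∫ τ in Ioi 0, (12 * (densG ν τ * (1 - τ) ^ 2) + ψ τ) :=
        setIntegral_mono_on hd hsum measurableSet_Ioi hbd
    _ = 12 * ((∫ s, (s - 1) ^ 4 ∂ν) / 12) + ∫ s in Ioi 0, ψ s := by
        rw [integral_add (h.integral_densG_sq.1.const_mul 12) hψi, integral_const_mul,
          h.integral_densG_sq.2]
    _ ≤ _ := by linarith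

end IsNormalized

/-! ### The abstract second order estimate -/

lemma IsNormalized.aestronglyMeasurable {E : Type*} [NormedAddCommGroup E]
    {ν : Measure ℝ} (h : IsNormalized ν) {φ : ℝ → E}
    (hφ : ContinuousOn φ (Ioi 0)) : AEStronglyMeasurable φ ν := by
  have := hφ.aestronglyMeasurable (μ := ν) measurableSet_Ioi
  rwa [Measure.restrict_eq_self_of_ae_mem (s := Ioi (0 : ℝ)) h.pos] at this

section Estimate

variable {E : Type*} [NormedAddCommGroup E] [NormedSpace ℝ E]

/-- The majorants are second derivatives of `M r^{-2}/6` and `M r^{-1}/2`, so Taylor's formula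
integrates them against the kernel exactly. The values are `M (1-τ)²(1+2τ)/(6τ²)` for `τ ≤ 1` and `M
(1-τ)²/(2τ)` for `τ ≥ 1`; both lie below half the weight of `d₁`, times `M`. -/
lemma norm_integral_kern_smul_le {τ : ℝ} (hτ : 0 < τ) {M : ℝ} (hM : 0 ≤ M) {φ : ℝ → E}
    (h₁ : ∀ r, 0 < r → r ≤ 1 → ‖φ r‖ ≤ M * r ^ (-4 : ℤ))
    (h₂ : ∀ r, 1 ≤ r → ‖φ r‖ ≤ M * r ^ (-3 : ℤ)) :
    ‖∫ r in Ioi 0, kern τ r • φ r‖ ≤ (1 - τ) ^ 2 * (1 + τ) / τ ^ 2 / 2 * M := by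
  have hder : ∀ (m : ℤ) (c s : ℝ), 0 < s →
      HasDerivAt (fun r : ℝ => c * r ^ m) (c * (m * s ^ (m - 1))) s := fun m c s hs =>
    (hasDerivAt_zpow m s (Or.inl hs.ne')).const_mul c
  have hcont : ∀ (m : ℤ), ContinuousOn (fun r : ℝ => M * r ^ m) (Ioi 0) := fun m s hs =>
    (hder m M s hs).continuousAt.continuousWithinAt
  have hz2 : τ ^ (-2 : ℤ) = (τ ^ 2)⁻¹ := by rw [zpow_neg]; norm_cast
  have hz1 : τ ^ (-1 : ℤ) = τ⁻¹ := by simp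
  rcases le_total τ 1 with h | h
  · obtain ⟨hi, he⟩ := integral_kern_smul (E := ℝ) (f := fun r => M / 6 * r ^ (-2 : ℤ))
      (f₁ := fun r => -(M / 3) * r ^ (-3 : ℤ)) (f₂ := fun r => M * r ^ (-4 : ℤ))
      (fun s hs => by
        convert! hder (-2) (M / 6) s hs using 1; norm_num; ring)
      (fun s hs => by
        convert! hder (-3) (-(M / 3)) s hs using 1; norm_num; ring) (hcont _) hτ
    refine (norm_integral_le_of_norm_le hi ?_).trans ?_
    · filter_upwards [ae_restrict_mem measurableSet_Ioi] with r hr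
      rw [norm_smul, Real.norm_of_nonneg (kern_nonneg _ _), smul_eq_mul]
      rcases le_or_gt r 1 with hr1 | hr1
      · exact mul_le_mul_of_nonneg_left (h₁ r hr hr1) (kern_nonneg _ _)
      · have : kern τ r = 0 := by
          rw [kern, if_neg (not_le.2 hr1), max_eq_right (by linarith)]
        rw [this]; simp
    · rw [he]
      simp only [one_zpow, hz2, smul_eq_mul]
      have : M / 6 * (τ ^ 2)⁻¹ - M / 6 * 1 - (τ - 1) * (-(M / 3) * 1) =
          (1 - τ) ^ 2 * (1 + 2 * τ) / τ ^ 2 / 6 * M := by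
        field_simp; ring
      rw [this]
      refine mul_le_mul_of_nonneg_right ?_ hM
      rw [div_div, div_div, div_le_div_iff₀ (by positivity) (by positivity)]
      have : 0 ≤ (1 - τ) ^ 2 * τ ^ 2 := by positivity
      nlinarith [mul_nonneg this hτ.le]
  · obtain ⟨hi, he⟩ := integral_kern_smul (E := ℝ) (f := fun r => M / 2 * r ^ (-1 : ℤ))
      (f₁ := fun r => -(M / 2) * r ^ (-2 : ℤ)) (f₂ := fun r => M * r ^ (-3 : ℤ))
      (fun s hs => by
        convert! hder (-1) (M / 2) s hs using 1; norm_num)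
      (fun s hs => by
        convert! hder (-2) (-(M / 2)) s hs using 1; norm_num; ring) (hcont _) hτ
    refine (norm_integral_le_of_norm_le hi ?_).trans ?_
    · filter_upwards [ae_restrict_mem measurableSet_Ioi] with r hr
      rw [norm_smul, Real.norm_of_nonneg (kern_nonneg _ _), smul_eq_mul]
      rcases le_or_gt r 1 with hr1 | hr1
      · have : kern τ r = 0 := by
          rw [kern, if_pos hr1, max_eq_right (by linarith)]
        rw [this]; simp
      · exact mul_le_mul_of_nonneg_left (h₂ r hr1.le) (kern_nonneg _ _)
    · rw [he]
      simp only [one_zpow, hz1, smul_eq_mul]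
      have : M / 2 * τ⁻¹ - M / 2 * 1 - (τ - 1) * (-(M / 2) * 1) =
          (1 - τ) ^ 2 * τ / τ ^ 2 / 2 * M := by
        field_simp; ring
      rw [this]
      refine mul_le_mul_of_nonneg_right ?_ hM
      gcongr
      linarith

/-- Taylor's formula is used twice. First, `∫ F₀ dν - F₀(1) = ∫ G F₂`, the linear term vanishing
because the mean is one. Then `F₂` is expanded at 1: the constant term meets `∫ G`, which is half
the variance, the linear term gives `-b F₃(1)`, and the remainder is what `d₁` measures. The
constant `C` serves integrability only and is absent from the conclusion. -/
theorem IsNormalized.norm_integral_sub_le [CompleteSpace E] {ν : Measure ℝ} (h : IsNormalized ν)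
    (hd : IntegrableOn (dIntegrand ν) (Ioi 0)) {F : ℕ → ℝ → E}
    (hF : ∀ k s, 0 < s → HasDerivAt (F k) (F (k + 1) s) s) {C M : ℝ} (hM : 0 ≤ M)
    (h₀ : ∀ s, 0 < s → ‖F 0 s‖ ≤ C) (h₂ : ∀ s, 0 < s → ‖F 2 s‖ ≤ C * (s ^ 2)⁻¹)
    (h₄ : ∀ r, 0 < r → r ≤ 1 → ‖F 4 r‖ ≤ M * r ^ (-4 : ℤ))
    (h₄' : ∀ r, 1 ≤ r → ‖F 4 r‖ ≤ M * r ^ (-3 : ℤ)) :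
    ‖(∫ s, F 0 s ∂ν) - F 0 1 - ((∫ s, (s - 1) ^ 2 ∂ν) / 2) • F 2 1‖ ≤
      |bCoeff ν| * ‖F 3 1‖ + dCoeff ν / 2 * M := by
  have := h.prob
  have hC : 0 ≤ C := (norm_nonneg _).trans (h₀ 1 one_pos)
  have hcont : ∀ k, ContinuousOn (F k) (Ioi 0) := fun k s hs =>
    (hF k s hs).continuousAt.continuousWithinAt
  have hGm : AEStronglyMeasurable (densG ν) (volume.restrict (Ioi 0)) := h.integral_densG.1.1
  -- integrability of `G F₂`
  have hI2 : IntegrableOn (fun τ => densG ν τ * ‖F 2 τ‖) (Ioi 0) := by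
    refine ((hd.const_mul (4 * C)).add (h.integral_densG.1.const_mul (4 * C))).mono'
      (hGm.mul ((hcont 2).aestronglyMeasurable measurableSet_Ioi).norm) ?_
    filter_upwards [ae_restrict_mem measurableSet_Ioi] with τ hτ
    have hτ' : 0 < τ := hτ
    have hG := densG_nonneg h.measure_Iio τ
    rw [Real.norm_of_nonneg (by positivity), Pi.add_apply, dIntegrand]
    -- The weight of `d₁` vanishes at `τ = 1` and cannot majorize `τ^{-2}` there; the added constant
    -- is paid for by the integrability of `G`.
    have h5 : (τ ^ 2)⁻¹ ≤ 4 * ((1 - τ) ^ 2 * (1 + τ) / τ ^ 2) + 4 := by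
      rw [inv_eq_one_div, div_le_iff₀ (by positivity), add_mul, mul_assoc,
        div_mul_cancel₀ _ (by positivity)]
      rcases le_total τ (1 / 2) with h6 | h6
      · nlinarith [mul_nonneg hτ'.le (sq_nonneg (1 - τ))]
      · nlinarith [mul_nonneg hτ'.le (sq_nonneg (1 - τ))]
    calc densG ν τ * ‖F 2 τ‖ ≤ densG ν τ * (C * (4 * ((1 - τ) ^ 2 * (1 + τ) / τ ^ 2) + 4)) := by
          gcongr; exact (h₂ τ hτ).trans (by gcongr)
      _ = _ := by ring
  obtain ⟨hI2', hE2⟩ := integral_densG_smul h.measure_Iio (integrable_kern_smul_of_densG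
    h.measure_Iio h.integrable_id ((hcont 2).aestronglyMeasurable measurableSet_Ioi) hI2)
  have hF0 : Integrable (F 0) ν := by
    refine (integrable_const C).mono' (h.aestronglyMeasurable (hcont 0)) ?_
    filter_upwards [h.pos] with s hs using h₀ s hs
  have hs1 : Integrable (fun s : ℝ => s - 1) ν := h.integrable_id.sub (integrable_const _)
  have hF0' : Integrable (fun s => F 0 s - F 0 1) ν := hF0.sub (integrable_const _)
  have hlhs : (∫ s, F 0 s ∂ν) - F 0 1 = ∫ τ in Ioi 0, densG ν τ • F 2 τ := by
    rw [hE2]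
    have : ∀ᵐ s ∂ν, ∫ τ in Ioi 0, kern s τ • F 2 τ = F 0 s - F 0 1 - (s - 1) • F 1 1 := by
      filter_upwards [h.pos] with s hs
      exact (integral_kern_smul (hF 0) (hF 1) (hcont 2) hs).2
    rw [integral_congr_ae this, integral_sub hF0' (hs1.smul_const _),
      integral_sub hF0 (integrable_const _), integral_smul_const, h.integral_sub_one]
    simp
  have hI1 : IntegrableOn (fun τ => densG ν τ • F 2 1) (Ioi 0) := h.integral_densG.1.smul_const _
  have hI3 : IntegrableOn (fun τ => bIntegrand ν τ • F 3 1) (Ioi 0) :=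
    h.integrable_bIntegrand.smul_const _
  have hI21 : IntegrableOn (fun τ => densG ν τ • F 2 τ - densG ν τ • F 2 1) (Ioi 0) :=
    hI2'.sub hI1
  have hrem : (∫ s, F 0 s ∂ν) - F 0 1 - ((∫ s, (s - 1) ^ 2 ∂ν) / 2) • F 2 1 =
      -(bCoeff ν • F 3 1) +
        ∫ τ in Ioi 0, densG ν τ • ∫ r in Ioi 0, kern τ r • F 4 r := by
    have : ∀ᵐ τ ∂(volume.restrict (Ioi (0 : ℝ))),
        densG ν τ • ∫ r in Ioi 0, kern τ r • F 4 r =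
        densG ν τ • F 2 τ - densG ν τ • F 2 1 + bIntegrand ν τ • F 3 1 := by
      filter_upwards [ae_restrict_mem measurableSet_Ioi] with τ hτ
      rw [(integral_kern_smul (hF 2) (hF 3) (hcont 4) hτ).2, bIntegrand]
      module
    rw [hlhs, integral_congr_ae this, integral_add hI21 hI3, integral_sub hI2' hI1,
      integral_smul_const, integral_smul_const, h.integral_densG.2, bCoeff]
    module
  rw [hrem]
  refine (norm_add_le _ _).trans (add_le_add ?_ ?_)
  · rw [norm_neg, norm_smul, Real.norm_eq_abs]
  · refine (norm_integral_le_of_norm_le (hd.mul_const (M / 2)) ?_).trans (le_of_eq ?_)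
    · filter_upwards [ae_restrict_mem measurableSet_Ioi] with τ hτ
      have hG := densG_nonneg h.measure_Iio τ
      rw [norm_smul, Real.norm_of_nonneg hG, dIntegrand]
      calc _ ≤ densG ν τ * ((1 - τ) ^ 2 * (1 + τ) / τ ^ 2 / 2 * M) := by
            gcongr; exact norm_integral_kern_smul_le hτ hM h₄ h₄'
        _ = _ := by ring
    · rw [integral_mul_const, dCoeff]; ring

end Estimate

/-! ### Moments of the representing measure -/

lemma Represents.ae_nonneg {g : ℝ → ℝ} {ν : Measure ℝ} (h : Represents g ν) :
    ∀ᵐ s ∂ν, 0 ≤ s := by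
  rw [ae_iff]; simpa [Iio] using h.2.1

lemma integrable_exp_neg_mul {ν : Measure ℝ} [IsFiniteMeasure ν] (h : ∀ᵐ s ∂ν, 0 ≤ s) {z : ℝ}
    (hz : 0 ≤ z) : Integrable (fun s => Real.exp (-(z * s))) ν := by
  refine (integrable_const (1 : ℝ)).mono' (by fun_prop) ?_
  filter_upwards [h] with s hs
  rw [Real.norm_of_nonneg (Real.exp_pos _).le]
  exact Real.exp_le_one_iff.2 (by nlinarith)

lemma Represents.iteratedDeriv_eq {g : ℝ → ℝ} {ν : Measure ℝ} (h : Represents g ν) (k : ℕ) {z : ℝ}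
    (hz : 0 < z) :
    iteratedDeriv k g z = (-1) ^ k * ∫ s, s ^ k * Real.exp (-(z * s)) ∂ν := by
  have := h.1
  have hset : Iic 0 ⊆ ProbabilityTheory.integrableExpSet id ν := by
    intro t ht
    have := integrable_exp_neg_mul h.ae_nonneg (z := -t) (by simpa using ht)
    simpa [ProbabilityTheory.integrableExpSet] using this
  have hint : -z ∈ interior (ProbabilityTheory.integrableExpSet id ν) :=
    interior_mono hset (by rw [interior_Iic]; simpa using hz)
  have heq : g =ᶠ[𝓝 z] fun w => ProbabilityTheory.mgf id ν (-w) := by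
    filter_upwards [Ioi_mem_nhds hz] with w hw
    rw [h.2.2 w hw, ProbabilityTheory.mgf]
    simp
  rw [heq.iteratedDeriv_eq, iteratedDeriv_comp_neg, ProbabilityTheory.iteratedDeriv_mgf hint,
    smul_eq_mul]
  simp

/-- Monotone convergence: as `z` decreases to 0, `s^k e^{-zs}` increases to `s^k` for `s ≥ 0`, while
its integral is `(-1)^k g^{(k)}(z)`. -/
lemma Represents.moment {g : ℝ → ℝ} {ν : Measure ℝ} (h : Represents g ν) {k : ℕ} {l : ℝ}
    (hl : HasDerivZero g k l) :
    Integrable (fun s => s ^ k) ν ∧ ∫ s, s ^ k ∂ν = (-1) ^ k * l := by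
  have := h.1
  have hseq : Tendsto (fun n : ℕ => 1 / ((n : ℝ) + 1)) atTop (𝓝[>] 0) :=
    tendsto_nhdsWithin_iff.2 ⟨tendsto_one_div_add_atTop_nhds_zero_nat,
      Eventually.of_forall fun n => by simp only [mem_Ioi]; positivity⟩
  set zs : ℕ → ℝ := fun n => 1 / ((n : ℝ) + 1) with hzs
  have hzpos : ∀ n, 0 < zs n := fun n => by simp only [hzs]; positivity
  have hlim : Tendsto (fun n => ∫ s, s ^ k * Real.exp (-(zs n * s)) ∂ν) atTop
      (𝓝 ((-1) ^ k * l)) := by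
    refine ((hl.comp hseq).const_mul ((-1) ^ k)).congr fun n => ?_
    simp only [Function.comp]
    rw [h.iteratedDeriv_eq k (hzpos n), ← mul_assoc, ← mul_pow]
    simp
  have hint : ∀ n, Integrable (fun s => s ^ k * Real.exp (-(zs n * s))) ν := by
    intro n
    have hset : Iic 0 ⊆ ProbabilityTheory.integrableExpSet id ν := by
      intro t ht
      have := integrable_exp_neg_mul h.ae_nonneg (z := -t) (by simpa using ht)
      simpa [ProbabilityTheory.integrableExpSet] using this
    have hmem : -zs n ∈ interior (ProbabilityTheory.integrableExpSet id ν) :=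
      interior_mono hset (by rw [interior_Iic]; simpa using hzpos n)
    simpa using ProbabilityTheory.integrable_pow_mul_exp_of_mem_interior_integrableExpSet hmem k
  have hmono : Tendsto (fun n => ∫⁻ s, ENNReal.ofReal (s ^ k * Real.exp (-(zs n * s))) ∂ν) atTop
      (𝓝 (∫⁻ s, ENNReal.ofReal (s ^ k) ∂ν)) := by
    refine lintegral_tendsto_of_tendsto_of_monotone
      (fun n => (by fun_prop : Measurable fun s : ℝ =>
        ENNReal.ofReal (s ^ k * Real.exp (-(zs n * s)))).aemeasurable) ?_ ?_
    · filter_upwards [h.ae_nonneg] with s hs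
      intro m n hmn
      refine ENNReal.ofReal_le_ofReal ?_
      gcongr
      exact one_div_le_one_div_of_le (by positivity) (by gcongr)
    · filter_upwards with s
      refine ENNReal.tendsto_ofReal ?_
      have : Tendsto (fun n => s ^ k * Real.exp (-(zs n * s))) atTop
          (𝓝 (s ^ k * Real.exp (-(0 * s)))) :=
        (((Real.continuous_exp.tendsto _).comp
          (((tendsto_one_div_add_atTop_nhds_zero_nat).mul_const s).neg))).const_mul _
      simpa using this
  have hnn : ∀ n, 0 ≤ᵐ[ν] fun s => s ^ k * Real.exp (-(zs n * s)) := fun n => by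
    filter_upwards [h.ae_nonneg] with s hs
    exact mul_nonneg (pow_nonneg hs k) (Real.exp_pos _).le
  have heq : ∫⁻ s, ENNReal.ofReal (s ^ k) ∂ν = ENNReal.ofReal ((-1) ^ k * l) := by
    refine tendsto_nhds_unique hmono ?_
    refine (ENNReal.tendsto_ofReal hlim).congr fun n => ?_
    exact ofReal_integral_eq_lintegral_ofReal (hint n) (hnn n)
  have hnn' : 0 ≤ᵐ[ν] fun s => s ^ k := by
    filter_upwards [h.ae_nonneg] with s hs using pow_nonneg hs k
  have hm : AEStronglyMeasurable (fun s : ℝ => s ^ k) ν := by fun_prop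
  have hi : Integrable (fun s => s ^ k) ν :=
    (lintegral_ofReal_ne_top_iff_integrable hm hnn').1 (heq ▸ ENNReal.ofReal_ne_top)
  refine ⟨hi, ?_⟩
  rw [integral_eq_lintegral_of_nonneg_ae hnn' hm, heq, ENNReal.toReal_ofReal]
  exact ge_of_tendsto' hlim fun n => integral_nonneg_of_ae (hnn n)

/-- Chernoff's bound for the lower tail. -/
lemma measureReal_Iic_le {ρ : Measure ℝ} [IsFiniteMeasure ρ] (h : ∀ᵐ s ∂ρ, 0 ≤ s) {z : ℝ}
    (hz : 0 ≤ z) (s : ℝ) :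
    ρ.real (Iic s) ≤ Real.exp (z * s) * ∫ τ, Real.exp (-(z * τ)) ∂ρ := by
  have := ProbabilityTheory.measure_le_le_exp_mul_mgf (X := id) (μ := ρ) (t := -z) s (by simpa)
    (by simpa using integrable_exp_neg_mul h hz)
  simp only [ProbabilityTheory.mgf, id, neg_mul, neg_neg] at this
  exact this

/-- Decay of a decreasing function of class `L^k`. -/
lemma exists_le_rpow_of_memLp {g : ℝ → ℝ} (ha : AntitoneOn g (Ioi 0))
    (hnn : ∀ z, 0 < z → 0 ≤ g z) {k : ℕ} (hk : 1 ≤ k)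
    (hL : MemLp g k (volume.restrict (Ioi (0 : ℝ)))) :
    ∃ C : ℝ, 0 ≤ C ∧ ∀ z, 0 < z → g z ≤ C * z⁻¹ ^ ((k : ℝ)⁻¹) := by
  have hi : IntegrableOn (fun z => ‖g z‖ ^ k) (Ioi 0) := hL.integrable_norm_pow (by omega)
  set I := ∫ z in Ioi 0, ‖g z‖ ^ k with hI
  have hI0 : 0 ≤ I := integral_nonneg fun z => by positivity
  refine ⟨I ^ ((k : ℝ)⁻¹), by positivity, fun z hz => ?_⟩
  have h1 : z * g z ^ k ≤ I := by
    calc z * g z ^ k = ∫ w in Ioc 0 z, g z ^ k := by simp [hz.le]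
      _ ≤ ∫ w in Ioc 0 z, ‖g w‖ ^ k := by
        refine setIntegral_mono_on (by simp) (hi.mono_set Ioc_subset_Ioi_self)
          measurableSet_Ioc fun w hw => ?_
        have h2 := ha (mem_Ioi.2 hw.1) (mem_Ioi.2 hz) hw.2
        exact pow_le_pow_left₀ (hnn z hz) (h2.trans (le_abs_self _)) k
      _ ≤ I := setIntegral_mono_set hi (Eventually.of_forall fun z => by positivity)
        Ioc_subset_Ioi_self.eventuallyLE
  have h2 : g z ^ k ≤ I * z⁻¹ := by
    rw [← div_eq_mul_inv, le_div_iff₀ hz, mul_comm]; exact h1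
  have h3 : g z = (g z ^ k) ^ ((k : ℝ)⁻¹) :=
    (Real.pow_rpow_inv_natCast (hnn z hz) (by omega)).symm
  rw [h3, ← Real.mul_rpow hI0 (by positivity)]
  exact Real.rpow_le_rpow (pow_nonneg (hnn z hz) k) h2 (by positivity)

/-! ### Convolution powers -/

/-- The `n`-fold convolution power of a measure on the line. -/
def convPow (ν : Measure ℝ) : ℕ → Measure ℝ
  | 0 => Measure.dirac 0
  | n + 1 => (convPow ν n).conv ν

instance convPow.instIsProbabilityMeasure (ν : Measure ℝ) [IsProbabilityMeasure ν] (n : ℕ) :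
    IsProbabilityMeasure (convPow ν n) := by
  induction n with
  | zero => unfold convPow; infer_instance
  | succ n ih => unfold convPow; infer_instance

lemma ae_convPow_nonneg {ν : Measure ℝ} [IsProbabilityMeasure ν] (h : ∀ᵐ s ∂ν, 0 ≤ s) (n : ℕ) :
    ∀ᵐ s ∂(convPow ν n), 0 ≤ s := by
  induction n with
  | zero => unfold convPow; rw [ae_dirac_iff measurableSet_Ici]
  | succ n ih =>
    unfold convPow Measure.conv
    rw [ae_map_iff (by fun_prop) measurableSet_Ici]
    filter_upwards [Measure.quasiMeasurePreserving_fst.ae ih,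
      Measure.quasiMeasurePreserving_snd.ae h] with p h1 h2
    exact add_nonneg h1 h2

lemma ae_convPow_pos {ν : Measure ℝ} [IsProbabilityMeasure ν] (h : ∀ᵐ s ∂ν, 0 < s) {n : ℕ}
    (hn : 1 ≤ n) : ∀ᵐ s ∂(convPow ν n), 0 < s := by
  obtain ⟨m, rfl⟩ : ∃ m, n = m + 1 := ⟨n - 1, by omega⟩
  unfold convPow Measure.conv
  rw [ae_map_iff (by fun_prop) measurableSet_Ioi]
  filter_upwards [Measure.quasiMeasurePreserving_fst.ae
    (ae_convPow_nonneg (h.mono fun s hs => le_of_lt hs) m),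
    Measure.quasiMeasurePreserving_snd.ae h] with p h1 h2
  exact add_pos_of_nonneg_of_pos h1 h2

lemma integral_conv_real {ρ ν : Measure ℝ} {φ : ℝ → ℝ} (hφ : Measurable φ) :
    ∫ s, φ s ∂(ρ.conv ν) = ∫ p, φ (p.1 + p.2) ∂(ρ.prod ν) := by
  unfold Measure.conv
  rw [integral_map (by fun_prop) hφ.aestronglyMeasurable]

lemma integral_exp_convPow (ν : Measure ℝ) [IsProbabilityMeasure ν] (z : ℝ) (n : ℕ) :
    ∫ s, Real.exp (-(z * s)) ∂(convPow ν n) = (∫ s, Real.exp (-(z * s)) ∂ν) ^ n := by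
  induction n with
  | zero => unfold convPow; simp
  | succ n ih =>
    unfold convPow
    rw [integral_conv_real (by fun_prop), pow_succ, ← ih, ← integral_prod_mul]
    refine integral_congr_ae (Eventually.of_forall fun p => ?_)
    change Real.exp _ = Real.exp _ * Real.exp _
    rw [← Real.exp_add]; congr 1; ring

lemma integrable_convPow_sub_pow {ν : Measure ℝ} (h : IsNormalized ν) (n : ℕ) {k : ℕ} (hk : k ≤ 4) :
    Integrable (fun s : ℝ => (s - n) ^ k) (convPow ν n) := by
  have := h.prob
  induction n generalizing k with
  | zero => exact integrable_dirac (by simp)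
  | succ n ih =>
    unfold convPow Measure.conv
    rw [integrable_map_measure (by fun_prop) (by fun_prop)]
    have : (fun s : ℝ => (s - (n + 1 : ℕ)) ^ k) ∘ (fun p : ℝ × ℝ => p.1 + p.2) =
        fun p : ℝ × ℝ => ∑ i ∈ Finset.range (k + 1),
          (p.1 - n) ^ i * (p.2 - 1) ^ (k - i) * (k.choose i : ℝ) := by
      ext p
      rw [← add_pow]; simp only [Function.comp]; push_cast; ring
    rw [this]
    refine integrable_finsetSum _ fun i hi => Integrable.mul_const ?_ _
    exact (ih (by simp only [Finset.mem_range] at hi; omega)).mul_prod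
      (h.integrable_sub_pow (by omega))

lemma integral_convPow_succ {ν : Measure ℝ} (h : IsNormalized ν) (n : ℕ) {k : ℕ} (hk : k ≤ 4) :
    ∫ s : ℝ, (s - (n + 1 : ℕ)) ^ k ∂(convPow ν (n + 1)) = ∑ i ∈ Finset.range (k + 1),
      (∫ s : ℝ, (s - n) ^ i ∂(convPow ν n)) * (∫ s : ℝ, (s - 1) ^ (k - i) ∂ν) * (k.choose i : ℝ) := by
  have := h.prob
  rw [convPow, integral_conv_real (by fun_prop)]
  have : ∀ p : ℝ × ℝ, (p.1 + p.2 - (n + 1 : ℕ)) ^ k = ∑ i ∈ Finset.range (k + 1),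
      (p.1 - n) ^ i * (p.2 - 1) ^ (k - i) * (k.choose i : ℝ) := by
    intro p
    rw [← add_pow]; push_cast; ring
  simp only [this]
  rw [integral_finsetSum]
  · refine Finset.sum_congr rfl fun i _ => ?_
    rw [integral_mul_const, integral_prod_mul (fun s : ℝ => (s - n) ^ i) (fun s : ℝ => (s - 1) ^ (k - i))]
  · intro i hi
    exact ((integrable_convPow_sub_pow h n
      (by simp only [Finset.mem_range] at hi; omega)).mul_prod
      (h.integrable_sub_pow (by omega))).mul_const _

/-- Induction on the binomial expansion for an independent sum; vanishing first centred moments kill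
most cross terms. The fourth moment is quadratic in `n`, so after division by `n⁴` it is of order
`n^{-2}`, as is the third after division by `n³`. -/
lemma integral_convPow_moments {ν : Measure ℝ} (h : IsNormalized ν) (n : ℕ) :
    (∫ s : ℝ, (s - n) ^ 1 ∂(convPow ν n) = 0) ∧
    (∫ s : ℝ, (s - n) ^ 2 ∂(convPow ν n) = n * ∫ s : ℝ, (s - 1) ^ 2 ∂ν) ∧
    (∫ s : ℝ, (s - n) ^ 3 ∂(convPow ν n) = n * ∫ s : ℝ, (s - 1) ^ 3 ∂ν) ∧
    (∫ s : ℝ, (s - n) ^ 4 ∂(convPow ν n) = n * ∫ s : ℝ, (s - 1) ^ 4 ∂ν +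
      3 * n * (n - 1) * (∫ s : ℝ, (s - 1) ^ 2 ∂ν) ^ 2) := by
  have := h.prob
  induction n with
  | zero => simp [convPow]
  | succ n ih =>
    obtain ⟨i1, i2, i3, i4⟩ := ih
    rw [integral_convPow_succ h n (by norm_num), integral_convPow_succ h n (by norm_num),
      integral_convPow_succ h n (by norm_num), integral_convPow_succ h n (by norm_num)]
    simp only [Finset.sum_range_succ, i1, i2, i3, i4]
    simp [h.integral_sub_one, Nat.choose]
    refine ⟨?_, ?_, ?_⟩ <;> ring

/-- The law of the mean of `n` independent variables of law `ν`. -/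
def meanLaw (ν : Measure ℝ) (n : ℕ) : Measure ℝ := (convPow ν n).map fun s => s / n

lemma integral_meanLaw (ν : Measure ℝ) (n : ℕ) {φ : ℝ → ℝ} (hφ : Measurable φ) :
    ∫ s, φ s ∂(meanLaw ν n) = ∫ s, φ (s / n) ∂(convPow ν n) := by
  rw [meanLaw, integral_map (by fun_prop) hφ.aestronglyMeasurable]

lemma integral_meanLaw_sub_pow (ν : Measure ℝ) {n : ℕ} (hn : 1 ≤ n) (k : ℕ) :
    ∫ s : ℝ, (s - 1) ^ k ∂(meanLaw ν n) = (∫ s : ℝ, (s - n) ^ k ∂(convPow ν n)) / n ^ k := by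
  have hn0 : (n : ℝ) ≠ 0 := by positivity
  rw [integral_meanLaw ν n (by fun_prop), ← integral_div]
  refine integral_congr_ae (Eventually.of_forall fun s => ?_)
  change (s / n - 1) ^ k = (s - n) ^ k / n ^ k
  rw [← div_pow, sub_div, div_self hn0]

lemma IsNormalized.meanLaw {ν : Measure ℝ} (h : IsNormalized ν) {n : ℕ} (hn : 1 ≤ n) :
    IsNormalized (meanLaw ν n) := by
  have := h.prob
  have hn0 : (0 : ℝ) < n := by positivity
  have hprob : IsProbabilityMeasure (SemigroupApprox.meanLaw ν n) :=
    Measure.isProbabilityMeasure_map (by fun_prop)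
  have h4 : Integrable (fun s => (s - 1) ^ 4) (SemigroupApprox.meanLaw ν n) := by
    rw [SemigroupApprox.meanLaw, integrable_map_measure (by fun_prop) (by fun_prop)]
    refine ((integrable_convPow_sub_pow h n le_rfl).div_const (n ^ 4)).congr
      (Eventually.of_forall fun s => ?_)
    change (s - n) ^ 4 / n ^ 4 = (s / n - 1) ^ 4
    rw [← div_pow, sub_div, div_self hn0.ne']
  -- By convexity, `s⁴ ≤ 8 ((s-1)⁴ + 1)`.
  have h4' : Integrable (fun s => s ^ 4) (SemigroupApprox.meanLaw ν n) := by
    refine ((h4.const_mul 8).add (integrable_const 8)).mono' (by fun_prop)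
      (Eventually.of_forall fun s => ?_)
    rw [Real.norm_of_nonneg (by positivity), Pi.add_apply]
    nlinarith [sq_nonneg (s - 2), sq_nonneg ((s - 1) ^ 2 - 1), sq_nonneg (s ^ 2 - 2 * s),
      sq_nonneg (s ^ 2 - (s - 1) ^ 2 - 1), sq_nonneg (s ^ 2 - 4 * s + 4)]
  refine ⟨hprob, ?_, h4', ?_⟩
  · rw [SemigroupApprox.meanLaw, ae_map_iff (by fun_prop) measurableSet_Ioi]
    filter_upwards [ae_convPow_pos h.pos hn] with s hs
    exact div_pos hs hn0
  · have h1 := integral_meanLaw_sub_pow ν hn 1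
    rw [(integral_convPow_moments h n).1, zero_div] at h1
    simp only [pow_one] at h1
    rw [integral_sub (by simpa using integrable_pow_of_pow_four h4' (k := 1) (by norm_num))
      (integrable_const _)] at h1
    simp at h1
    linarith

/-- Chernoff's bound for the sum. The rate `z` is left free: a fixed `z` will give decay in `n`, and
`z = 1/(ns)` decay in `s`. -/
lemma measureReal_meanLaw_Iic_le {ν : Measure ℝ} [IsProbabilityMeasure ν] (h : ∀ᵐ s ∂ν, 0 ≤ s)
    {n : ℕ} (hn : 1 ≤ n) {z : ℝ} (hz : 0 ≤ z) (s : ℝ) :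
    (meanLaw ν n).real (Iic s) ≤
      Real.exp (z * (n * s)) * (∫ τ, Real.exp (-(z * τ)) ∂ν) ^ n := by
  have hn0 : (0 : ℝ) < n := by positivity
  have : (meanLaw ν n).real (Iic s) = (convPow ν n).real (Iic (n * s)) := by
    rw [measureReal_def, measureReal_def, meanLaw, Measure.map_apply (by fun_prop) measurableSet_Iic]
    congr 2
    ext τ
    simp only [mem_preimage, mem_Iic, div_le_iff₀ hn0, mul_comm]
  rw [this, ← integral_exp_convPow]
  exact measureReal_Iic_le (ae_convPow_nonneg h n) hz _

/-- The coefficients `b` and `d₁` of the law of the mean of `n` independent copies. -/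
theorem IsNormalized.exists_dCoeff_meanLaw_le {ν : Measure ℝ} (h : IsNormalized ν) {C : ℝ}
    (hC : 0 ≤ C) {k : ℕ} (hk : 1 ≤ k)
    (hg : ∀ z, 0 < z → ∫ s, Real.exp (-(z * s)) ∂ν ≤ C * z⁻¹ ^ ((k : ℝ)⁻¹)) :
    ∃ D : ℝ, ∀ n : ℕ, 1 ≤ n →
      IntegrableOn (dIntegrand (SemigroupApprox.meanLaw ν n)) (Ioi 0) ∧
      dCoeff (SemigroupApprox.meanLaw ν n) ≤ D / n ^ 2 := by
  have := h.prob
  have hnn : ∀ᵐ s ∂ν, 0 ≤ s := h.pos.mono fun s hs => le_of_lt hs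
  set L : ℝ → ℝ := fun z => ∫ s, Real.exp (-(z * s)) ∂ν with hL
  have hL0 : ∀ z, 0 ≤ L z := fun z => integral_nonneg fun s => (Real.exp_pos _).le
  have hL1 : ∀ z, 0 ≤ z → L z ≤ 1 := fun z hz => by
    have : L z ≤ ∫ s, (1 : ℝ) ∂ν := by
      refine integral_mono_ae (integrable_exp_neg_mul hnn hz) (integrable_const _) ?_
      filter_upwards [hnn] with s hs
      exact Real.exp_le_one_iff.2 (by nlinarith)
    simpa using this
  set m₂ := ∫ s, s ^ 2 ∂ν with hm₂
  have hm₂0 : 0 ≤ m₂ := integral_nonneg fun s => by positivity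
  -- Any `ℓ > 0` with `m₂ ℓ < 1` works: then `L(ℓ) ≤ 1 - ℓ + m₂ℓ²/2 < 1 - ℓ/2 ≤ e^{-ℓ/2}`, that is,
  -- `q < 1`. The power `q^n` bounds the probability that the mean of `n` copies is at most `1/2`.
  set ℓ : ℝ := 1 / (m₂ + 1) with hℓ
  have hℓ0 : 0 < ℓ := by positivity
  have hℓm : m₂ * ℓ < 1 := by rw [hℓ, mul_one_div, div_lt_one (by positivity)]; linarith
  set q : ℝ := Real.exp (ℓ / 2) * L ℓ with hq
  have hq0 : 0 ≤ q := mul_nonneg (Real.exp_pos _).le (hL0 _)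
  have hq1 : q < 1 := by
    have h1 : L ℓ ≤ 1 - ℓ + m₂ * ℓ ^ 2 / 2 := by
      have e : 1 - ℓ + m₂ * ℓ ^ 2 / 2 = ∫ s, (1 - ℓ * s + ℓ ^ 2 / 2 * s ^ 2) ∂ν := by
        have i1 : Integrable (fun s => 1 - ℓ * s) ν :=
          (integrable_const _).sub (h.integrable_id.const_mul _)
        rw [integral_add i1 ((h.integrable_pow (by norm_num)).const_mul _), integral_sub (integrable_const _)
          (h.integrable_id.const_mul _), integral_const_mul, integral_const_mul, h.mean]
        simp; ring
      rw [e]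
      refine integral_mono_ae (integrable_exp_neg_mul hnn hℓ0.le)
        (((integrable_const _).sub (h.integrable_id.const_mul _)).add
          ((h.integrable_pow (by norm_num)).const_mul _)) ?_
      filter_upwards [hnn] with s hs
      have hx : 0 ≤ ℓ * s := by positivity
      have h2 := Real.quadratic_le_exp_of_nonneg hx
      have h3 : 0 ≤ ℓ * s := hx
      have h4 : Real.exp (-(ℓ * s)) * Real.exp (ℓ * s) = 1 := by
        rw [← Real.exp_add]; simp
      have h5 : 0 < Real.exp (-(ℓ * s)) := Real.exp_pos _
      change Real.exp (-(ℓ * s)) ≤ 1 - ℓ * s + ℓ ^ 2 / 2 * s ^ 2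
      set x := ℓ * s with hxdef
      have h6 : ℓ ^ 2 / 2 * s ^ 2 = x ^ 2 / 2 := by rw [hxdef]; ring
      rw [h6]
      have h7 : Real.exp (-x) * (1 + x + x ^ 2 / 2) ≤ 1 := by
        have := mul_le_mul_of_nonneg_left h2 h5.le
        linarith
      -- The product equals `1 + x⁴/4`.
      have h8 : 1 ≤ (1 - x + x ^ 2 / 2) * (1 + x + x ^ 2 / 2) := by nlinarith [sq_nonneg (x ^ 2)]
      have h9 : 0 < 1 + x + x ^ 2 / 2 := by positivity
      exact le_of_mul_le_mul_right (h7.trans h8) h9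
    have h2 : L ℓ < Real.exp (-(ℓ / 2)) := by
      have := Real.add_one_le_exp (-(ℓ / 2))
      nlinarith
    calc q < Real.exp (ℓ / 2) * Real.exp (-(ℓ / 2)) := by rw [hq]; gcongr
      _ = 1 := by rw [← Real.exp_add]; simp
  -- Four powers of `n` produce the factor `n^{-2}` in a bound for the square of the mass; the fifth
  -- absorbs the `n` in `hBd`.
  obtain ⟨B, hB⟩ : ∃ B : ℝ, ∀ n : ℕ, (n : ℝ) ^ 5 * q ^ n ≤ B := by
    have := (tendsto_pow_const_mul_const_pow_of_lt_one 5 hq0 hq1).bddAbove_range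
    obtain ⟨B, hB⟩ := this
    exact ⟨B, fun n => hB ⟨n, rfl⟩⟩
  have hB0 : 0 ≤ B := le_trans (by simp) (hB 0)
  set W := Real.sqrt (Real.exp 1 * C * B) with hW
  set δ : ℝ := (k : ℝ)⁻¹ / 2 with hδ
  have hk0 : (0 : ℝ) < k := by positivity
  have hδ0 : 0 < δ := by positivity
  refine ⟨∫ s : ℝ, (s - 1) ^ 4 ∂ν + 3 * (∫ s : ℝ, (s - 1) ^ 2 ∂ν) ^ 2 + W / δ, fun n hn => ?_⟩
  have hn0 : (0 : ℝ) < n := by positivity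
  have hn1 : (1 : ℝ) ≤ n := by exact_mod_cast hn
  -- The bounds `hA` (exponential in `n`) and `hBd` (a power of `s`) are interpolated by `P² = P ·
  -- P`, which halves the exponent `1/k`.
  have hmass : ∀ s, 0 < s → s ≤ 1 / 2 →
      (SemigroupApprox.meanLaw ν n).real (Iic s) ≤ W / n ^ 2 * s ^ δ := by
    intro s hs hs2
    set P := (SemigroupApprox.meanLaw ν n).real (Iic s) with hP
    have hP0 : 0 ≤ P := measureReal_nonneg
    have hA : P ≤ q ^ n := by
      refine (measureReal_meanLaw_Iic_le hnn hn hℓ0.le s).trans ?_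
      rw [hq, mul_pow, ← Real.exp_nat_mul]
      refine mul_le_mul_of_nonneg_right (Real.exp_le_exp.2 ?_) (pow_nonneg (hL0 _) _)
      have : ℓ * (n * s) ≤ ℓ * (n * (1 / 2)) := by gcongr
      linarith
    have hBd : P ≤ Real.exp 1 * C * n * s ^ ((k : ℝ)⁻¹) := by
      have hns : 0 < n * s := by positivity
      -- This rate makes the exponential factor equal to `e`. Of the `n` factors `L`, each at most
      -- one, a single one is kept.
      refine (measureReal_meanLaw_Iic_le hnn hn (z := (n * s)⁻¹) (by positivity) s).trans ?_
      rw [inv_mul_cancel₀ hns.ne']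
      have h1 : L ((n * s)⁻¹) ^ n ≤ C * (n * s ^ ((k : ℝ)⁻¹)) := by
        calc L ((n * s)⁻¹) ^ n ≤ L ((n * s)⁻¹) :=
              pow_le_of_le_one (hL0 _) (hL1 _ (by positivity)) (by omega)
          _ ≤ C * (n * s) ^ ((k : ℝ)⁻¹) := by
              have := hg ((n * s)⁻¹) (by positivity)
              rwa [inv_inv] at this
          _ ≤ C * (n * s ^ ((k : ℝ)⁻¹)) := by
              rw [Real.mul_rpow hn0.le hs.le]
              gcongr
              calc (n : ℝ) ^ ((k : ℝ)⁻¹) ≤ (n : ℝ) ^ (1 : ℝ) :=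
                    Real.rpow_le_rpow_of_exponent_le hn1
                      (inv_le_one_of_one_le₀ (by exact_mod_cast hk))
                _ = n := Real.rpow_one _
      calc Real.exp 1 * L ((n * s)⁻¹) ^ n ≤ Real.exp 1 * (C * (n * s ^ ((k : ℝ)⁻¹))) := by gcongr
        _ = _ := by ring
    have hsq : P ^ 2 ≤ (W / n ^ 2 * s ^ δ) ^ 2 := by
      have e1 : (s ^ δ) ^ 2 = s ^ ((k : ℝ)⁻¹) := by
        rw [← Real.rpow_natCast, ← Real.rpow_mul hs.le, hδ]; congr 1; push_cast; ring
      have e2 : W ^ 2 = Real.exp 1 * C * B := Real.sq_sqrt (by positivity)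
      rw [mul_pow, div_pow, e1, e2]
      calc P ^ 2 = P * P := sq P
        _ ≤ q ^ n * (Real.exp 1 * C * n * s ^ ((k : ℝ)⁻¹)) := by gcongr
        _ = Real.exp 1 * C * (n ^ 5 * q ^ n) / (n ^ 2) ^ 2 * s ^ ((k : ℝ)⁻¹) := by field_simp
        _ ≤ _ := by gcongr; exact hB n
    exact (pow_le_pow_iff_left₀ hP0 (by positivity) two_ne_zero).1 hsq
  obtain ⟨hd, hle⟩ := (h.meanLaw hn).dCoeff_le hδ0 hmass
  refine ⟨hd, hle.trans ?_⟩
  rw [integral_meanLaw_sub_pow ν hn, (integral_convPow_moments h n).2.2.2]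
  set κ := ∫ s : ℝ, (s - 1) ^ 4 ∂ν
  have hκ : 0 ≤ κ := integral_nonneg fun s => by positivity
  set σ := (∫ s : ℝ, (s - 1) ^ 2 ∂ν) ^ 2
  have hσ : 0 ≤ σ := sq_nonneg _
  have e : (κ + 3 * σ + W / δ) / n ^ 2 = (κ * n ^ 2 + 3 * n ^ 2 * σ) / n ^ 4 + W / n ^ 2 / δ := by
    field_simp
  rw [e]
  gcongr ?_ / _ + _
  have : (n : ℝ) ≤ n ^ 2 := by nlinarith
  have h1 : n * κ ≤ κ * n ^ 2 := by nlinarith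
  have h2 : 3 * n * (n - 1) * σ ≤ 3 * n ^ 2 * σ := by
    refine mul_le_mul_of_nonneg_right ?_ hσ
    nlinarith
  linarith

lemma meanLaw_one (ν : Measure ℝ) [IsProbabilityMeasure ν] : meanLaw ν 1 = ν := by
  simp [meanLaw, convPow]

lemma IsNormalized.bCoeff_meanLaw {ν : Measure ℝ} (h : IsNormalized ν) {n : ℕ} (hn : 1 ≤ n) :
    bCoeff (SemigroupApprox.meanLaw ν n) = bCoeff ν / n ^ 2 := by
  have hn0 : (n : ℝ) ≠ 0 := by positivity
  rw [(h.meanLaw hn).bCoeff_eq, h.bCoeff_eq, integral_meanLaw_sub_pow ν hn,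
    (integral_convPow_moments h n).2.2.1]
  field_simp

lemma IsNormalized.variance_meanLaw {ν : Measure ℝ} (h : IsNormalized ν) {n : ℕ} (hn : 1 ≤ n) :
    ∫ s : ℝ, (s - 1) ^ 2 ∂(SemigroupApprox.meanLaw ν n) = (∫ s : ℝ, (s - 1) ^ 2 ∂ν) / (n : ℝ) := by
  have hn0 : (n : ℝ) ≠ 0 := by positivity
  rw [integral_meanLaw_sub_pow ν hn, (integral_convPow_moments h n).2.1]
  field_simp

/-- The representing measure of a function of class `B₄` and `L^k`. -/
theorem Represents.isNormalized {g : ℝ → ℝ} (hg : g ∈ B₄) {k : ℕ} (hk : 1 ≤ k)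
    (hL : MemLp g k (volume.restrict (Ioi (0 : ℝ)))) {ν : Measure ℝ} (h : Represents g ν) :
    IsNormalized ν ∧ aCoeff g = (∫ s : ℝ, (s - 1) ^ 2 ∂ν) / 2 ∧
      ∃ C : ℝ, 0 ≤ C ∧ ∀ z, 0 < z → ∫ s, Real.exp (-(z * s)) ∂ν ≤ C * z⁻¹ ^ ((k : ℝ)⁻¹) := by
  obtain ⟨⟨⟨⟨hcm, -⟩, h0, h1⟩, l₂, h2⟩, l₄, h4⟩ := hg
  have hfin := h.1
  have hchain := hcm.isCMChain
  obtain ⟨C, hC0, hC⟩ := exists_le_rpow_of_memLp hchain.antitoneOn (fun z hz => hchain.nonneg hz)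
    hk hL
  have hC' : ∀ z, 0 < z → ∫ s, Real.exp (-(z * s)) ∂ν ≤ C * z⁻¹ ^ ((k : ℝ)⁻¹) := fun z hz => by
    rw [← h.2.2 z hz]; exact hC z hz
  have hprob : IsProbabilityMeasure ν := by
    have := (h.moment h0).2
    simp only [pow_zero, integral_const, smul_eq_mul, mul_one] at this
    exact ⟨by rw [← ENNReal.ofReal_toReal (measure_ne_top ν _)]; rw [measureReal_def] at this; simp [this]⟩
  -- The transform dominates the mass at 0 for every `z`, and it tends to 0 at infinity.
  have hpos : ∀ᵐ s ∂ν, 0 < s := by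
    have hlim : Tendsto (fun z : ℝ => C * z⁻¹ ^ ((k : ℝ)⁻¹)) atTop (𝓝 0) := by
      have hk' : (0 : ℝ) < (k : ℝ)⁻¹ := by positivity
      have := (tendsto_inv_atTop_zero.rpow_const (p := (k : ℝ)⁻¹) (Or.inr hk'.le)).const_mul C
      rwa [Real.zero_rpow hk'.ne', mul_zero] at this
    have hz : ν.real (Iic 0) ≤ 0 := by
      refine ge_of_tendsto hlim ?_
      filter_upwards [eventually_gt_atTop 0] with z hz
      have := measureReal_Iic_le h.ae_nonneg hz.le 0
      rw [mul_zero, Real.exp_zero, one_mul] at this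
      exact this.trans (hC' z hz)
    have hz' : ν (Iic 0) = 0 := by
      have := le_antisymm hz measureReal_nonneg
      rwa [measureReal_eq_zero_iff] at this
    rw [ae_iff]; simpa [Iic] using hz'
  have hN : IsNormalized ν := ⟨hprob, hpos, (h.moment h4).1, by simpa using (h.moment h1).2⟩
  refine ⟨hN, ?_, C, hC0, hC'⟩
  have hm2 := (h.moment h2).2
  have e : ∫ s : ℝ, (s - 1) ^ 2 ∂ν = ∫ s, s ^ 2 ∂ν - 1 := by
    have e1 : ∀ s : ℝ, (s - 1) ^ 2 = s ^ 2 - 2 * s + 1 := fun s => by ring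
    simp only [e1]
    have i1 : Integrable (fun s : ℝ => s ^ 2 - 2 * s) ν :=
      (hN.integrable_pow (by norm_num)).sub (hN.integrable_id.const_mul 2)
    rw [integral_add i1 (integrable_const _), integral_sub (hN.integrable_pow (by norm_num))
      (hN.integrable_id.const_mul 2), integral_const_mul, hN.mean]
    simp; ring
  rw [aCoeff, derivZero, Tendsto.limUnder_eq h2, e, hm2]
  norm_num

/-! ### Injectivity of the Laplace transform -/

lemma ae_nonneg_of_Iio {ν : Measure ℝ} (h : ν (Iio 0) = 0) : ∀ᵐ s ∂ν, 0 ≤ s := by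
  rw [ae_iff]; simpa [Iio] using h

lemma norm_exp_neg_mul_le {z : ℂ} (hz : 0 ≤ z.re) {s : ℝ} (hs : 0 ≤ s) :
    ‖Complex.exp (-(z * (s : ℂ)))‖ ≤ 1 := by
  rw [Complex.norm_exp, Real.exp_le_one_iff]
  simp
  positivity

lemma integrable_exp_mul {Ω : Type*} [MeasurableSpace Ω] {σ : Measure Ω} {p : Ω → ℝ}
    (hp : Measurable p) (hp0 : ∀ᵐ η ∂σ, 0 ≤ p η) {h : Ω → ℂ} (hh : Integrable h σ) {z : ℂ}
    (hz : 0 ≤ z.re) :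
    Integrable (fun η => Complex.exp (-(z * (p η : ℂ))) * h η) σ := by
  refine hh.norm.mono' (Measurable.aestronglyMeasurable (by fun_prop) |>.mul hh.1) ?_
  filter_upwards [hp0] with η hη
  rw [norm_mul]
  exact mul_le_of_le_one_left (norm_nonneg _) (norm_exp_neg_mul_le hz hη)

/-- Letting `Re z → 0` shows that the Fourier transform of `w ν` vanishes. The finite measures with
densities `w⁺` and `w⁻` then have the same characteristic function, so they agree, and `w⁺ = w⁻`
forces `w = 0`. -/
lemma ae_eq_zero_of_laplace_real {ν : Measure ℝ} [IsFiniteMeasure ν] (hν : ν (Iio 0) = 0)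
    {w : ℝ → ℝ} (hw : Integrable w ν)
    (h : ∀ z : ℂ, 0 < z.re → ∫ s, Complex.exp (-(z * (s : ℂ))) * (w s : ℂ) ∂ν = 0) :
    w =ᵐ[ν] 0 := by
  have hae := ae_nonneg_of_Iio hν
  have hwc : Integrable (fun s => (w s : ℂ)) ν := hw.ofReal
  have hre : ∀ r t : ℝ, ((r : ℂ) - t * Complex.I).re = r := fun r t => by simp
  have hfour : ∀ t : ℝ, ∫ s, Complex.exp (t * s * Complex.I) * (w s : ℂ) ∂ν = 0 := by
    intro t
    have hseq : Tendsto (fun n : ℕ => 1 / ((n : ℝ) + 1)) atTop (𝓝 0) :=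
      tendsto_one_div_add_atTop_nhds_zero_nat
    have hlim : Tendsto (fun n : ℕ => ∫ s,
        Complex.exp (-((((1 / ((n : ℝ) + 1) : ℝ) : ℂ) - t * Complex.I) * (s : ℂ))) * (w s : ℂ) ∂ν)
        atTop (𝓝 (∫ s, Complex.exp (t * s * Complex.I) * (w s : ℂ) ∂ν)) := by
      refine tendsto_integral_of_dominated_convergence (fun s => ‖(w s : ℂ)‖) ?_ hwc.norm ?_ ?_
      · intro n
        exact (Measurable.aestronglyMeasurable (by fun_prop)).mul hwc.1
      · intro n
        filter_upwards [hae] with s hs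
        rw [norm_mul]
        refine mul_le_of_le_one_left (norm_nonneg _) (norm_exp_neg_mul_le ?_ hs)
        rw [hre]; positivity
      · refine Eventually.of_forall fun s => ?_
        have h1 : Tendsto (fun n : ℕ => Complex.exp
            (-((((1 / ((n : ℝ) + 1) : ℝ) : ℂ) - t * Complex.I) * (s : ℂ)))) atTop
            (𝓝 (Complex.exp (-((((0 : ℝ) : ℂ) - t * Complex.I) * (s : ℂ))))) := by
          refine (Complex.continuous_exp.tendsto _).comp ?_
          exact ((((Complex.continuous_ofReal.tendsto _).comp hseq).sub_const _).mul_const _).neg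
        have h2 : -((((0 : ℝ) : ℂ) - t * Complex.I) * (s : ℂ)) = t * s * Complex.I := by
          push_cast; ring
        rw [h2] at h1
        exact h1.mul_const _
    refine tendsto_nhds_unique hlim (tendsto_const_nhds.congr fun n => ?_)
    rw [h]
    rw [hre]; positivity
  have hfin1 := isFiniteMeasure_withDensity_ofReal hw.2
  have hfin2 := isFiniteMeasure_withDensity_ofReal hw.neg.2
  have hm1 : AEMeasurable (fun s => ENNReal.ofReal (w s)) ν := hw.1.aemeasurable.ennreal_ofReal
  have hm2 : AEMeasurable (fun s => ENNReal.ofReal ((-w) s)) ν :=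
    hw.neg.1.aemeasurable.ennreal_ofReal
  have hmeas : ν.withDensity (fun s => ENNReal.ofReal (w s)) =
      ν.withDensity fun s => ENNReal.ofReal ((-w) s) := by
    refine Measure.ext_of_charFun ?_
    ext t
    rw [charFun_apply_real, charFun_apply_real,
      integral_withDensity_eq_integral_toReal_smul₀ hm1 (by simp),
      integral_withDensity_eq_integral_toReal_smul₀ hm2 (by simp), ← sub_eq_zero]
    have hb : ∀ (v : ℝ → ℝ), Integrable v ν → Integrable (fun s =>
        (ENNReal.ofReal (v s)).toReal • Complex.exp (t * s * Complex.I)) ν := by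
      intro v hv
      refine hv.norm.mono' ?_ (Eventually.of_forall fun s => ?_)
      · exact (hv.1.aemeasurable.ennreal_ofReal.ennreal_toReal.aestronglyMeasurable).smul
          (Measurable.aestronglyMeasurable (by fun_prop))
      · have : ‖Complex.exp (t * s * Complex.I)‖ = 1 := by
          rw [← Complex.ofReal_mul, Complex.norm_exp_ofReal_mul_I]
        rw [norm_smul, this, mul_one, Real.norm_of_nonneg ENNReal.toReal_nonneg]
        rw [ENNReal.toReal_ofReal', Real.norm_eq_abs]
        exact max_le (le_abs_self _) (abs_nonneg _)
    rw [← integral_sub (hb w hw) (hb (-w) hw.neg), ← hfour t]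
    refine integral_congr_ae (Eventually.of_forall fun s => ?_)
    simp only [ENNReal.toReal_ofReal', Pi.neg_apply, ← sub_smul]
    have : max (w s) 0 - max (-w s) 0 = w s := by
      rcases le_total 0 (w s) with h | h
      · rw [max_eq_left h, max_eq_right (by linarith)]; ring
      · rw [max_eq_right h, max_eq_left (by linarith)]; ring
    rw [this, Complex.real_smul, mul_comm]
  have := (withDensity_eq_iff hm1 hm2 (by
    rw [← setLIntegral_univ, ← withDensity_apply _ MeasurableSet.univ]
    exact measure_ne_top _ _)).1 hmeas
  filter_upwards [this] with s hs
  rcases le_total 0 (w s) with h | h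
  · rw [ENNReal.ofReal_of_nonpos (p := (-w) s) (by simpa using h), ENNReal.ofReal_eq_zero] at hs
    exact le_antisymm hs h
  · rw [ENNReal.ofReal_of_nonpos h, eq_comm, ENNReal.ofReal_eq_zero, Pi.neg_apply] at hs
    exact le_antisymm h (neg_nonpos.1 hs)

/-- Conjugating the hypothesis at the conjugate point shows that the conjugate density also has
vanishing transform; real and imaginary parts are combinations of the two. -/
lemma ae_eq_zero_of_laplace {ν : Measure ℝ} [IsFiniteMeasure ν] (hν : ν (Iio 0) = 0)
    {h : ℝ → ℂ} (hh : Integrable h ν)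
    (h0 : ∀ z : ℂ, 0 < z.re → ∫ s, Complex.exp (-(z * (s : ℂ))) * h s ∂ν = 0) :
    h =ᵐ[ν] 0 := by
  have hae := ae_nonneg_of_Iio hν
  have hconj : ∀ z : ℂ, 0 < z.re →
      ∫ s, Complex.exp (-(z * (s : ℂ))) * (starRingEnd ℂ) (h s) ∂ν = 0 := by
    intro z hz
    have := congrArg (starRingEnd ℂ) (h0 ((starRingEnd ℂ) z) (by simpa using hz))
    rw [← integral_conj, map_zero] at this
    rw [← this]
    refine integral_congr_ae (Eventually.of_forall fun s => ?_)
    simp [← Complex.exp_conj]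
  have hci : Integrable (fun s => (starRingEnd ℂ) (h s)) ν :=
    hh.norm.mono' (Complex.continuous_conj.comp_aestronglyMeasurable hh.1)
      (Eventually.of_forall fun s => by simp)
  have hi1 : ∀ z : ℂ, 0 < z.re → Integrable (fun s : ℝ => Complex.exp (-(z * (s : ℂ))) * h s) ν :=
    fun z hz => integrable_exp_mul (p := fun s => s)
    measurable_id hae hh hz.le
  have hi2 : ∀ z : ℂ, 0 < z.re →
      Integrable (fun s : ℝ => Complex.exp (-(z * (s : ℂ))) * (starRingEnd ℂ) (h s)) ν :=
    fun z hz => integrable_exp_mul (p := fun s => s)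
    measurable_id hae hci hz.le
  have hre : (fun s => (h s).re) =ᵐ[ν] 0 := by
    refine ae_eq_zero_of_laplace_real hν hh.re fun z hz => ?_
    have e : ∀ s : ℝ, Complex.exp (-(z * (s : ℂ))) * ((h s).re : ℂ) =
        (1 / 2) * (Complex.exp (-(z * (s : ℂ))) * h s +
          Complex.exp (-(z * (s : ℂ))) * (starRingEnd ℂ) (h s)) := by
      intro s; rw [Complex.re_eq_add_conj]; ring
    simp only [e]
    rw [integral_const_mul, integral_add (hi1 z hz) (hi2 z hz), h0 z hz, hconj z hz]; simp
  have him : (fun s => (h s).im) =ᵐ[ν] 0 := by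
    refine ae_eq_zero_of_laplace_real hν hh.im fun z hz => ?_
    have e : ∀ s : ℝ, Complex.exp (-(z * (s : ℂ))) * ((h s).im : ℂ) =
        (1 / (2 * Complex.I)) * (Complex.exp (-(z * (s : ℂ))) * h s -
          Complex.exp (-(z * (s : ℂ))) * (starRingEnd ℂ) (h s)) := by
      intro s; rw [Complex.im_eq_sub_conj]; ring
    simp only [e]
    rw [integral_const_mul, integral_sub (hi1 z hz) (hi2 z hz), h0 z hz, hconj z hz]; simp
  filter_upwards [hre, him] with s h1 h2
  exact Complex.ext h1 h2

/-- A sum of two complex measures has to be written over one positive measure. The sum `ν₁ + ν₂`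
dominates both, and the Radon–Nikodym derivatives supply the density. -/
lemma integral_add_rnDeriv_smul {ν₁ ν₂ : Measure ℝ} [IsFiniteMeasure ν₁] [IsFiniteMeasure ν₂]
    {E : Type*} [NormedAddCommGroup E] [NormedSpace ℂ E] {k₁ k₂ : ℝ → ℂ} {F : ℝ → E}
    (i₁ : Integrable (fun s => k₁ s • F s) ν₁) (i₂ : Integrable (fun s => k₂ s • F s) ν₂) :
    ∫ s, ((((ν₁.rnDeriv (ν₁ + ν₂) s).toReal : ℂ) * k₁ s +
      ((ν₂.rnDeriv (ν₁ + ν₂) s).toReal : ℂ) * k₂ s) • F s) ∂(ν₁ + ν₂) =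
    (∫ s, k₁ s • F s ∂ν₁) + ∫ s, k₂ s • F s ∂ν₂ := by
  have hac₁ : ν₁ ≪ ν₁ + ν₂ := Measure.AbsolutelyContinuous.rfl.add_right _
  have hac₂ : ν₂ ≪ ν₁ + ν₂ := by
    rw [add_comm]; exact Measure.AbsolutelyContinuous.rfl.add_right _
  rw [← integral_rnDeriv_smul hac₁, ← integral_rnDeriv_smul hac₂,
    ← integral_add ((integrable_rnDeriv_smul_iff hac₁).2 i₁)
      ((integrable_rnDeriv_smul_iff hac₂).2 i₂)]
  refine integral_congr_ae (Eventually.of_forall fun s => ?_)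
  simp only [add_smul, mul_smul, Complex.coe_smul]

lemma eq_pos_sub_neg (a : ℂ) : a = ((max a.re 0 : ℝ) : ℂ) - ((max (-a.re) 0 : ℝ) : ℂ) +
    Complex.I * (((max a.im 0 : ℝ) : ℂ) - ((max (-a.im) 0 : ℝ) : ℂ)) := by
  have e : ∀ r : ℝ, max r 0 - max (-r) 0 = r := fun r => by
    rcases le_total 0 r with h | h
    · rw [max_eq_left h, max_eq_right (by linarith)]; ring
    · rw [max_eq_right h, max_eq_left (by linarith)]; ring
  rw [← Complex.ofReal_sub, ← Complex.ofReal_sub, e, e, mul_comm, Complex.re_add_im]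

lemma integral_smul_pos_sub_neg {Ω : Type*} [MeasurableSpace Ω] {σ : Measure Ω}
    {E : Type*} [NormedAddCommGroup E] [NormedSpace ℂ E] {h : Ω → ℂ} {F : Ω → E}
    (j₁ : Integrable (fun η => ((max (h η).re 0 : ℝ) : ℂ) • F η) σ)
    (j₂ : Integrable (fun η => ((max (-(h η).re) 0 : ℝ) : ℂ) • F η) σ)
    (j₃ : Integrable (fun η => ((max (h η).im 0 : ℝ) : ℂ) • F η) σ)
    (j₄ : Integrable (fun η => ((max (-(h η).im) 0 : ℝ) : ℂ) • F η) σ) :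
    ∫ η, h η • F η ∂σ = (∫ η, ((max (h η).re 0 : ℝ) : ℂ) • F η ∂σ) -
      (∫ η, ((max (-(h η).re) 0 : ℝ) : ℂ) • F η ∂σ) +
      Complex.I • ((∫ η, ((max (h η).im 0 : ℝ) : ℂ) • F η ∂σ) -
        ∫ η, ((max (-(h η).im) 0 : ℝ) : ℂ) • F η ∂σ) := by
  have e : ∀ η, h η • F η = (((max (h η).re 0 : ℝ) : ℂ) • F η -
      ((max (-(h η).re) 0 : ℝ) : ℂ) • F η) + Complex.I • (((max (h η).im 0 : ℝ) : ℂ) • F η -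
      ((max (-(h η).im) 0 : ℝ) : ℂ) • F η) := fun η => by
    conv_lhs => rw [eq_pos_sub_neg (h η)]
    module
  have j12 : Integrable (fun η => ((max (h η).re 0 : ℝ) : ℂ) • F η -
      ((max (-(h η).re) 0 : ℝ) : ℂ) • F η) σ := j₁.sub j₂
  have j34 : Integrable (fun η => Complex.I • (((max (h η).im 0 : ℝ) : ℂ) • F η -
      ((max (-(h η).im) 0 : ℝ) : ℂ) • F η)) σ := (j₃.sub j₄).smul Complex.I
  simp only [e]
  rw [integral_add j12 j34, integral_smul, integral_sub j₁ j₂, integral_sub j₃ j₄]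

/-! ### The Hille-Phillips calculus -/

section HP

variable {X : Type*} [NormedAddCommGroup X] [NormedSpace ℂ X]

/-- A bounded `C₀`-semigroup. -/
structure IsBddSemigroup (T : ℝ → X →L[ℂ] X) (c : ℝ) : Prop where
  c0 : IsC0Semigroup T
  bound : ∀ t : ℝ, 0 ≤ t → ‖T t‖ ≤ c

/-- `B = f(A)` in the Hille-Phillips calculus. -/
def IsHP (T : ℝ → X →L[ℂ] X) (f : ℂ → ℂ) (B : X →L[ℂ] X) : Prop :=
  ∃ (ν : Measure ℝ) (h : ℝ → ℂ), IsLaplace f ν h ∧ ∀ x, hpComplex T ν h x = B x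

lemma IsHP.congr {T : ℝ → X →L[ℂ] X} {f f' : ℂ → ℂ} {B : X →L[ℂ] X} (h : IsHP T f B)
    (hf : ∀ z : ℂ, 0 < z.re → f z = f' z) : IsHP T f' B := by
  obtain ⟨ν, k, ⟨h1, h2, h3, h4⟩, h5⟩ := h
  exact ⟨ν, k, ⟨h1, h2, h3, fun z hz => by rw [← hf z hz, h4 z hz]⟩, h5⟩

namespace IsBddSemigroup

variable {T : ℝ → X →L[ℂ] X} {c : ℝ}

lemma nonneg (hT : IsBddSemigroup T c) : 0 ≤ c := (norm_nonneg _).trans (hT.bound 0 le_rfl)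

lemma continuous_orbit (hT : IsBddSemigroup T c) (x : X) :
    Continuous fun s : ℝ => T (max s 0) x :=
  (hT.c0.2.2 x).comp_continuous (by fun_prop) fun s => mem_Ici.2 (le_max_right _ _)

lemma norm_apply_le (hT : IsBddSemigroup T c) {t : ℝ} (ht : 0 ≤ t) (x : X) :
    ‖T t x‖ ≤ c * ‖x‖ := (T t).le_of_opNorm_le (hT.bound t ht) x

lemma aestronglyMeasurable (hT : IsBddSemigroup T c) {Ω : Type*} [MeasurableSpace Ω]
    {σ : Measure Ω} {p : Ω → ℝ} (hp : Measurable p) (hp0 : ∀ᵐ η ∂σ, 0 ≤ p η) (x : X) :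
    AEStronglyMeasurable (fun η => T (p η) x) σ := by
  refine ((hT.continuous_orbit x).stronglyMeasurable.comp_measurable hp).aestronglyMeasurable.congr
    ?_
  filter_upwards [hp0] with η hη
  simp [max_eq_left hη]

lemma integrable_smul (hT : IsBddSemigroup T c) {Ω : Type*} [MeasurableSpace Ω]
    {σ : Measure Ω} {p : Ω → ℝ} (hp : Measurable p) (hp0 : ∀ᵐ η ∂σ, 0 ≤ p η) {h : Ω → ℂ}
    (hh : Integrable h σ) (x : X) : Integrable (fun η => h η • T (p η) x) σ := by
  refine (hh.norm.mul_const (c * ‖x‖)).mono' (hh.1.smul (hT.aestronglyMeasurable hp hp0 x)) ?_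
  filter_upwards [hp0] with η hη
  rw [norm_smul]
  gcongr
  exact hT.norm_apply_le hη x

/-- The operator `x ↦ ∫ h T(p) x dσ`. -/
def avg (hT : IsBddSemigroup T c) {Ω : Type*} [MeasurableSpace Ω]
    {σ : Measure Ω} {p : Ω → ℝ} (hp : Measurable p) (hp0 : ∀ᵐ η ∂σ, 0 ≤ p η) {h : Ω → ℂ}
    (hh : Integrable h σ) : X →L[ℂ] X :=
  LinearMap.mkContinuous
    { toFun := fun x => ∫ η, h η • T (p η) x ∂σ
      map_add' := fun x y => by
        simp only [map_add, smul_add]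
        exact integral_add (hT.integrable_smul hp hp0 hh x) (hT.integrable_smul hp hp0 hh y)
      map_smul' := fun a x => by
        simp only [map_smul, RingHom.id_apply]
        rw [← integral_smul]
        simp only [smul_comm a] }
    ((∫ η, ‖h η‖ ∂σ) * c) fun x => by
      refine (norm_integral_le_of_norm_le (hh.norm.mul_const (c * ‖x‖)) ?_).trans (le_of_eq ?_)
      · filter_upwards [hp0] with η hη
        rw [norm_smul]
        gcongr
        exact hT.norm_apply_le hη x
      · rw [integral_mul_const]; ring

lemma avg_apply (hT : IsBddSemigroup T c) {Ω : Type*} [MeasurableSpace Ω]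
    {σ : Measure Ω} {p : Ω → ℝ} (hp : Measurable p) (hp0 : ∀ᵐ η ∂σ, 0 ≤ p η) {h : Ω → ℂ}
    (hh : Integrable h σ) (x : X) : hT.avg hp hp0 hh x = ∫ η, h η • T (p η) x ∂σ := rfl

lemma norm_avg_le (hT : IsBddSemigroup T c) {Ω : Type*} [MeasurableSpace Ω]
    {σ : Measure Ω} {p : Ω → ℝ} (hp : Measurable p) (hp0 : ∀ᵐ η ∂σ, 0 ≤ p η) {h : Ω → ℂ}
    (hh : Integrable h σ) : ‖hT.avg hp hp0 hh‖ ≤ (∫ η, ‖h η‖ ∂σ) * c :=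
  LinearMap.mkContinuous_norm_le _
    (mul_nonneg (integral_nonneg fun _ => norm_nonneg _) hT.nonneg) _

lemma exists_isHP (hT : IsBddSemigroup T c) {f : ℂ → ℂ} {ν : Measure ℝ} {h : ℝ → ℂ}
    (hf : IsLaplace f ν h) : ∃ B : X →L[ℂ] X, IsHP T f B ∧ ∀ x, hpComplex T ν h x = B x :=
  ⟨hT.avg measurable_id (ae_nonneg_of_Iio hf.2.1) hf.2.2.1, ⟨ν, h, hf, fun _ => rfl⟩, fun _ => rfl⟩

lemma isHP_smul {f : ℂ → ℂ} {B : X →L[ℂ] X} (a : ℂ) (h : IsHP T f B) :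
    IsHP T (fun z => a * f z) (a • B) := by
  obtain ⟨ν, k, ⟨h1, h2, h3, h4⟩, h5⟩ := h
  refine ⟨ν, fun s => a * k s, ⟨h1, h2, h3.const_mul a, fun z hz => ?_⟩, fun x => ?_⟩
  · change a * f z = _
    rw [h4 z hz, ← integral_const_mul]
    refine integral_congr_ae (Eventually.of_forall fun s => ?_)
    change _ = _ * _
    ring
  · simp only [hpComplex, smul_apply, ← h5, mul_smul]
    rw [integral_smul]

lemma isHP_add (hT : IsBddSemigroup T c) {f g : ℂ → ℂ} {B B' : X →L[ℂ] X} (h : IsHP T f B)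
    (h' : IsHP T g B') : IsHP T (fun z => f z + g z) (B + B') := by
  obtain ⟨ν₁, k₁, ⟨a1, a2, a3, a4⟩, a5⟩ := h
  obtain ⟨ν₂, k₂, ⟨b1, b2, b3, b4⟩, b5⟩ := h'
  refine ⟨ν₁ + ν₂, fun s => ((ν₁.rnDeriv (ν₁ + ν₂) s).toReal : ℂ) * k₁ s +
    ((ν₂.rnDeriv (ν₁ + ν₂) s).toReal : ℂ) * k₂ s, ⟨inferInstance, by simp [a2, b2], ?_,
    fun z hz => ?_⟩, fun x => ?_⟩
  · have hac₁ : ν₁ ≪ ν₁ + ν₂ := Measure.AbsolutelyContinuous.rfl.add_right _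
    have hac₂ : ν₂ ≪ ν₁ + ν₂ := by
      rw [add_comm]; exact Measure.AbsolutelyContinuous.rfl.add_right _
    refine Integrable.add ?_ ?_
    · simpa using! (integrable_rnDeriv_smul_iff hac₁).2 a3
    · simpa using! (integrable_rnDeriv_smul_iff hac₂).2 b3
  · have i₁ := integrable_exp_mul measurable_id (ae_nonneg_of_Iio a2) a3 hz.le
    have i₂ := integrable_exp_mul measurable_id (ae_nonneg_of_Iio b2) b3 hz.le
    have := integral_add_rnDeriv_smul (F := fun s : ℝ => Complex.exp (-(z * (s : ℂ))))
      (by simpa [mul_comm] using i₁) (by simpa [mul_comm] using i₂)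
    simp only [smul_eq_mul] at this
    change f z + g z = _
    rw [a4 z hz, b4 z hz]
    simp only [mul_comm (Complex.exp _)]
    exact this.symm
  · rw [add_apply, ← a5, ← b5]
    exact integral_add_rnDeriv_smul (F := fun s => T s x)
      (hT.integrable_smul (p := fun s => s) measurable_id (ae_nonneg_of_Iio a2) a3 x)
      (hT.integrable_smul (p := fun s => s) measurable_id (ae_nonneg_of_Iio b2) b3 x)

lemma isHP_sub (hT : IsBddSemigroup T c) {f g : ℂ → ℂ} {B B' : X →L[ℂ] X} (h : IsHP T f B)
    (h' : IsHP T g B') : IsHP T (fun z => f z - g z) (B - B') := by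
  have := hT.isHP_add h (isHP_smul (-1) h')
  have e : B + (-1 : ℂ) • B' = B - B' := by simp [sub_eq_add_neg]
  rw [e] at this
  exact this.congr fun z _ => by ring

/-- The representing measure of `f - g` has vanishing transform, hence vanishing density. Operator
identities below are proved by comparing functions on the half-plane. -/
lemma isHP_unique (hT : IsBddSemigroup T c) {f g : ℂ → ℂ} {B B' : X →L[ℂ] X} (h : IsHP T f B)
    (h' : IsHP T g B') (hfg : ∀ z : ℂ, 0 < z.re → f z = g z) : B = B' := by
  obtain ⟨ν, k, ⟨h1, h2, h3, h4⟩, h5⟩ := hT.isHP_sub h h'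
  have := ae_eq_zero_of_laplace h2 h3 fun z hz => by
    rw [← h4 z hz]; exact sub_eq_zero.2 (hfg z hz)
  rw [← sub_eq_zero]
  ext x
  rw [← h5, hpComplex, zero_apply]
  refine integral_eq_zero_of_ae ?_
  filter_upwards [this] with s hs
  rw [hs]; simp

lemma isHP_of_real (hT : IsBddSemigroup T c) {Ω : Type*} [MeasurableSpace Ω]
    {σ : Measure Ω} {p : Ω → ℝ} (hp : Measurable p) (hp0 : ∀ᵐ η ∂σ, 0 ≤ p η) {w : Ω → ℝ}
    (hw : Integrable w σ) (hw0 : ∀ η, 0 ≤ w η) :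
    IsHP T (fun z => ∫ η, Complex.exp (-(z * (p η : ℂ))) * (w η : ℂ) ∂σ)
      (hT.avg hp hp0 (h := fun η => (w η : ℂ)) hw.ofReal) := by
  have hm : AEMeasurable (fun η => ENNReal.ofReal (w η)) σ := hw.1.aemeasurable.ennreal_ofReal
  have hfin := isFiniteMeasure_withDensity_ofReal hw.2
  set ρ := σ.withDensity fun η => ENNReal.ofReal (w η) with hρ
  have hρ0 : ∀ᵐ η ∂ρ, 0 ≤ p η := (withDensity_absolutelyContinuous _ _).ae_le hp0
  have hν0 : (ρ.map p) (Iio 0) = 0 := by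
    rw [Measure.map_apply hp measurableSet_Iio]
    have := hρ0
    rw [ae_iff] at this
    simpa [preimage, Iio] using this
  refine ⟨ρ.map p, fun _ => 1, ⟨inferInstance, hν0, integrable_const _, fun z hz => ?_⟩,
    fun x => ?_⟩
  · rw [integral_map hp.aemeasurable (Measurable.aestronglyMeasurable (by fun_prop)), hρ,
      integral_withDensity_eq_integral_toReal_smul₀ hm (by simp)]
    refine integral_congr_ae (Eventually.of_forall fun η => ?_)
    simp only [ENNReal.toReal_ofReal (hw0 η), mul_one, Complex.real_smul]
    ring
  · rw [avg_apply, hpComplex]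
    simp only [one_smul]
    rw [integral_map hp.aemeasurable
      (hT.aestronglyMeasurable (p := fun s => s) measurable_id (ae_nonneg_of_Iio hν0) x), hρ,
      integral_withDensity_eq_integral_toReal_smul₀ hm (by simp)]
    refine integral_congr_ae (Eventually.of_forall fun η => ?_)
    simp only [ENNReal.toReal_ofReal (hw0 η)]
    exact (Complex.coe_smul _ _).symm

/-- A complex density on `Ω` need not be a function of `p`, so it cannot simply be carried along by
`p`. A nonnegative one can be absorbed into the measure before pushing forward, whence the splitting
into four parts. -/
lemma isHP_avg (hT : IsBddSemigroup T c) {Ω : Type*} [MeasurableSpace Ω]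
    {σ : Measure Ω} {p : Ω → ℝ} (hp : Measurable p) (hp0 : ∀ᵐ η ∂σ, 0 ≤ p η) {h : Ω → ℂ}
    (hh : Integrable h σ) :
    IsHP T (fun z => ∫ η, Complex.exp (-(z * (p η : ℂ))) * h η ∂σ) (hT.avg hp hp0 hh) := by
  have i1 : Integrable (fun η => max (h η).re 0) σ := hh.re.pos_part
  have i2 : Integrable (fun η => max (-(h η).re) 0) σ := hh.re.neg_part
  have i3 : Integrable (fun η => max (h η).im 0) σ := hh.im.pos_part
  have i4 : Integrable (fun η => max (-(h η).im) 0) σ := hh.im.neg_part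
  have h1 := hT.isHP_of_real hp hp0 i1 fun η => le_max_right _ _
  have h2 := hT.isHP_of_real hp hp0 i2 fun η => le_max_right _ _
  have h3 := hT.isHP_of_real hp hp0 i3 fun η => le_max_right _ _
  have h4 := hT.isHP_of_real hp hp0 i4 fun η => le_max_right _ _
  have c1 : Integrable (fun η => ((max (h η).re 0 : ℝ) : ℂ)) σ := i1.ofReal
  have c2 : Integrable (fun η => ((max (-(h η).re) 0 : ℝ) : ℂ)) σ := i2.ofReal
  have c3 : Integrable (fun η => ((max (h η).im 0 : ℝ) : ℂ)) σ := i3.ofReal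
  have c4 : Integrable (fun η => ((max (-(h η).im) 0 : ℝ) : ℂ)) σ := i4.ofReal
  have hsum := hT.isHP_add (hT.isHP_sub h1 h2) (isHP_smul Complex.I (hT.isHP_sub h3 h4))
  have hB : hT.avg hp hp0 hh = hT.avg hp hp0 c1 - hT.avg hp hp0 c2 +
      Complex.I • (hT.avg hp hp0 c3 - hT.avg hp hp0 c4) := by
    ext x
    exact integral_smul_pos_sub_neg (hT.integrable_smul hp hp0 c1 x)
      (hT.integrable_smul hp hp0 c2 x) (hT.integrable_smul hp hp0 c3 x)
      (hT.integrable_smul hp hp0 c4 x)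
  rw [hB]
  refine hsum.congr fun z hz => ?_
  have hj : ∀ {k : Ω → ℂ}, Integrable k σ →
      Integrable (fun η => k η • Complex.exp (-(z * (p η : ℂ)))) σ := fun hk => by
    simpa [mul_comm] using integrable_exp_mul hp hp0 hk hz.le
  have := integral_smul_pos_sub_neg (hj c1) (hj c2) (hj c3) (hj c4)
  simp only [smul_eq_mul] at this
  simp only [mul_comm (Complex.exp _)]
  exact this.symm

variable [CompleteSpace X]

/-- Convolution, realized as an average over the product space with `p` the sum; the semigroup law
and Fubini give the composition. -/
lemma isHP_mul (hT : IsBddSemigroup T c) {f g : ℂ → ℂ} {B B' : X →L[ℂ] X} (h : IsHP T f B)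
    (h' : IsHP T g B') : IsHP T (fun z => f z * g z) (B.comp B') := by
  obtain ⟨ν₁, k₁, ⟨a1, a2, a3, a4⟩, a5⟩ := h
  obtain ⟨ν₂, k₂, ⟨b1, b2, b3, b4⟩, b5⟩ := h'
  have n1 := ae_nonneg_of_Iio a2
  have n2 := ae_nonneg_of_Iio b2
  have hp : Measurable fun q : ℝ × ℝ => q.1 + q.2 := by fun_prop
  have hp0 : ∀ᵐ q ∂(ν₁.prod ν₂), 0 ≤ q.1 + q.2 := by
    filter_upwards [Measure.quasiMeasurePreserving_fst.ae n1,
      Measure.quasiMeasurePreserving_snd.ae n2] with q h1 h2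
    exact add_nonneg h1 h2
  have hk : Integrable (fun q : ℝ × ℝ => k₁ q.1 * k₂ q.2) (ν₁.prod ν₂) := a3.mul_prod b3
  have hB : B.comp B' = hT.avg hp hp0 hk := by
    ext x
    rw [avg_apply, ContinuousLinearMap.comp_apply, ← a5, hpComplex,
      integral_prod _ (hT.integrable_smul hp hp0 hk x)]
    refine integral_congr_ae ?_
    filter_upwards [n1] with s hs
    rw [← b5, hpComplex, ← ContinuousLinearMap.integral_comp_comm _
      (hT.integrable_smul (p := fun s => s) measurable_id n2 b3 x), ← integral_smul]
    refine integral_congr_ae ?_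
    filter_upwards [n2] with r hr
    rw [hT.c0.2.1 s r hs hr, map_smul, mul_smul]
    rfl
  rw [hB]
  refine (hT.isHP_avg hp hp0 hk).congr fun z hz => ?_
  rw [a4 z hz, b4 z hz, ← integral_prod_mul]
  refine integral_congr_ae (Eventually.of_forall fun q => ?_)
  simp only [Complex.ofReal_add, mul_add, neg_add, Complex.exp_add]
  ring

lemma isHP_apply (T : ℝ → X →L[ℂ] X) {r : ℝ} (hr : 0 ≤ r) :
    IsHP T (fun z => Complex.exp (-(z * (r : ℂ)))) (T r) := by
  refine ⟨Measure.dirac r, fun _ => 1, ⟨inferInstance, ?_, integrable_const _, fun z hz => ?_⟩,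
    fun x => ?_⟩
  · rw [Measure.dirac_apply' _ measurableSet_Iio]; simp [hr]
  · simp
  · simp [hpComplex]

lemma isHP_one (hT : IsBddSemigroup T c) :
    IsHP T (fun _ => 1) (ContinuousLinearMap.id ℂ X) := by
  have := isHP_apply T (le_refl (0 : ℝ))
  rw [hT.c0.1] at this
  exact this.congr fun z _ => by simp

lemma isHP_comm (hT : IsBddSemigroup T c) {f g : ℂ → ℂ} {B B' : X →L[ℂ] X}
    (h : IsHP T f B) (h' : IsHP T g B') (x : X) : B (B' x) = B' (B x) := by
  have := hT.isHP_unique (hT.isHP_mul h h') (hT.isHP_mul h' h) fun z _ => mul_comm _ _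
  exact congrArg (fun L : X →L[ℂ] X => L x) this

lemma isHP_pow (hT : IsBddSemigroup T c) {f : ℂ → ℂ} {B : X →L[ℂ] X}
    (h : IsHP T f B) (n : ℕ) : IsHP T (fun z => f z ^ n) (B ^ n) := by
  induction n with
  | zero => simpa using! hT.isHP_one
  | succ n ih =>
    rw [pow_succ B]
    exact (hT.isHP_mul ih h).congr fun z _ => (pow_succ _ _).symm

end IsBddSemigroup

end HP

/-! ### Derivatives of bounded holomorphic semigroups -/

/-- A disc around 1, rescaled. Radii proportional to `t` are what give `t^{-k}` in Cauchy's
estimates. -/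
lemma exists_ball_subset_sector {ξ : ℝ} (hξ : 0 < ξ) :
    ∃ ε : ℝ, 0 < ε ∧ ∀ t : ℝ, 0 < t → Metric.ball (t : ℂ) (ε * t) ⊆ sector ξ := by
  have h1 : ∀ᶠ z : ℂ in 𝓝 1, |z.arg| < ξ := by
    have hc : ContinuousAt (fun z : ℂ => |z.arg|) 1 :=
      (Complex.continuousAt_arg (by simp)).abs
    exact hc.eventually_lt_const (by simpa using hξ)
  have h2 : ∀ᶠ z : ℂ in 𝓝 1, z ≠ 0 := isOpen_ne.mem_nhds one_ne_zero
  obtain ⟨ε, hε, h⟩ := Metric.eventually_nhds_iff.1 (h1.and h2)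
  refine ⟨ε, hε, fun t ht z hz => ?_⟩
  have htc : (t : ℂ) ≠ 0 := by exact_mod_cast ht.ne'
  have hzt : z = (t : ℝ) * (z / t) := by field_simp
  have hd : dist (z / t) 1 < ε := by
    rw [Metric.mem_ball, dist_eq_norm] at hz
    have : z / t - 1 = (z - t) / t := by field_simp
    rw [dist_eq_norm, this, norm_div, Complex.norm_real, Real.norm_of_nonneg ht.le,
      div_lt_iff₀ ht]
    exact hz
  obtain ⟨h3, h4⟩ := h hd
  constructor
  · rw [hzt]; exact mul_ne_zero htc h4
  · rw [hzt, Complex.arg_real_mul _ ht]; exact h3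

section Smoothing

variable {X : Type*} [NormedAddCommGroup X] [NormedSpace ℂ X]

/-- A bounded semigroup with the derivatives `D k t = A ^ k e^{-tA}` and the bounds
`‖A ^ k e^{-tA}‖ ≤ K k / t ^ k`. -/
structure IsSmoothing (T : ℝ → X →L[ℂ] X) (D : ℕ → ℝ → X →L[ℂ] X) (c : ℝ) (K : ℕ → ℝ) :
    Prop where
  bdd : IsBddSemigroup T c
  zero : ∀ t : ℝ, 0 < t → D 0 t = T t
  hasDerivAt : ∀ (k : ℕ) (t : ℝ), 0 < t → HasDerivAt (D k) (-D (k + 1) t) t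
  bound : ∀ (k : ℕ) (t : ℝ), 0 < t → ‖D k t‖ ≤ K k * (t ^ k)⁻¹

/-- Take `(-1)^k` times the complex derivatives of the extension, with Cauchy's estimates on the
circle of radius `εt/2` around `t`. -/
lemma IsSectBddHolomorphic.exists_isSmoothing [CompleteSpace X] {T : ℝ → X →L[ℂ] X}
    (hT : IsSectBddHolomorphic T) : ∃ D c K, IsSmoothing T D c K := by
  obtain ⟨h0, θ, hθ, -, S, hST, hS, hb⟩ := hT
  obtain ⟨⟨c, hc⟩, -⟩ := hb (θ / 2) (by positivity) (by linarith)
  obtain ⟨ε, hε, hball⟩ := exists_ball_subset_sector (ξ := θ / 2) (by positivity)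
  have hsub : sector (θ / 2) ⊆ sector θ := fun z hz => ⟨hz.1, hz.2.trans (by linarith)⟩
  have hTc : ∀ t : ℝ, 0 < t → ‖T t‖ ≤ c := fun t ht => by
    rw [← hST t ht.le]
    exact hc _ (subset_closure (hball t ht (Metric.mem_ball_self (by positivity))))
  have hd : ∀ t : ℝ, 0 < t → DifferentiableOn ℂ S (Metric.ball (t : ℂ) (ε * t)) := fun t ht =>
    hS.mono ((hball t ht).trans hsub)
  have han : ∀ t : ℝ, 0 < t → AnalyticAt ℂ S t := fun t ht =>
    (hd t ht).analyticAt (Metric.ball_mem_nhds _ (by positivity))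
  have hc0 : 0 ≤ c := (norm_nonneg _).trans (hTc 1 one_pos)
  refine ⟨fun k t => (-1 : ℂ) ^ k • iteratedDeriv k S t, max c ‖T 0‖,
    fun k => k.factorial * c / (ε / 2) ^ k, ⟨h0, fun t ht => ?_⟩, fun t ht => ?_, fun k t ht => ?_,
    fun k t ht => ?_⟩
  · rcases ht.eq_or_lt with rfl | ht
    · exact le_max_right _ _
    · exact (hTc t ht).trans (le_max_left _ _)
  · simp [hST t ht.le]
  · have h1 : HasDerivAt (iteratedDeriv k S) (iteratedDeriv (k + 1) S t) (t : ℂ) := by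
      rw [iteratedDeriv_succ]
      have : AnalyticAt ℂ (iteratedDeriv k S) t := by
        rw [iteratedDeriv_eq_iterate]; exact (han t ht).iterated_deriv k
      exact this.differentiableAt.hasDerivAt
    have h2 := (h1.scomp t Complex.ofRealCLM.hasDerivAt).const_smul ((-1 : ℂ) ^ k)
    convert! h2 using 1
    rw [pow_succ]; simp
  · rw [norm_smul, norm_pow, norm_neg, norm_one, one_pow, one_mul]
    have hR : 0 < ε / 2 * t := by positivity
    have hcl : Metric.closedBall (t : ℂ) (ε / 2 * t) ⊆ Metric.ball (t : ℂ) (ε * t) :=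
      Metric.closedBall_subset_ball (by nlinarith [mul_pos hε ht])
    have := Complex.norm_iteratedDeriv_le_of_forall_mem_sphere_norm_le (n := k) (f := S)
      (c := (t : ℂ)) (C := c) hR (((hd t ht).mono hcl).diffContOnCl_ball subset_rfl) fun z hz =>
        hc z (subset_closure (hball t ht (hcl (Metric.sphere_subset_closedBall hz))))
    refine this.trans (le_of_eq ?_)
    rw [mul_pow]
    field_simp

namespace IsSmoothing

variable {T : ℝ → X →L[ℂ] X} {D : ℕ → ℝ → X →L[ℂ] X} {c : ℝ} {K : ℕ → ℝ}

lemma comp_deriv (h : IsSmoothing T D c K) {s : ℝ} (hs : 0 ≤ s) (k : ℕ) :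
    ∀ t : ℝ, 0 < t → (T s).comp (D k t) = D k (s + t) := by
  induction k with
  | zero =>
    intro t ht
    rw [h.zero t ht, h.zero _ (by positivity), h.bdd.c0.2.1 s t hs ht.le]
  | succ k ih =>
    intro t ht
    have h1 : HasDerivAt (fun t => (T s).comp (D k t)) ((T s).comp (-D (k + 1) t)) t :=
      ((ContinuousLinearMap.compL ℂ X X X (T s)).restrictScalars ℝ).hasFDerivAt.comp_hasDerivAt t
        (h.hasDerivAt k t ht)
    have h2 : HasDerivAt (fun t => D k (s + t)) (-D (k + 1) (s + t)) t :=
      (h.hasDerivAt k (s + t) (by positivity)).comp_const_add s t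
    have h3 := h1.unique (h2.congr_of_eventuallyEq
      (Filter.eventually_of_mem (Ioi_mem_nhds ht) ih))
    simpa using h3

lemma comm_deriv (h : IsSmoothing T D c K) {B : X →L[ℂ] X}
    (hB : ∀ t : ℝ, 0 < t → B.comp (T t) = (T t).comp B) (k : ℕ) :
    ∀ t : ℝ, 0 < t → B.comp (D k t) = (D k t).comp B := by
  induction k with
  | zero =>
    intro t ht
    rw [h.zero t ht, hB t ht]
  | succ k ih =>
    intro t ht
    have h1 : HasDerivAt (fun t => B.comp (D k t)) (B.comp (-D (k + 1) t)) t :=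
      ((ContinuousLinearMap.compL ℂ X X X B).restrictScalars ℝ).hasFDerivAt.comp_hasDerivAt t
        (h.hasDerivAt k t ht)
    have h2 : HasDerivAt (fun t => (D k t).comp B) ((-D (k + 1) t).comp B) t :=
      (((ContinuousLinearMap.compL ℂ X X X).flip B).restrictScalars ℝ).hasFDerivAt.comp_hasDerivAt t
        (h.hasDerivAt k t ht)
    have h3 := h1.unique (h2.congr_of_eventuallyEq
      (Filter.eventually_of_mem (Ioi_mem_nhds ht) ih))
    simpa using h3

lemma hasDerivAt_apply (h : IsSmoothing T D c K) (k : ℕ) {t : ℝ} (ht : 0 < t) (x : X) :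
    HasDerivAt (fun t => D k t x) (-D (k + 1) t x) t := by
  have := ((ContinuousLinearMap.apply ℂ X x).restrictScalars ℝ).hasFDerivAt.comp_hasDerivAt t
    (h.hasDerivAt k t ht)
  simpa using! this

lemma norm_apply_le (h : IsSmoothing T D c K) (k : ℕ) {t : ℝ} (ht : 0 < t) (x : X) :
    ‖D k t x‖ ≤ K k * (t ^ k)⁻¹ * ‖x‖ := (D k t).le_of_opNorm_le (h.bound k t ht) x

lemma apply_apply (h : IsSmoothing T D c K) {s t : ℝ} (hs : 0 ≤ s) (ht : 0 < t) (k : ℕ) (x : X) :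
    T s (D k t x) = D k (s + t) x :=
  congrArg (fun L : X →L[ℂ] X => L x) (h.comp_deriv hs k t ht)

lemma nonneg (h : IsSmoothing T D c K) (k : ℕ) : 0 ≤ K k := by
  simpa using (norm_nonneg _).trans (h.bound k 1 one_pos)

/-- Since `T s` shifts `D k` by `s`, the quotient defining the generator is a difference quotient of
`D k`. -/
lemma mem_graph (h : IsSmoothing T D c K) {A : X →ₗ.[ℂ] X} (hA : IsNegGenerator T A) (k : ℕ)
    {t : ℝ} (ht : 0 < t) (x : X) : (D k t x, D (k + 1) t x) ∈ A.graph := by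
  rw [hA]
  have h1 := ((h.hasDerivAt_apply k ht x).neg).tendsto_slope_zero_right
  rw [neg_neg] at h1
  refine h1.congr' (Filter.eventually_of_mem self_mem_nhdsWithin fun s hs => ?_)
  simp only [Pi.neg_apply]
  rw [h.apply_apply (le_of_lt hs) ht, add_comm s t]
  congr 1
  abel

end IsSmoothing

end Smoothing

/-! ### Analytic continuation of Laplace transforms -/

lemma isOpen_rightHalfPlane : IsOpen {z : ℂ | 0 < z.re} :=
  isOpen_lt continuous_const Complex.continuous_re

lemma mul_exp_neg_mul_le {δ : ℝ} (hδ : 0 < δ) (s : ℝ) : s * Real.exp (-(δ * s)) ≤ δ⁻¹ := by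
  have h1 : δ * s ≤ Real.exp (δ * s) := by linarith [Real.add_one_le_exp (δ * s)]
  rw [Real.exp_neg, ← div_eq_mul_inv, div_le_iff₀ (Real.exp_pos _), inv_mul_eq_div, le_div_iff₀ hδ,
    mul_comm]
  exact h1

lemma differentiableOn_laplace {ν : Measure ℝ} (hν : ν (Iio 0) = 0) {h : ℝ → ℂ}
    (hh : Integrable h ν) :
    DifferentiableOn ℂ (fun z => ∫ s, Complex.exp (-(z * (s : ℂ))) * h s ∂ν) {z | 0 < z.re} := by
  intro z hz
  have hz : 0 < z.re := hz
  have h0 := ae_nonneg_of_Iio hν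
  have hlow : ∀ w ∈ Metric.ball z (z.re / 2), z.re / 2 < w.re := fun w hw => by
    have h1 : |(w - z).re| ≤ ‖w - z‖ := Complex.abs_re_le_norm _
    rw [Metric.mem_ball, dist_eq_norm] at hw
    rw [Complex.sub_re] at h1
    linarith [(abs_le.1 h1).1]
  refine (hasDerivAt_integral_of_dominated_loc_of_deriv_le (μ := ν)
    (F := fun z s => Complex.exp (-(z * (s : ℂ))) * h s)
    (F' := fun z s => Complex.exp (-(z * (s : ℂ))) * (-(s : ℂ)) * h s)
    (bound := fun s => (z.re / 2)⁻¹ * ‖h s‖)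
    (Metric.ball_mem_nhds z (half_pos hz)) ?_ ?_ ?_ ?_ ?_ ?_).2.differentiableAt.differentiableWithinAt
  · exact Eventually.of_forall fun w =>
      (Measurable.aestronglyMeasurable (by fun_prop)).mul hh.1
  · exact integrable_exp_mul measurable_id h0 hh hz.le
  · exact (Measurable.aestronglyMeasurable (by fun_prop)).mul hh.1
  · filter_upwards [h0] with s hs w hw
    rw [norm_mul, norm_mul, norm_neg, Complex.norm_real, Real.norm_of_nonneg hs, Complex.norm_exp]
    gcongr
    rw [mul_comm]
    refine le_trans ?_ (mul_exp_neg_mul_le (half_pos hz) s)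
    gcongr
    simp only [Complex.neg_re, Complex.re_mul_ofReal, neg_le_neg_iff]
    exact mul_le_mul_of_nonneg_right (hlow w hw).le hs
  · exact hh.norm.const_mul _
  · refine Eventually.of_forall fun s w _ => ?_
    have h1 : HasDerivAt (fun w : ℂ => -(w * (s : ℂ))) (-(1 * (s : ℂ))) w :=
      ((hasDerivAt_id w).mul_const _).neg
    rw [one_mul] at h1
    exact h1.cexp.mul_const _

lemma eqOn_rightHalfPlane_of_real {f g : ℂ → ℂ} (hf : DifferentiableOn ℂ f {z | 0 < z.re})
    (hg : DifferentiableOn ℂ g {z | 0 < z.re}) (h : ∀ r : ℝ, 0 < r → f r = g r) :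
    EqOn f g {z | 0 < z.re} := by
  refine (hf.analyticOnNhd isOpen_rightHalfPlane).eqOn_of_preconnected_of_frequently_eq
    (hg.analyticOnNhd isOpen_rightHalfPlane) (convex_halfSpace_re_gt 0).isPreconnected
    (z₀ := 1) (by simp) ?_
  have h1 : Tendsto (fun n : ℕ => ((1 + 1 / ((n : ℝ) + 1) : ℝ) : ℂ)) atTop (𝓝[≠] 1) := by
    refine tendsto_nhdsWithin_iff.2 ⟨?_, Eventually.of_forall fun n => ?_⟩
    · have := (tendsto_one_div_add_atTop_nhds_zero_nat (𝕜 := ℝ)).const_add 1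
      rw [add_zero] at this
      exact (Complex.continuous_ofReal.tendsto 1).comp this
    · have : (0 : ℝ) < 1 / ((n : ℝ) + 1) := by positivity
      have h2 : (1 + 1 / ((n : ℝ) + 1) : ℝ) ≠ 1 := by linarith
      simpa only [mem_compl_iff, mem_singleton_iff, Complex.ofReal_eq_one] using h2
  exact h1.frequently (Frequently.of_forall fun n => h _ (by positivity))

lemma differentiableOn_cpow_rightHalfPlane (β : ℂ) :
    DifferentiableOn ℂ (fun z : ℂ => z ^ β) {z | 0 < z.re} := fun _ hz =>
  (differentiableAt_id.cpow_const (Or.inl hz)).differentiableWithinAt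

/-! ### Fractional power graphs and the resolvent as regularizer -/

section Resolvent

variable {X : Type*} [NormedAddCommGroup X] [NormedSpace ℂ X] {T : ℝ → X →L[ℂ] X} {c : ℝ}

lemma IsHP.congr_real {f f' : ℂ → ℂ} {B : X →L[ℂ] X} (h : IsHP T f B)
    (hf' : DifferentiableOn ℂ f' {z | 0 < z.re}) (heq : ∀ r : ℝ, 0 < r → f r = f' r) :
    IsHP T f' B := by
  refine h.congr (eqOn_rightHalfPlane_of_real ?_ hf' heq)
  obtain ⟨ν, k, ⟨h1, h2, h3, h4⟩, -⟩ := h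
  exact (differentiableOn_laplace h2 h3).congr h4

lemma mem_fracPowGraph_iff (hT : IsBddSemigroup T c) {β : ℝ} {x y : X} :
    (x, y) ∈ fracPowGraph T β ↔ ∃ (e : ℂ → ℂ) (E F : X →L[ℂ] X), IsHP T e E ∧
      IsHP T (fun z => e z * z ^ (β : ℂ)) F ∧ Function.Injective E ∧ E y = F x := by
  constructor
  · rintro ⟨-, e, ν, h, μ, k, he, hf, hi, hxy⟩
    obtain ⟨E, hE, hE'⟩ := hT.exists_isHP he
    obtain ⟨F, hF, hF'⟩ := hT.exists_isHP hf
    refine ⟨e, E, F, hE, hF, ?_, ?_⟩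
    · rwa [show ⇑E = hpComplex T ν h from funext fun x => (hE' x).symm]
    · rw [← hE', ← hF']; exact hxy
  · rintro ⟨e, E, F, ⟨ν, h, he, hE⟩, ⟨μ, k, hf, hF⟩, hi, hxy⟩
    refine ⟨differentiableOn_cpow_rightHalfPlane _, e, ν, h, μ, k, he, hf, ?_, ?_⟩
    · rwa [show hpComplex T ν h = ⇑E from funext hE]
    · change hpComplex T ν h y = hpComplex T μ k x
      rw [hE, hF, hxy]

lemma smul_mem_fracPowGraph (hT : IsBddSemigroup T c) {β : ℝ} {x y : X}
    (h : (x, y) ∈ fracPowGraph T β) (a : ℂ) : (a • x, a • y) ∈ fracPowGraph T β := by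
  rw [mem_fracPowGraph_iff hT] at h ⊢
  obtain ⟨e, E, F, hE, hF, hi, hxy⟩ := h
  exact ⟨e, E, F, hE, hF, hi, by rw [map_smul, map_smul, hxy]⟩

/-- Two regularizers are compared by commutativity: `e'(ef) = e(e'f)` gives `E'F = EF'`, so the
injective operator `EE'` identifies the two values. -/
lemma fracPowGraph_unique [CompleteSpace X] (hT : IsBddSemigroup T c) {β : ℝ} {x y y' : X}
    (h : (x, y) ∈ fracPowGraph T β) (h' : (x, y') ∈ fracPowGraph T β) : y = y' := by
  rw [mem_fracPowGraph_iff hT] at h h'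
  obtain ⟨e, E, F, hE, hF, hi, hxy⟩ := h
  obtain ⟨e', E', F', hE', hF', hi', hxy'⟩ := h'
  have h1 : E'.comp F = E.comp F' :=
    hT.isHP_unique (hT.isHP_mul hE' hF) (hT.isHP_mul hE hF') fun z _ => by ring
  have h2 : E' (F x) = E (F' x) := congrArg (fun L : X →L[ℂ] X => L x) h1
  rw [← hxy, ← hxy', hT.isHP_comm hE hE'] at h2
  exact hi (hi' h2)

namespace IsBddSemigroup

lemma ae_nonneg_volume_Ioi : ∀ᵐ s : ℝ ∂(volume.restrict (Ioi 0)), 0 ≤ s :=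
  (ae_restrict_mem measurableSet_Ioi).mono fun _ hs => le_of_lt hs

lemma integrable_exp_neg_ofReal :
    Integrable (fun s : ℝ => ((Real.exp (-s) : ℝ) : ℂ)) (volume.restrict (Ioi 0)) :=
  (integrableOn_exp_neg_Ioi 0).ofReal

/-- The resolvent `(1 + A)⁻¹`. -/
def resolvent (hT : IsBddSemigroup T c) : X →L[ℂ] X :=
  hT.avg (p := fun s => s) measurable_id ae_nonneg_volume_Ioi integrable_exp_neg_ofReal

lemma one_add_ne_zero {z : ℂ} (hz : 0 < z.re) : 1 + z ≠ 0 := fun h => by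
  have := congrArg Complex.re h
  simp at this
  linarith

lemma isHP_resolvent (hT : IsBddSemigroup T c) : IsHP T (fun z => (1 + z)⁻¹) hT.resolvent := by
  refine (hT.isHP_avg (p := fun s => s) measurable_id ae_nonneg_volume_Ioi
    integrable_exp_neg_ofReal).congr fun z hz => ?_
  have h1 : ∀ s : ℝ, Complex.exp (-(z * (s : ℂ))) * ((Real.exp (-s) : ℝ) : ℂ) =
      Complex.exp (-(1 + z) * s) := fun s => by
    rw [Complex.ofReal_exp, ← Complex.exp_add]
    congr 1
    push_cast
    ring
  simp only [h1]
  rw [integral_exp_mul_complex_Ioi (by simp; linarith), neg_div_neg_eq]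
  simp

variable [CompleteSpace X]

/-- The operator `A (1 + A)⁻¹`. -/
def coresolvent (hT : IsBddSemigroup T c) : X →L[ℂ] X :=
  ContinuousLinearMap.id ℂ X - hT.resolvent

lemma isHP_coresolvent (hT : IsBddSemigroup T c) :
    IsHP T (fun z => z * (1 + z)⁻¹) hT.coresolvent := by
  refine (hT.isHP_sub hT.isHP_one hT.isHP_resolvent).congr fun z hz => ?_
  have := one_add_ne_zero hz
  field_simp
  ring

end IsBddSemigroup

namespace IsSmoothing

variable {D : ℕ → ℝ → X →L[ℂ] X} {K : ℕ → ℝ} [CompleteSpace X]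

lemma isHP_comm_deriv (h : IsSmoothing T D c K) {f : ℂ → ℂ} {B : X →L[ℂ] X} (hB : IsHP T f B)
    (k : ℕ) {t : ℝ} (ht : 0 < t) (x : X) : B (D k t x) = D k t (B x) := by
  refine congrArg (fun L : X →L[ℂ] X => L x) (h.comm_deriv (fun s hs => ?_) k t ht)
  ext x
  exact h.bdd.isHP_comm hB (IsBddSemigroup.isHP_apply T hs.le) x

/-- Integrate the derivative of `e^{-s} A^k e^{-(s+t)A} x` over `s > 0`: the boundary value shows
that the resolvent sends the sum of the two derivatives to `D k t x`. -/
lemma resolvent_deriv_succ (h : IsSmoothing T D c K) (k : ℕ) {t : ℝ} (ht : 0 < t) (x : X) :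
    h.bdd.resolvent (D (k + 1) t x) = h.bdd.coresolvent (D k t x) := by
  have i : ∀ j, IntegrableOn (fun s : ℝ => ((Real.exp (-s) : ℝ) : ℂ) • T s (D j t x)) (Ioi 0) :=
    fun j => h.bdd.integrable_smul (p := fun s => s) measurable_id
      IsBddSemigroup.ae_nonneg_volume_Ioi IsBddSemigroup.integrable_exp_neg_ofReal (D j t x)
  have hd : ∀ s ∈ Ioi (0 : ℝ), HasDerivAt (fun s : ℝ => Real.exp (-s) • D k (s + t) x)
      (-(((Real.exp (-s) : ℝ) : ℂ) • T s (D k t x)) -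
        ((Real.exp (-s) : ℝ) : ℂ) • T s (D (k + 1) t x)) s := by
    intro s hs
    have hs : 0 < s := hs
    have h1 := (h.hasDerivAt_apply k (t := s + t) (by positivity) x).comp_add_const s t
    have h2 : HasDerivAt (fun s : ℝ => Real.exp (-s)) (-Real.exp (-s)) s := by
      simpa using (hasDerivAt_neg s).exp
    convert! h2.smul h1 using 1
    rw [h.apply_apply hs.le ht, h.apply_apply hs.le ht, Complex.coe_smul, Complex.coe_smul]
    simp only [neg_smul, smul_neg]
    abel
  have hcont : ContinuousWithinAt (fun s : ℝ => Real.exp (-s) • D k (s + t) x) (Ici 0) 0 := by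
    refine ContinuousAt.continuousWithinAt (ContinuousAt.smul
      (f := fun s : ℝ => Real.exp (-s)) (by fun_prop) ?_)
    have h1 := (h.hasDerivAt_apply k (t := 0 + t) (by simpa) x).comp_add_const 0 t
    exact h1.continuousAt
  have hlim : Tendsto (fun s : ℝ => Real.exp (-s) • D k (s + t) x) atTop (𝓝 0) := by
    refine squeeze_zero_norm' (a := fun s => Real.exp (-s) * (c * ‖D k t x‖)) ?_ ?_
    · filter_upwards [eventually_ge_atTop 0] with s hs
      rw [norm_smul, Real.norm_of_nonneg (Real.exp_pos _).le, ← h.apply_apply hs ht]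
      gcongr
      exact h.bdd.norm_apply_le hs _
    · simpa using Real.tendsto_exp_neg_atTop_nhds_zero.mul_const (c * ‖D k t x‖)
  have key := integral_Ioi_of_hasDerivAt_of_tendsto hcont hd ((i k).neg.sub (i (k + 1))) hlim
  have i1 : IntegrableOn (fun s : ℝ => -(((Real.exp (-s) : ℝ) : ℂ) • T s (D k t x))) (Ioi 0) :=
    (i k).neg
  rw [integral_sub i1 (i (k + 1)), integral_neg] at key
  simp only [neg_zero, Real.exp_zero, zero_add, one_smul, zero_sub] at key
  change -h.bdd.resolvent (D k t x) - h.bdd.resolvent (D (k + 1) t x) = _ at key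
  rw [← neg_add', neg_inj] at key
  rw [IsBddSemigroup.coresolvent, sub_apply, ContinuousLinearMap.id_apply]
  exact eq_sub_of_add_eq' key

/-- If `Rx = 0`, then `R A e^{-tA} x = e^{-tA} x - R e^{-tA} x` reduces to `e^{-tA} x = 0` for `t >
0`; strong continuity at 0 gives `x = 0`. -/
lemma resolvent_injective (h : IsSmoothing T D c K) :
    Function.Injective h.bdd.resolvent := by
  rw [injective_iff_map_eq_zero]
  intro x hx
  have h0 : ∀ t : ℝ, 0 < t → T t x = 0 := fun t ht => by
    have h1 := h.resolvent_deriv_succ 0 ht x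
    rw [h.isHP_comm_deriv h.bdd.isHP_resolvent 1 ht, hx, map_zero, h.zero t ht,
      IsBddSemigroup.coresolvent, sub_apply, ContinuousLinearMap.id_apply,
      h.bdd.isHP_comm h.bdd.isHP_resolvent (IsBddSemigroup.isHP_apply T ht.le), hx, map_zero,
      sub_zero] at h1
    exact h1.symm
  have h1 : Tendsto (fun t => T t x) (𝓝[>] 0) (𝓝 (T 0 x)) :=
    ((h.bdd.c0.2.2 x) 0 self_mem_Ici).mono_left (nhdsWithin_mono _ Ioi_subset_Ici_self)
  have h2 : T 0 x = 0 := tendsto_nhds_unique h1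
    (tendsto_const_nhds.congr' (Filter.eventually_of_mem self_mem_nhdsWithin fun t ht =>
      (h0 t ht).symm))
  simpa [h.bdd.c0.1] using h2

lemma resolvent_pow_injective (h : IsSmoothing T D c K) (m : ℕ) :
    Function.Injective (h.bdd.resolvent ^ m : X →L[ℂ] X) := by
  induction m with
  | zero => exact Function.injective_id
  | succ m ih =>
    rw [pow_succ]
    exact ih.comp h.resolvent_injective

lemma resolvent_pow_deriv (h : IsSmoothing T D c K) (m k : ℕ) {t : ℝ} (ht : 0 < t) (x : X) :
    (h.bdd.resolvent ^ m : X →L[ℂ] X) (D (m + k) t x) =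
      (h.bdd.coresolvent ^ m : X →L[ℂ] X) (D k t x) := by
  induction m generalizing k with
  | zero => simp
  | succ m ih =>
    rw [pow_succ', pow_succ, add_assoc, add_comm 1 k]
    change h.bdd.resolvent ((h.bdd.resolvent ^ m : X →L[ℂ] X) (D (m + (k + 1)) t x)) =
      (h.bdd.coresolvent ^ m : X →L[ℂ] X) (h.bdd.coresolvent (D k t x))
    rw [ih, h.bdd.isHP_comm h.bdd.isHP_resolvent (h.bdd.isHP_pow h.bdd.isHP_coresolvent m),
      h.resolvent_deriv_succ k ht]

end IsSmoothing

end Resolvent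

/-! ### The integral representation of `z ^ (1 - α)` -/

lemma one_sub_exp_neg_nonneg {u : ℝ} (hu : 0 ≤ u) : 0 ≤ 1 - Real.exp (-u) :=
  sub_nonneg.2 (Real.exp_le_one_iff.2 (by linarith))

lemma one_sub_exp_neg_le (u : ℝ) : 1 - Real.exp (-u) ≤ u := by
  linarith [Real.add_one_le_exp (-u)]

lemma integrableOn_rpow_mul_one_sub_exp {α : ℝ} (h0 : 0 < α) (h1 : α < 1) {z : ℝ} (hz : 0 < z) :
    IntegrableOn (fun u : ℝ => u ^ (α - 2) * (1 - Real.exp (-(z * u)))) (Ioi 0) := by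
  have hm : Measurable fun u : ℝ => u ^ (α - 2) * (1 - Real.exp (-(z * u))) := by fun_prop
  rw [← Ioc_union_Ioi_eq_Ioi (zero_le_one' ℝ)]
  refine IntegrableOn.union ?_ ?_
  · have : IntegrableOn (fun u : ℝ => z * u ^ (α - 1)) (Ioc 0 1) := by
      rw [← intervalIntegrable_iff_integrableOn_Ioc_of_le zero_le_one]
      exact (intervalIntegral.intervalIntegrable_rpow' (by linarith)).const_mul z
    refine Integrable.mono' this hm.aestronglyMeasurable ?_
    filter_upwards [ae_restrict_mem measurableSet_Ioc] with u hu
    have hu0 : 0 < u := hu.1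
    have h2 := one_sub_exp_neg_nonneg (mul_pos hz hu0).le
    rw [Real.norm_of_nonneg (mul_nonneg (by positivity) h2)]
    calc u ^ (α - 2) * (1 - Real.exp (-(z * u))) ≤ u ^ (α - 2) * (z * u) := by
          gcongr; exact one_sub_exp_neg_le _
      _ = z * u ^ (α - 1) := by
          rw [show α - 1 = α - 2 + 1 by ring, Real.rpow_add_one hu0.ne']; ring
  · refine Integrable.mono' (integrableOn_Ioi_rpow_of_lt (a := α - 2) (by linarith) one_pos)
      hm.aestronglyMeasurable ?_
    filter_upwards [ae_restrict_mem measurableSet_Ioi] with u hu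
    have hu0 : 0 < u := one_pos.trans hu
    have h2 := one_sub_exp_neg_nonneg (mul_pos hz hu0).le
    rw [Real.norm_of_nonneg (mul_nonneg (by positivity) h2)]
    exact mul_le_of_le_one_right (by positivity) (by linarith [Real.exp_pos (-(z * u))])

/-- The constant `∫₀^∞ u ^ (α - 2) (1 - e^{-u}) du`. -/
def levyConst (α : ℝ) : ℝ := ∫ u in Ioi (0 : ℝ), u ^ (α - 2) * (1 - Real.exp (-u))

lemma levyConst_pos {α : ℝ} (h0 : 0 < α) (h1 : α < 1) : 0 < levyConst α := by
  have hi := integrableOn_rpow_mul_one_sub_exp h0 h1 one_pos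
  simp only [one_mul] at hi
  have hpos : ∀ u ∈ Ioi (0 : ℝ), 0 < u ^ (α - 2) * (1 - Real.exp (-u)) := fun u hu => by
    have hu : 0 < u := hu
    have : 0 < 1 - Real.exp (-u) := sub_pos.2 (Real.exp_lt_one_iff.2 (by linarith))
    positivity
  rw [levyConst, setIntegral_pos_iff_support_of_nonneg_ae
    ((ae_restrict_mem measurableSet_Ioi).mono fun u hu => (hpos u hu).le) hi]
  rw [inter_eq_self_of_subset_right (show Ioi (0 : ℝ) ⊆ Function.support _ from
    fun u hu => (hpos u hu).ne')]
  simp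

lemma integral_rpow_mul_one_sub_exp {α z : ℝ} (hz : 0 < z) :
    ∫ u in Ioi (0 : ℝ), u ^ (α - 2) * (1 - Real.exp (-(z * u))) =
      z ^ (1 - α) * levyConst α := by
  have h1 := integral_comp_mul_left_Ioi
    (fun u : ℝ => u ^ (α - 2) * (1 - Real.exp (-u))) 0 hz
  rw [mul_zero, smul_eq_mul] at h1
  have h2 : ∀ u ∈ Ioi (0 : ℝ), (z * u) ^ (α - 2) * (1 - Real.exp (-(z * u))) =
      z ^ (α - 2) * (u ^ (α - 2) * (1 - Real.exp (-(z * u)))) := fun u hu => by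
    rw [Real.mul_rpow hz.le (le_of_lt hu), mul_assoc]
  rw [setIntegral_congr_fun measurableSet_Ioi h2, integral_const_mul] at h1
  have h3 : z ^ (1 - α) = z⁻¹ * (z ^ (α - 2))⁻¹ := by
    rw [← Real.rpow_neg_one z, ← Real.rpow_neg hz.le, ← Real.rpow_add hz]
    congr 1; ring
  have h4 : z ^ (α - 2) ≠ 0 := by positivity
  rw [h3, levyConst, mul_right_comm, ← h1]
  field_simp

lemma integral_exp_neg_mul_unit {a : ℝ} (ha : a ≠ 0) :
    ∫ q in Ioc (0 : ℝ) 1, Real.exp (-(a * q)) = (1 - Real.exp (-a)) / a := by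
  rw [← intervalIntegral.integral_of_le zero_le_one]
  have h1 : ∀ q ∈ uIcc (0 : ℝ) 1, HasDerivAt (fun q : ℝ => -(a⁻¹ * Real.exp (-(a * q))))
      (Real.exp (-(a * q))) q := fun q _ => by
    have := ((((hasDerivAt_id q).const_mul a).neg.exp).const_mul a⁻¹).neg
    convert! this using 1
    simp only [id, mul_one, Pi.neg_apply]
    field_simp
  rw [intervalIntegral.integral_eq_sub_of_hasDerivAt h1
    (Continuous.intervalIntegrable (by fun_prop) _ _)]
  simp
  field_simp
  ring

section Levy

variable {X : Type*} [NormedAddCommGroup X] [NormedSpace ℂ X] {T : ℝ → X →L[ℂ] X} {c : ℝ}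

namespace IsBddSemigroup

/-- The identity `1 - e^{-zu} = zu ∫₀¹ e^{-zuq} dq` extracts a factor `z` and leaves an average of
exponentials with density `u^{α-1}`, integrable at 0. -/
lemma exists_isHP_near (hT : IsBddSemigroup T c) {α : ℝ} (h0 : 0 < α) {t : ℝ} (ht : 0 < t) :
    ∃ (f : ℂ → ℂ) (U : X →L[ℂ] X), IsHP T f U ∧ ‖U‖ ≤ t ^ α / α * c ∧
      ∀ z : ℝ, 0 < z → z * f z =
        ((∫ u in Ioc 0 t, u ^ (α - 2) * (1 - Real.exp (-(z * u))) : ℝ) : ℂ) := by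
  set σ := (volume.restrict (Ioc 0 t)).prod (volume.restrict (Ioc (0 : ℝ) 1)) with hσ
  have hp : Measurable fun q : ℝ × ℝ => q.1 * q.2 := by fun_prop
  have hu : ∀ᵐ u ∂(volume.restrict (Ioc 0 t)), 0 < u :=
    (ae_restrict_mem measurableSet_Ioc).mono fun _ h => h.1
  have hp0 : ∀ᵐ q ∂σ, 0 ≤ q.1 * q.2 := by
    filter_upwards [Measure.quasiMeasurePreserving_fst.ae hu,
      Measure.quasiMeasurePreserving_snd.ae (ae_restrict_mem measurableSet_Ioc)] with q h1 h2
    exact mul_nonneg h1.le h2.1.le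
  have hi : IntegrableOn (fun u : ℝ => u ^ (α - 1)) (Ioc 0 t) := by
    rw [← intervalIntegrable_iff_integrableOn_Ioc_of_le ht.le]
    exact intervalIntegral.intervalIntegrable_rpow' (by linarith)
  have hiσ : Integrable (fun q : ℝ × ℝ => ((q.1 ^ (α - 1) : ℝ) : ℂ)) σ :=
    (Integrable.comp_fst (ν := volume.restrict (Ioc (0 : ℝ) 1)) hi).ofReal
  refine ⟨_, _, hT.isHP_avg hp hp0 hiσ, (hT.norm_avg_le hp hp0 hiσ).trans (le_of_eq ?_),
    fun z hz => ?_⟩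
  · congr 1
    rw [hσ, integral_fun_fst (fun u : ℝ => ‖((u ^ (α - 1) : ℝ) : ℂ)‖)]
    simp only [Complex.norm_real]
    rw [setIntegral_congr_fun measurableSet_Ioc (g := fun u : ℝ => u ^ (α - 1)) fun u hu =>
      Real.norm_of_nonneg (Real.rpow_nonneg hu.1.le _),
      ← intervalIntegral.integral_of_le ht.le, integral_rpow (Or.inl (by linarith))]
    simp [h0.ne']
  · have hj := integrable_exp_mul hp hp0 hiσ (z := (z : ℂ)) (by simpa using hz.le)
    rw [hσ, integral_prod _ hj, ← integral_const_mul, ← integral_complex_ofReal]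
    refine setIntegral_congr_fun measurableSet_Ioc fun u hu => ?_
    have hu0 : 0 < u := hu.1
    simp only
    have e : ∀ q : ℝ, Complex.exp (-((z : ℂ) * ((u * q : ℝ) : ℂ))) * ((u ^ (α - 1) : ℝ) : ℂ) =
        ((Real.exp (-((z * u) * q)) * u ^ (α - 1) : ℝ) : ℂ) := fun q => by
      push_cast
      rw [mul_assoc (z : ℂ)]
    simp only [e]
    rw [integral_complex_ofReal, integral_mul_const, integral_exp_neg_mul_unit (by positivity),
      ← Complex.ofReal_mul]
    congr 1
    rw [show α - 1 = α - 2 + 1 by ring, Real.rpow_add_one hu0.ne']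
    field_simp

/-- Away from 0 the density `u^{α-2}` is integrable, and `1` and `e^{-zu}` are averaged separately;
hence the factor 2. The constant `1` is the exponential with `p = 0`. -/
lemma exists_isHP_far (hT : IsBddSemigroup T c) {α : ℝ} (h1 : α < 1) {t : ℝ} (ht : 0 < t) :
    ∃ (f : ℂ → ℂ) (V : X →L[ℂ] X), IsHP T f V ∧ ‖V‖ ≤ 2 * (t ^ (α - 1) / (1 - α)) * c ∧
      ∀ z : ℝ, 0 < z → f z =
        ((∫ u in Ioi t, u ^ (α - 2) * (1 - Real.exp (-(z * u))) : ℝ) : ℂ) := by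
  have hi : IntegrableOn (fun u : ℝ => u ^ (α - 2)) (Ioi t) :=
    integrableOn_Ioi_rpow_of_lt (by linarith) ht
  have hiC : Integrable (fun u : ℝ => ((u ^ (α - 2) : ℝ) : ℂ)) (volume.restrict (Ioi t)) :=
    hi.ofReal
  have hu : ∀ᵐ u ∂(volume.restrict (Ioi t)), 0 ≤ u :=
    (ae_restrict_mem measurableSet_Ioi).mono fun _ h => ht.le.trans (le_of_lt h)
  have hz0 : ∀ᵐ _ ∂(volume.restrict (Ioi t)), (0 : ℝ) ≤ 0 := Eventually.of_forall fun _ => le_rfl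
  have hn : ∫ u in Ioi t, ‖((u ^ (α - 2) : ℝ) : ℂ)‖ = t ^ (α - 1) / (1 - α) := by
    simp only [Complex.norm_real]
    rw [setIntegral_congr_fun measurableSet_Ioi (g := fun u : ℝ => u ^ (α - 2)) fun u hu =>
      Real.norm_of_nonneg (Real.rpow_nonneg (ht.le.trans (le_of_lt hu)) _),
      integral_Ioi_rpow_of_lt (by linarith) ht, show α - 2 + 1 = -(1 - α) by ring, neg_div_neg_eq,
      neg_sub]
  refine ⟨_, _, hT.isHP_sub (hT.isHP_avg measurable_const hz0 hiC)
    (hT.isHP_avg (p := fun u => u) measurable_id hu hiC), ?_, fun z hz => ?_⟩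
  · refine (norm_sub_le _ _).trans ((add_le_add (hT.norm_avg_le _ _ _)
      (hT.norm_avg_le _ _ _)).trans (le_of_eq ?_))
    rw [hn]; ring
  · have hzz : 0 ≤ (z : ℂ).re := by simpa using hz.le
    rw [← integral_sub (integrable_exp_mul measurable_const hz0 hiC hzz)
      (integrable_exp_mul (p := fun u => u) measurable_id hu hiC hzz), ← integral_complex_ofReal]
    refine integral_congr_ae (Eventually.of_forall fun u => ?_)
    simp
    ring

/-- The Lévy integral for `z^{1-α}` is cut at `u = t`. The part carrying the extra `z` is smaller by
a factor `t`, which offsets the factor `t^{-1}` that one more derivative of the semigroup costs at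
time `t`. -/
lemma exists_isHP_levy (hT : IsBddSemigroup T c) {α : ℝ} (h0 : 0 < α) (h1 : α < 1) :
    ∃ C : ℝ, 0 ≤ C ∧ ∀ t : ℝ, 0 < t → ∃ (f g : ℂ → ℂ) (U V : X →L[ℂ] X), IsHP T f U ∧
      IsHP T g V ∧ ‖U‖ ≤ C * t ^ α ∧ ‖V‖ ≤ C * t ^ (α - 1) ∧
      ∀ z : ℝ, 0 < z → z * f z + g z = (z : ℂ) ^ ((1 - α : ℝ) : ℂ) := by
  have hl := levyConst_pos h0 h1
  have hc := hT.nonneg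
  have h1' : 0 < 1 - α := by linarith
  refine ⟨(levyConst α)⁻¹ * (c / α + 2 * c / (1 - α)), by positivity, fun t ht => ?_⟩
  obtain ⟨f, U, hU, hU', hf⟩ := hT.exists_isHP_near h0 ht
  obtain ⟨g, V, hV, hV', hg⟩ := hT.exists_isHP_far h1 ht
  set l : ℂ := (((levyConst α)⁻¹ : ℝ) : ℂ) with hl'
  have hln : ‖l‖ = (levyConst α)⁻¹ := by
    rw [hl', Complex.norm_real, Real.norm_of_nonneg (by positivity)]
  have e1 : 0 ≤ c / α := by positivity
  have e2 : 0 ≤ 2 * c / (1 - α) := by positivity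
  refine ⟨_, _, _, _, isHP_smul l hU, isHP_smul l hV, ?_, ?_, fun z hz => ?_⟩
  · rw [norm_smul, hln, mul_assoc]
    gcongr
    refine hU'.trans ?_
    have : t ^ α / α * c = c / α * t ^ α := by ring
    rw [this]
    gcongr
    linarith
  · rw [norm_smul, hln, mul_assoc]
    gcongr
    refine hV'.trans ?_
    have : 2 * (t ^ (α - 1) / (1 - α)) * c = 2 * c / (1 - α) * t ^ (α - 1) := by ring
    rw [this]
    gcongr
    linarith
  · have hi := integrableOn_rpow_mul_one_sub_exp h0 h1 hz
    have h2 : (z : ℂ) * (l * f z) + l * g z = l * (z * f z + g z) := by ring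
    have hdis : Disjoint (Ioc 0 t) (Ioi t) :=
      Set.disjoint_left.2 fun u hu hu' => not_lt_of_ge hu.2 hu'
    rw [h2, hf z hz, hg z hz, ← Complex.ofReal_add, ← setIntegral_union hdis measurableSet_Ioi
      (hi.mono_set Ioc_subset_Ioi_self) (hi.mono_set (Ioi_subset_Ioi ht.le)),
      Ioc_union_Ioi_eq_Ioi ht.le, integral_rpow_mul_one_sub_exp hz, hl', ← Complex.ofReal_mul,
      ← Complex.ofReal_cpow hz.le]
    congr 1
    field_simp

end IsBddSemigroup

end Levy

/-! ### Fractional powers on the range of the semigroup -/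

lemma powBound_nonneg {X : Type*} [NormedAddCommGroup X] [NormedSpace ℂ X] (T : ℝ → X →L[ℂ] X)
    (β : ℝ) : 0 ≤ powBound T β := by
  refine Real.sSup_nonneg ?_
  rintro r ⟨t, x, y, ht, -, -, rfl⟩
  positivity

section FracPow

variable {X : Type*} [NormedAddCommGroup X] [NormedSpace ℂ X] [CompleteSpace X]
  {T : ℝ → X →L[ℂ] X} {D : ℕ → ℝ → X →L[ℂ] X} {c : ℝ} {K : ℕ → ℝ}

namespace IsSmoothing

lemma isHP_cpow_one_sub (h : IsSmoothing T D c K) {α : ℝ} {f g : ℂ → ℂ} {U V : X →L[ℂ] X}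
    (hU : IsHP T f U) (hV : IsHP T g V)
    (hfg : ∀ z : ℝ, 0 < z → z * f z + g z = (z : ℂ) ^ ((1 - α : ℝ) : ℂ)) :
    IsHP T (fun z => (1 + z)⁻¹ * z ^ ((1 - α : ℝ) : ℂ))
      (h.bdd.coresolvent.comp U + h.bdd.resolvent.comp V) := by
  refine (h.bdd.isHP_add (h.bdd.isHP_mul h.bdd.isHP_coresolvent hU)
    (h.bdd.isHP_mul h.bdd.isHP_resolvent hV)).congr_real ?_ fun r hr => ?_
  · refine DifferentiableOn.mul (DifferentiableOn.inv (by fun_prop) fun z hz =>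
      IsBddSemigroup.one_add_ne_zero hz) (differentiableOn_cpow_rightHalfPlane _)
  · rw [← hfg r hr]; ring

/-- The fractional power `A ^ (k + 1 - α)`, regularized by `(1 + A) ^ (-(k + 1))`, and the bound for
`A ^ (k + 1 - α) e^{-tA}`. -/
lemma exists_regularized (h : IsSmoothing T D c K) (k : ℕ) {α : ℝ} (h0 : 0 ≤ α) (h1 : α ≤ 1) :
    ∃ (F : X →L[ℂ] X) (C : ℝ), 0 ≤ C ∧
      IsHP T (fun z => (1 + z)⁻¹ ^ (k + 1) * z ^ ((k + 1 - α : ℝ) : ℂ)) F ∧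
      ∀ t : ℝ, 0 < t → ∀ x : X, ∃ y : X,
        (h.bdd.resolvent ^ (k + 1) : X →L[ℂ] X) y = F (T t x) ∧
        ‖y‖ ≤ C * t ^ (-(k + 1 - α)) * ‖x‖ := by
  have hR := h.bdd.isHP_resolvent
  have hQ := h.bdd.isHP_coresolvent
  -- At `α = 0` and `α = 1` the Lévy integral diverges, but the exponent is an integer and the
  -- derivatives of the semigroup serve directly.
  rcases h0.eq_or_lt with rfl | h0
  · refine ⟨_, K (k + 1), h.nonneg _, (h.bdd.isHP_pow hQ (k + 1)).congr fun z hz => ?_,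
      fun t ht x => ⟨D (k + 1) t x, ?_, ?_⟩⟩
    · have : (((k : ℝ) + 1 - 0 : ℝ) : ℂ) = ((k + 1 : ℕ) : ℂ) := by push_cast; ring
      rw [this, Complex.cpow_natCast, mul_pow, mul_comm]
    · rw [← h.zero t ht]
      exact h.resolvent_pow_deriv (k + 1) 0 ht x
    · have : t ^ (-((k : ℝ) + 1 - 0)) = (t ^ (k + 1))⁻¹ := by
        rw [sub_zero, Real.rpow_neg ht.le, ← Nat.cast_succ, Real.rpow_natCast]
      rw [this]
      exact h.norm_apply_le _ ht x
  rcases h1.eq_or_lt with rfl | h1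
  · refine ⟨_, K k, h.nonneg _, (h.bdd.isHP_mul hR (h.bdd.isHP_pow hQ k)).congr fun z hz => ?_,
      fun t ht x => ⟨D k t x, ?_, ?_⟩⟩
    · have : (((k : ℝ) + 1 - 1 : ℝ) : ℂ) = (k : ℂ) := by push_cast; ring
      rw [this, Complex.cpow_natCast, mul_pow]
      ring
    · rw [← h.zero t ht, pow_succ']
      exact congrArg h.bdd.resolvent (h.resolvent_pow_deriv k 0 ht x)
    · have : t ^ (-((k : ℝ) + 1 - 1)) = (t ^ k)⁻¹ := by
        rw [add_sub_cancel_right, Real.rpow_neg ht.le, Real.rpow_natCast]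
      rw [this]
      exact h.norm_apply_le _ ht x
  obtain ⟨C, hC, hUV⟩ := h.bdd.exists_isHP_levy h0 h1
  have hF : ∀ {f g : ℂ → ℂ} {U V : X →L[ℂ] X}, IsHP T f U → IsHP T g V →
      (∀ z : ℝ, 0 < z → z * f z + g z = (z : ℂ) ^ ((1 - α : ℝ) : ℂ)) →
      IsHP T (fun z => (1 + z)⁻¹ ^ (k + 1) * z ^ ((k + 1 - α : ℝ) : ℂ))
        ((h.bdd.coresolvent ^ k : X →L[ℂ] X).comp
          (h.bdd.coresolvent.comp U + h.bdd.resolvent.comp V)) := by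
    intro f g U V hU hV hfg
    refine (h.bdd.isHP_mul (h.bdd.isHP_pow hQ k) (h.isHP_cpow_one_sub hU hV hfg)).congr
      fun z hz => ?_
    have hz0 : z ≠ 0 := fun h => by simp [h] at hz
    have : (((k : ℝ) + 1 - α : ℝ) : ℂ) = (k : ℂ) + ((1 - α : ℝ) : ℂ) := by push_cast; ring
    rw [this, Complex.cpow_add _ _ hz0, Complex.cpow_natCast, mul_pow]
    ring
  -- The operator `F` must not depend on `t`, so it is built with the cut at 1. The estimate at time
  -- `t` uses the cut at `t`, and uniqueness of the calculus identifies the two.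
  obtain ⟨f₁, g₁, U₁, V₁, hU₁, hV₁, -, -, hfg₁⟩ := hUV 1 one_pos
  refine ⟨_, C * (K (k + 1) + K k), mul_nonneg hC (add_nonneg (h.nonneg _) (h.nonneg _)),
    hF hU₁ hV₁ hfg₁, fun t ht x => ?_⟩
  obtain ⟨f, g, U, V, hU, hV, hUn, hVn, hfg⟩ := hUV t ht
  -- Formally `A^{k+1-α} e^{-tA} = (A f(A) + g(A)) A^k e^{-tA}`.
  refine ⟨U (D (k + 1) t x) + V (D k t x), ?_, ?_⟩
  · rw [h.bdd.isHP_unique (hF hU₁ hV₁ hfg₁) (hF hU hV hfg) fun z _ => rfl]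
    have hRk := h.bdd.isHP_pow hR (k + 1)
    have e1 := h.resolvent_pow_deriv (k + 1) 0 ht x
    have e2 : (h.bdd.resolvent ^ (k + 1) : X →L[ℂ] X) (D k t x) =
        h.bdd.resolvent ((h.bdd.coresolvent ^ k : X →L[ℂ] X) (D 0 t x)) := by
      rw [pow_succ']
      exact congrArg h.bdd.resolvent (h.resolvent_pow_deriv k 0 ht x)
    rw [map_add, h.bdd.isHP_comm hRk hU, h.bdd.isHP_comm hRk hV, e2]
    rw [add_zero] at e1
    rw [e1, h.zero t ht, h.bdd.isHP_comm hR (h.bdd.isHP_pow hQ k),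
      h.bdd.isHP_comm hV (h.bdd.isHP_pow hQ k), h.bdd.isHP_comm hV hR, pow_succ]
    simp only [ContinuousLinearMap.comp_apply, add_apply, map_add]
    congr 1
    change U ((h.bdd.coresolvent ^ k : X →L[ℂ] X) (h.bdd.coresolvent (T t x))) = _
    rw [h.bdd.isHP_comm hU (h.bdd.isHP_pow hQ k), h.bdd.isHP_comm hU hQ]
  · have hk1 := h.nonneg (k + 1)
    have hk := h.nonneg k
    have r1 : t ^ α * (t ^ (k + 1))⁻¹ = t ^ (-(k + 1 - α)) := by
      rw [← Real.rpow_natCast, ← Real.rpow_neg ht.le, ← Real.rpow_add ht]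
      congr 1; push_cast; ring
    have r2 : t ^ (α - 1) * (t ^ k)⁻¹ = t ^ (-(k + 1 - α)) := by
      rw [← Real.rpow_natCast, ← Real.rpow_neg ht.le, ← Real.rpow_add ht]
      congr 1; ring
    calc ‖U (D (k + 1) t x) + V (D k t x)‖
        ≤ C * t ^ α * (K (k + 1) * (t ^ (k + 1))⁻¹ * ‖x‖) +
          C * t ^ (α - 1) * (K k * (t ^ k)⁻¹ * ‖x‖) := by
          refine (norm_add_le _ _).trans (add_le_add ?_ ?_)
          · refine (U.le_of_opNorm_le hUn _).trans ?_
            gcongr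
            exact h.norm_apply_le _ ht x
          · refine (V.le_of_opNorm_le hVn _).trans ?_
            gcongr
            exact h.norm_apply_le _ ht x
      _ = C * K (k + 1) * (t ^ α * (t ^ (k + 1))⁻¹) * ‖x‖ +
          C * K k * (t ^ (α - 1) * (t ^ k)⁻¹) * ‖x‖ := by ring
      _ = C * (K (k + 1) + K k) * t ^ (-(k + 1 - α)) * ‖x‖ := by rw [r1, r2]; ring

lemma exists_mem_fracPowGraph (h : IsSmoothing T D c K) (k : ℕ) {α : ℝ} (h0 : 0 ≤ α)
    (h1 : α ≤ 1) : ∃ C : ℝ, 0 ≤ C ∧ ∀ t : ℝ, 0 < t → ∀ x : X, ∃ y : X,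
      (T t x, y) ∈ fracPowGraph T (k + 1 - α) ∧ ‖y‖ ≤ C * t ^ (-(k + 1 - α)) * ‖x‖ := by
  obtain ⟨F, C, hC, hF, hy⟩ := h.exists_regularized k h0 h1
  refine ⟨C, hC, fun t ht x => ?_⟩
  obtain ⟨y, hy1, hy2⟩ := hy t ht x
  exact ⟨y, (mem_fracPowGraph_iff h.bdd).2 ⟨_, _, F, h.bdd.isHP_pow h.bdd.isHP_resolvent (k + 1),
    hF, h.resolvent_pow_injective _, hy1⟩, hy2⟩

/-- Uniqueness of the value turns the bound for one `y` into a bound for every pair in the graph.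
Without it the real supremum `powBound` could take its default value 0. -/
lemma bddAbove_powBoundSet (h : IsSmoothing T D c K) (k : ℕ) {α : ℝ} (h0 : 0 ≤ α)
    (h1 : α ≤ 1) : BddAbove (powBoundSet T (k + 1 - α)) := by
  obtain ⟨C, hC, hy⟩ := h.exists_mem_fracPowGraph k h0 h1
  refine ⟨C, ?_⟩
  rintro r ⟨t, x, y, ht, hx, hxy, rfl⟩
  obtain ⟨y', hy1, hy2⟩ := hy t ht x
  rw [fracPowGraph_unique h.bdd hxy hy1]
  calc t ^ (k + 1 - α) * ‖y'‖ ≤ t ^ (k + 1 - α) * (C * t ^ (-(k + 1 - α)) * 1) := by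
        gcongr
        exact hy2.trans (by gcongr)
    _ = C * (t ^ (k + 1 - α) * t ^ (-(k + 1 - α))) := by ring
    _ = C := by rw [← Real.rpow_add ht]; simp

/-- `A ^ (k + 1) e^{-tA} x = A ^ (k + 1 - α) e^{-tA} A ^ α x`. -/
lemma deriv_mem_fracPowGraph (h : IsSmoothing T D c K) (k : ℕ) {α : ℝ} (h0 : 0 ≤ α)
    (h1 : α ≤ 1) {x y : X} (hxy : (x, y) ∈ fracPowGraph T α) {t : ℝ} (ht : 0 < t) :
    (T t y, D (k + 1) t x) ∈ fracPowGraph T (k + 1 - α) := by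
  obtain ⟨F, C, -, hF, -⟩ := h.exists_regularized k h0 h1
  obtain ⟨e, E, E', hE, hE', hi, hxy⟩ := (mem_fracPowGraph_iff h.bdd).1 hxy
  refine (mem_fracPowGraph_iff h.bdd).2 ⟨_, _, F, h.bdd.isHP_pow h.bdd.isHP_resolvent (k + 1),
    hF, h.resolvent_pow_injective _, hi ?_⟩
  have hTt := IsBddSemigroup.isHP_apply T ht.le
  have hQ := h.bdd.isHP_pow h.bdd.isHP_coresolvent (k + 1)
  -- On functions: `e(z) (z/(1+z))^{k+1}` is the product of `(1+z)^{-(k+1)} z^{k+1-α}` and `e(z)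
  -- z^α`.
  have e1 : E.comp (h.bdd.coresolvent ^ (k + 1)) = F.comp E' := by
    refine h.bdd.isHP_unique (h.bdd.isHP_mul hE hQ) (h.bdd.isHP_mul hF hE') fun z hz => ?_
    have hz0 : z ≠ 0 := fun h => by simp [h] at hz
    have e2 : z ^ (((k : ℝ) + 1 - α : ℝ) : ℂ) * z ^ (α : ℂ) = z ^ (k + 1) := by
      rw [← Complex.cpow_add _ _ hz0, ← Complex.cpow_natCast]
      congr 1
      push_cast
      ring
    rw [mul_pow, ← e2]
    ring
  have e2 := h.resolvent_pow_deriv (k + 1) 0 ht x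
  rw [add_zero, h.zero t ht] at e2
  rw [e2, h.bdd.isHP_comm hE hF, h.bdd.isHP_comm hE hTt, hxy, ← h.bdd.isHP_comm hE' hTt]
  exact congrArg (fun L : X →L[ℂ] X => L (T t x)) e1

lemma norm_deriv_le_powBound (h : IsSmoothing T D c K) (k : ℕ) {α : ℝ} (h0 : 0 ≤ α)
    (h1 : α ≤ 1) {x y : X} (hxy : (x, y) ∈ fracPowGraph T α) {t : ℝ} (ht : 0 < t) :
    ‖D (k + 1) t x‖ ≤ powBound T (k + 1 - α) * t ^ (-(k + 1 - α)) * ‖y‖ := by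
  have hmem := h.deriv_mem_fracPowGraph k h0 h1 hxy ht
  -- The definition of `powBound` asks for a vector in the unit ball, so `y` is normalized. For `y =
  -- 0` the derivative vanishes by uniqueness.
  rcases eq_or_ne y 0 with rfl | hy
  · obtain ⟨C, hC, hz⟩ := h.exists_mem_fracPowGraph k h0 h1
    obtain ⟨z, hz1, hz2⟩ := hz t ht 0
    rw [fracPowGraph_unique h.bdd hmem hz1]
    simpa using hz2
  · have hy0 : 0 < ‖y‖ := norm_pos_iff.2 hy
    have h2 := smul_mem_fracPowGraph h.bdd hmem ((‖y‖⁻¹ : ℝ) : ℂ)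
    rw [← map_smul] at h2
    have h3 : t ^ (k + 1 - α) * ‖((‖y‖⁻¹ : ℝ) : ℂ) • D (k + 1) t x‖ ≤ powBound T (k + 1 - α) := by
      refine le_csSup (h.bddAbove_powBoundSet k h0 h1) ⟨t, _, _, ht, ?_, h2, rfl⟩
      rw [norm_smul, Complex.norm_real, norm_inv, norm_norm, inv_mul_cancel₀ hy0.ne']
    rw [norm_smul, Complex.norm_real, norm_inv, norm_norm] at h3
    have h4 : 0 < t ^ ((k : ℝ) + 1 - α) := by positivity
    rw [Real.rpow_neg ht.le]
    calc ‖D (k + 1) t x‖ = t ^ ((k : ℝ) + 1 - α) * (‖y‖⁻¹ * ‖D (k + 1) t x‖) *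
          (t ^ ((k : ℝ) + 1 - α))⁻¹ * ‖y‖ := by field_simp
      _ ≤ _ := by gcongr

end IsSmoothing

end FracPow

/-! ### Iterates of `g(rA)` -/

section Approximation

variable {X : Type*} [NormedAddCommGroup X] [NormedSpace ℂ X] {T : ℝ → X →L[ℂ] X} {c : ℝ}

lemma IsBddSemigroup.integrable_apply (hT : IsBddSemigroup T c) {Ω : Type*} [MeasurableSpace Ω]
    {σ : Measure Ω} [IsFiniteMeasure σ] {p : Ω → ℝ} (hp : Measurable p)
    (hp0 : ∀ᵐ η ∂σ, 0 ≤ p η) (x : X) : Integrable (fun η => T (p η) x) σ := by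
  simpa using hT.integrable_smul hp hp0 (integrable_const (1 : ℂ)) x

variable [CompleteSpace X]

lemma IsBddSemigroup.iterate_hp (hT : IsBddSemigroup T c) {ν : Measure ℝ} [IsProbabilityMeasure ν]
    (hν : ∀ᵐ s ∂ν, 0 ≤ s) {r : ℝ} (hr : 0 ≤ r) (n : ℕ) (x : X) :
    (hp T ν r)^[n] x = ∫ s, T (r * s) x ∂(convPow ν n) := by
  have hm : Measurable fun s : ℝ => r * s := by fun_prop
  induction n generalizing x with
  | zero =>
    unfold convPow
    simp [hT.c0.1]
  | succ n ih =>
    have hn := ae_convPow_nonneg hν n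
    have hn' := ae_convPow_nonneg hν (n + 1)
    rw [Function.iterate_succ_apply, ih]
    have hmeas := hT.aestronglyMeasurable hm (hn'.mono fun s hs => mul_nonneg hr hs) x
    have e : convPow ν (n + 1) = ((convPow ν n).prod ν).map fun q : ℝ × ℝ => q.1 + q.2 := rfl
    rw [e] at hmeas ⊢
    rw [integral_map (by fun_prop) hmeas]
    have hp0 : ∀ᵐ q : ℝ × ℝ ∂((convPow ν n).prod ν), 0 ≤ r * (q.1 + q.2) := by
      filter_upwards [Measure.quasiMeasurePreserving_fst.ae hn,
        Measure.quasiMeasurePreserving_snd.ae hν] with q h1 h2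
      exact mul_nonneg hr (add_nonneg h1 h2)
    rw [integral_prod _ (hT.integrable_apply (by fun_prop) hp0 x)]
    refine integral_congr_ae (hn.mono fun a ha => ?_)
    simp only
    rw [hp, ← ContinuousLinearMap.integral_comp_comm (T (r * a))
      (hT.integrable_apply hm (hν.mono fun s hs => mul_nonneg hr hs) x)]
    refine integral_congr_ae ?_
    filter_upwards [hν] with b hb
    rw [mul_add, hT.c0.2.1 _ _ (mul_nonneg hr ha) (mul_nonneg hr hb)]
    rfl

/-- Composition of averages is convolution, and `(t/n) s = t (s/n)`. The power thus becomes a single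
average at time scale `t`, to which the estimate for one measure applies. -/
lemma IsBddSemigroup.iterate_hp_div (hT : IsBddSemigroup T c) {ν : Measure ℝ}
    (h : IsNormalized ν) {t : ℝ} (ht : 0 ≤ t) {n : ℕ} (hn : 1 ≤ n) (x : X) :
    (hp T ν (t / n))^[n] x = ∫ s, T (t * s) x ∂(meanLaw ν n) := by
  have := h.prob
  have hm : Measurable fun s : ℝ => t * s := by fun_prop
  rw [hT.iterate_hp (h.pos.mono fun s hs => le_of_lt hs) (by positivity)]
  have hmeas := hT.aestronglyMeasurable hm
    ((h.meanLaw hn).pos.mono fun s hs => mul_nonneg ht (le_of_lt hs)) x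
  unfold meanLaw at hmeas ⊢
  rw [integral_map (by fun_prop) hmeas]
  refine integral_congr_ae (Eventually.of_forall fun s => ?_)
  simp only
  rw [div_mul_eq_mul_div, mul_div_assoc]

/-! ### The main estimate -/

variable {D : ℕ → ℝ → X →L[ℂ] X} {K : ℕ → ℝ}

namespace IsSmoothing

lemma norm_pow_mul_deriv_le (h : IsSmoothing T D c K) (k : ℕ) {α : ℝ} (h0 : 0 ≤ α)
    (h1 : α ≤ 1) {x y : X} (hxy : (x, y) ∈ fracPowGraph T α) {t s : ℝ} (ht : 0 < t) (hs : 0 < s) :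
    ‖(-t) ^ (k + 1) • D (k + 1) (t * s) x‖ ≤
      powBound T (k + 1 - α) * (t ^ α * ‖y‖) * s ^ (α - (k + 1)) := by
  have hP := powBound_nonneg T (k + 1 - α)
  rw [norm_smul, norm_pow, norm_neg, Real.norm_of_nonneg ht.le]
  calc t ^ (k + 1) * ‖D (k + 1) (t * s) x‖
      ≤ t ^ (k + 1) * (powBound T (k + 1 - α) * (t * s) ^ (-(k + 1 - α)) * ‖y‖) := by
        gcongr
        exact h.norm_deriv_le_powBound k h0 h1 hxy (mul_pos ht hs)
    _ = powBound T (k + 1 - α) * ((t ^ (k + 1) * t ^ (α - (k + 1))) * ‖y‖) *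
          s ^ (α - (k + 1)) := by
        rw [neg_sub, Real.mul_rpow ht.le hs.le]; ring
    _ = _ := by
        rw [← Real.rpow_natCast, ← Real.rpow_add ht]
        congr 4
        push_cast
        ring

/-- The abstract estimate for `s ↦ T(ts)x`, whose `k`-th derivative is `F k`. The third and fourth
derivatives are controlled by `A^α x` through `powBound`. -/
theorem norm_integral_sub_le (h : IsSmoothing T D c K) {μ : Measure ℝ} (hμ : IsNormalized μ)
    (hd : IntegrableOn (dIntegrand μ) (Ioi 0)) {α : ℝ} (h0 : 0 ≤ α) (h1 : α ≤ 1) {x y : X}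
    (hxy : (x, y) ∈ fracPowGraph T α) {t : ℝ} (ht : 0 < t) :
    ‖(∫ s, T (t * s) x ∂μ) - T t x - ((∫ s, (s - 1) ^ 2 ∂μ) / 2 * t ^ 2) • D 2 t x‖ ≤
      (|bCoeff μ| * powBound T (3 - α) + dCoeff μ / 2 * powBound T (4 - α)) *
        (t ^ α * ‖y‖) := by
  set F : ℕ → ℝ → X := fun k s => (-t) ^ k • D k (t * s) x with hF
  have e3 : (((2 : ℕ) : ℝ) + 1 - α) = 3 - α := by norm_num
  have e4 : (((3 : ℕ) : ℝ) + 1 - α) = 4 - α := by norm_num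
  have hM : 0 ≤ powBound T (4 - α) * (t ^ α * ‖y‖) :=
    mul_nonneg (powBound_nonneg _ _) (by positivity)
  have hK0 := h.nonneg 0
  have hK2 := h.nonneg 2
  have hFd : ∀ k s, 0 < s → HasDerivAt (F k) (F (k + 1) s) s := fun k s hs => by
    have h2 := (h.hasDerivAt_apply k (mul_pos ht hs) x).scomp s ((hasDerivAt_id s).const_mul t)
    convert! h2.const_smul ((-t) ^ k) using 1
    simp only [hF, mul_one]
    rw [smul_smul, smul_neg, ← neg_smul, pow_succ]
    congr 1
    ring
  have hb0 : ∀ s, 0 < s → ‖F 0 s‖ ≤ (K 0 + K 2) * ‖x‖ := fun s hs => by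
    have := h.norm_apply_le 0 (mul_pos ht hs) x
    simp only [hF, pow_zero, one_smul, inv_one, mul_one] at this ⊢
    refine this.trans ?_
    gcongr
    linarith
  have hb2 : ∀ s, 0 < s → ‖F 2 s‖ ≤ (K 0 + K 2) * ‖x‖ * (s ^ 2)⁻¹ := fun s hs => by
    have h2 := h.norm_apply_le 2 (mul_pos ht hs) x
    simp only [hF, norm_smul, norm_pow, norm_neg, Real.norm_of_nonneg ht.le]
    calc t ^ 2 * ‖D 2 (t * s) x‖ ≤ t ^ 2 * (K 2 * ((t * s) ^ 2)⁻¹ * ‖x‖) := by gcongr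
      _ = K 2 * ‖x‖ * (s ^ 2)⁻¹ := by field_simp
      _ ≤ _ := by gcongr; linarith
  have hb4 : ∀ r, 0 < r → ‖F 4 r‖ ≤ powBound T (4 - α) * (t ^ α * ‖y‖) * r ^ (α - 4) :=
    fun r hr => by
    have := h.norm_pow_mul_deriv_le 3 h0 h1 hxy ht hr
    rw [e4] at this
    convert this using 3
    norm_num
  -- For `0 ≤ α ≤ 1` the power `r^{α-4}` is at most `r^{-4}` when `r ≤ 1` and at most `r^{-3}` when
  -- `r ≥ 1`.
  have key := hμ.norm_integral_sub_le hd hFd hM hb0 hb2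
    (fun r hr hr1 => (hb4 r hr).trans (by
      gcongr
      rw [← Real.rpow_intCast]
      refine Real.rpow_le_rpow_of_exponent_ge hr hr1 ?_
      push_cast
      linarith))
    (fun r hr => (hb4 r (one_pos.trans_le hr)).trans (by
      gcongr
      rw [← Real.rpow_intCast]
      refine Real.rpow_le_rpow_of_exponent_le hr ?_
      push_cast
      linarith))
  have f0 : ∫ s, F 0 s ∂μ = ∫ s, T (t * s) x ∂μ := by
    refine integral_congr_ae ?_
    filter_upwards [hμ.pos] with s hs
    simp only [hF, pow_zero, one_smul]
    rw [h.zero _ (mul_pos ht hs)]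
  have f1 : F 0 1 = T t x := by
    simp only [hF, pow_zero, one_smul, mul_one]
    rw [h.zero _ ht]
  have f2 : ((∫ s, (s - 1) ^ 2 ∂μ) / 2) • F 2 1 =
      ((∫ s, (s - 1) ^ 2 ∂μ) / 2 * t ^ 2) • D 2 t x := by
    simp only [hF, mul_one, smul_smul, neg_sq]
  have f3 : ‖F 3 1‖ ≤ powBound T (3 - α) * (t ^ α * ‖y‖) := by
    have := h.norm_pow_mul_deriv_le 2 h0 h1 hxy ht one_pos
    rw [e3, Real.one_rpow, mul_one (powBound T (3 - α) * _)] at this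
    exact this
  rw [f0, f1, f2] at key
  refine key.trans ?_
  calc |bCoeff μ| * ‖F 3 1‖ + dCoeff μ / 2 * (powBound T (4 - α) * (t ^ α * ‖y‖))
      ≤ |bCoeff μ| * (powBound T (3 - α) * (t ^ α * ‖y‖)) +
        dCoeff μ / 2 * (powBound T (4 - α) * (t ^ α * ‖y‖)) := by gcongr
    _ = _ := by ring

/-- For the law of the mean, the variance is divided by `n` and `b` by `n²`, and `d₁` is at most
`d/n²`. The summand 1 in the constant ensures positivity; `|d|` avoids a sign condition on `d`. -/
theorem norm_iterate_hp_sub_le (h : IsSmoothing T D c K) {ν : Measure ℝ} (hν : IsNormalized ν)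
    {d : ℝ} {n : ℕ} (hn : 1 ≤ n)
    (hd : IntegrableOn (dIntegrand (meanLaw ν n)) (Ioi 0) ∧ dCoeff (meanLaw ν n) ≤ d / n ^ 2)
    {α : ℝ} (h0 : 0 ≤ α) (h1 : α ≤ 1) {x y : X} (hxy : (x, y) ∈ fracPowGraph T α) {t : ℝ}
    (ht : 0 < t) :
    ‖(hp T ν (t / n))^[n] x - T t x -
        ((∫ s, (s - 1) ^ 2 ∂ν) / 2 * (n : ℝ)⁻¹ * t ^ 2) • D 2 t x‖ ≤
      (|bCoeff ν| + |d| / 2 + 1) * (powBound T (3 - α) + powBound T (4 - α)) *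
        (t ^ α / (n : ℝ) ^ 2) * ‖y‖ := by
  have hn0 : (0 : ℝ) < n := by exact_mod_cast hn
  have key := h.norm_integral_sub_le (hν.meanLaw hn) hd.1 h0 h1 hxy ht
  have e : (∫ s, (s - 1) ^ 2 ∂(meanLaw ν n)) / 2 * t ^ 2 =
      (∫ s, (s - 1) ^ 2 ∂ν) / 2 * (n : ℝ)⁻¹ * t ^ 2 := by
    rw [hν.variance_meanLaw hn]; ring
  rw [← h.bdd.iterate_hp_div hν ht.le hn, e, hν.bCoeff_meanLaw hn, abs_div,
    abs_of_pos (by positivity : (0 : ℝ) < (n : ℝ) ^ 2)] at key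
  have hP3 := powBound_nonneg T (3 - α)
  have hP4 := powBound_nonneg T (4 - α)
  have hd' : dCoeff (meanLaw ν n) ≤ |d| / n ^ 2 :=
    hd.2.trans (by gcongr; exact le_abs_self d)
  refine key.trans ?_
  calc (|bCoeff ν| / n ^ 2 * powBound T (3 - α) +
        dCoeff (meanLaw ν n) / 2 * powBound T (4 - α)) * (t ^ α * ‖y‖)
      ≤ (|bCoeff ν| / n ^ 2 * powBound T (3 - α) +
        |d| / n ^ 2 / 2 * powBound T (4 - α)) * (t ^ α * ‖y‖) := by gcongr
    _ = (|bCoeff ν| * powBound T (3 - α) + |d| / 2 * powBound T (4 - α)) *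
        (t ^ α / n ^ 2) * ‖y‖ := by ring
    _ ≤ _ := by
        have := abs_nonneg (bCoeff ν)
        have := abs_nonneg d
        gcongr ?_ * _ * _
        nlinarith [mul_nonneg (abs_nonneg (bCoeff ν)) hP4, mul_nonneg (abs_nonneg d) hP3]

end IsSmoothing

end Approximation

end

end SemigroupApprox

theorem mainTheorem6 (g : ℝ → ℝ) (hg : g ∈ SemigroupApprox.B₄)
    (hL : ∃ k : ℕ, 1 ≤ k ∧
      MeasureTheory.MemLp g k (MeasureTheory.volume.restrict (Set.Ioi (0 : ℝ)))) :
    -- `g` has a representing measure, and everything below holds for it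
    (∃ ν : MeasureTheory.Measure ℝ, SemigroupApprox.Represents g ν) ∧
    ∀ ν : MeasureTheory.Measure ℝ, SemigroupApprox.Represents g ν →
      -- the integrals defining `b[g]` and `d₁[g]` converge
      MeasureTheory.IntegrableOn (SemigroupApprox.bIntegrand ν) (Set.Ioi 0) ∧
      MeasureTheory.IntegrableOn (SemigroupApprox.dIntegrand ν) (Set.Ioi 0) ∧
      -- the constant depends on `g` alone
      ∃ C : ℝ, 0 < C ∧
        ∀ (X : Type u) [NormedAddCommGroup X] [NormedSpace ℂ X] [CompleteSpace X]
          (T : ℝ → X →L[ℂ] X) (A : X →ₗ.[ℂ] X),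
          SemigroupApprox.IsSectBddHolomorphic T → SemigroupApprox.IsNegGenerator T A →
          ∀ α : ℝ, 0 ≤ α → α ≤ 1 →
            -- `M_{3-α}` and `M_{4-α}` are suprema of norms of everywhere defined operators,
            -- and they are finite
            (∀ β ∈ ({3 - α, 4 - α} : Set ℝ),
              (∀ t : ℝ, 0 < t → ∀ x : X,
                ∃ y : X, (T t x, y) ∈ SemigroupApprox.fracPowGraph T β) ∧
              BddAbove (SemigroupApprox.powBoundSet T β)) ∧
            ∀ x y : X, (x, y) ∈ SemigroupApprox.fracPowGraph T α →
              -- the estimate for the single function `g`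
              (∃ u v : X, (T 1 x, u) ∈ A.graph ∧ (u, v) ∈ A.graph ∧
                ‖SemigroupApprox.hp T ν 1 x - T 1 x - SemigroupApprox.aCoeff g • v‖ ≤
                  (|SemigroupApprox.bCoeff ν| * SemigroupApprox.powBound T (3 - α) +
                    SemigroupApprox.dCoeff ν / 2 * SemigroupApprox.powBound T (4 - α)) * ‖y‖) ∧
              -- the second order approximation formula
              ∀ (n : ℕ) (t : ℝ), 1 ≤ n → 0 < t →
                ∃ u v : X, (T t x, u) ∈ A.graph ∧ (u, v) ∈ A.graph ∧
                  ‖(SemigroupApprox.hp T ν (t / n))^[n] x - T t x -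
                      (SemigroupApprox.aCoeff g * (n : ℝ)⁻¹ * t ^ 2) • v‖ ≤
                    C * (SemigroupApprox.powBound T (3 - α) + SemigroupApprox.powBound T (4 - α)) *
                      (t ^ α / (n : ℝ) ^ 2) * ‖y‖ := by
  have h0 : Filter.Tendsto g (nhdsWithin 0 (Set.Ioi 0)) (nhds 1) := by
    have := hg.1.1.2.1
    rwa [SemigroupApprox.HasDerivZero, iteratedDeriv_zero] at this
  obtain ⟨k, hk, hL⟩ := hL
  refine ⟨hg.1.1.1.1.isCMChain.exists_represents h0, fun ν hν => ?_⟩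
  obtain ⟨hN, ha, C₀, hC₀, hgC⟩ := hν.isNormalized hg hk hL
  obtain ⟨d, hd⟩ := hN.exists_dCoeff_meanLaw_le hC₀ hk hgC
  have := hN.prob
  -- The case `n = 1`, where the law of the mean is `ν` itself.
  have hd1 : MeasureTheory.IntegrableOn (SemigroupApprox.dIntegrand ν) (Set.Ioi 0) := by
    have := (hd 1 le_rfl).1
    rwa [SemigroupApprox.meanLaw_one] at this
  refine ⟨hN.integrable_bIntegrand, hd1, |SemigroupApprox.bCoeff ν| + |d| / 2 + 1, by positivity,
    fun X _ _ _ T A hT hA α hα0 hα1 => ?_⟩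
  obtain ⟨D, c, K, h⟩ := hT.exists_isSmoothing
  -- The exponents `3 - α` and `4 - α` are the cases `k = 2` and `k = 3` of `k + 1 - α`.
  have e3 : (((2 : ℕ) : ℝ) + 1 - α) = 3 - α := by norm_num
  have e4 : (((3 : ℕ) : ℝ) + 1 - α) = 4 - α := by norm_num
  have hdom : ∀ k : ℕ, (∀ t : ℝ, 0 < t → ∀ x : X,
      ∃ y : X, (T t x, y) ∈ SemigroupApprox.fracPowGraph T (k + 1 - α)) ∧
      BddAbove (SemigroupApprox.powBoundSet T (k + 1 - α)) := fun k => by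
    obtain ⟨_, -, hy⟩ := h.exists_mem_fracPowGraph k hα0 hα1
    exact ⟨fun t ht x => (hy t ht x).imp fun y hy => hy.1, h.bddAbove_powBoundSet k hα0 hα1⟩
  have hgr : ∀ t : ℝ, 0 < t → ∀ x : X,
      (T t x, D 1 t x) ∈ A.graph ∧ (D 1 t x, D 2 t x) ∈ A.graph := fun t ht x => by
    refine ⟨?_, h.mem_graph hA 1 ht x⟩
    rw [← h.zero t ht]
    exact h.mem_graph hA 0 ht x
  refine ⟨fun β hβ => ?_, fun x y hxy => ⟨?_, fun n t hn ht => ?_⟩⟩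
  · rcases hβ with rfl | rfl
    · rw [← e3]; exact hdom 2
    · rw [← e4]; exact hdom 3
  · refine ⟨D 1 1 x, D 2 1 x, (hgr 1 one_pos x).1, (hgr 1 one_pos x).2, ?_⟩
    have key := h.norm_integral_sub_le hN hd1 hα0 hα1 hxy one_pos
    rw [Real.one_rpow, one_pow, mul_one, one_mul, ← ha] at key
    exact key
  · refine ⟨D 1 t x, D 2 t x, (hgr t ht x).1, (hgr t ht x).2, ?_⟩
    rw [ha]
    exact h.norm_iterate_hp_sub_le hN hn (hd n hn) hα0 hα1 hxy ht
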